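/- Let $n\ge 1$ and let $M$ be a smooth manifold of dimension $n$ (Hausdorff, second countable). A \emph{codimension-$1$ divergence-free $n$-web} $\mathcal W_\Omega=(M,\mathcal F_1,\dots,\mathcal F_n,\Omega)$ consists of $n$ smooth codimension-$1$ foliations $\mathcal F_i$ of $M$ in general position, i.e. $\operatorname{codim}\bigcap_i T_p\mathcal F_i=\sum_i\operatorname{codim}T_p\mathcal F_i$ for every $p\in M$, and a smooth nowhere-vanishing $n$-form $\Omega$ on $M$. An \emph{adapted chart} is a smooth chart $\varphi=(x_1,\dots,x_n)$ whose image is a bounded open box $\prod_i(a_i,b_i)$ and for which $T\mathcal F_i=\ker dx_i$ for all $i$. A \emph{region bounded by leaves} is a set which in some adapted chart is a closed coordinate box $[\![p,q]\!]=\{x:\ x_i\text{ lies between }x_i(p)\text{ and }x_i(q)\text{ for all }i\}$ with $p,q$ in the chart domain. Its $\Omega$-volume is $|\int_C\Omega|$. Regions $A,B$ are \emph{adjacent along} $\mathcal F_i$ if $A\cup B$ is a region and $A\cap B$ is contained in a leaf of $\mathcal F_i$. An open subset $F$ of a leaf \emph{subdivides} a region $K$ into regions $A,B$ if $K=A\cup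 B$ and $A\cap B\subseteq F$. The web is \emph{locally trivial} if each point has a neighbourhood with a diffeomorphism onto an open subset of $\mathbb R^n$ which carries $\Omega$ to $dx_1\wedge\dots\wedge dx_n$ and the foliations $\mathcal F_i$, up to a permutation, to the foliations by the hyperplanes $x_i=\mathrm{const}$. For $p\in M$ the \emph{volume-preserving reflection} $r_{p;\mathcal F_i}$ through $\mathcal F_i$ anchored at $p$ is the germ at $p$ of a smooth map $(M,p)\to(M,p)$ such that, in an adapted chart centred at $p$, for all $q$ near $p$ lying on none of the leaves through $p$, the point $q'=r_{p;\mathcal F_i}(q)$ is different from $q$, and the regions $[\![p,q]\!]$ and $[\![p,q']\!]$ are adjacent along $\mathcal F_i$ and have equal $\Omega$-volumes. Let $\mathcal R_p$ be the group of diffeomorphism germs at $p$ generated by the $r_{p;\mathcal F_i}$, $i=1,\dots,n$. The \emph{reflection holonomy group} at $p$ is the commutator subgroup $[\mathcal R_p,\mathcal R_p]$. The \emph{nonuniformity tensor} is the symmetric $2$-tensor field given in adapted charts by $\mathcal K(\mathcal W_\Omega)=\sum_{i\ne j}\frac{\partial^2\log|h|}{\partial x_i\,\partial x_j}\,dx_i\,dx_j$,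 where $\Omega=h\,dx_1\wedge\dots\wedge dx_n$. \textbf{Theorem.} For a codimension-$1$ divergence-free $n$-web $\mathcal W_\Omega=(M,\mathcal F_1,\dots,\mathcal F_n,\Omega)$ on an $n$-manifold, the following conditions are equivalent. (1) $\mathcal W_\Omega$ is locally trivial. (2) For any two different foliations $\mathcal F,\mathcal G$ of the web, any region $K$ bounded by leaves, and any open subsets $F,G$ of leaves of $\mathcal F,\mathcal G$ respectively which subdivide $K$ into four subregions $A,B,C,D$ (with $F$ subdividing $K$ into the regions $A\cup B$ and $C\cup D$, so $(A\cup B)\cap(C\cup D)\subseteq F$, and $G$ subdividing $K$ into the regions $A\cup D$ and $B\cup C$, so $(A\cup D)\cap(B\cup C)\subseteq G$), the $\Omega$-volumes $a,b,c,d$ of $A,B,C,D$ satisfy $ac=bd$. (3) For all $\mathcal F,\mathcal G,K,F,G,A,B,C,D$ as in (2) with $a+b=c+d$, the equality $a=b$ implies $a=b=c=d$. (4) For any region $K$ bounded by leaves and each $k=1,\dots,n$ there exist open subsets $F_i$ of leaves of $\mathcal F_i$, $i=1,\dots,k$, which subdivide $K$ into $2^k$ subregions with equal $\Omega$-volumes.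 (5) The volume-preserving reflection holonomy group of $\mathcal W_\Omega$ at each point $p\in M$ is trivial. (6) The nonuniformity tensor $\mathcal K(\mathcal W_\Omega)$ vanishes identically. -/

import Mathlib

open scoped Manifold ContDiff Topology
open Set Filter

noncomputable section

/-- Euclidean space `ℝⁿ`. -/
abbrev Euc (n : ℕ) : Type := EuclideanSpace ℝ (Fin n)

/-- The `i`-th standard basis vector of `ℝⁿ`. -/
abbrev stdVec {n : ℕ} (i : Fin n) : Euc n := EuclideanSpace.single i (1 : ℝ)

/-- The `i`-th coordinate functional on `ℝⁿ`. -/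
abbrev stdCoord {n : ℕ} (i : Fin n) : Euc n →L[ℝ] ℝ := EuclideanSpace.proj i

section Foliations

variable (n : ℕ) (M : Type*) [TopologicalSpace M] [ChartedSpace (Euc n) M]

/-- `f` is a smooth submersion on the open set `U` whose level sets are tangent to the field of
tangent subspaces `D`. -/
def IsDistinguished {n : ℕ} {M : Type*} [TopologicalSpace M] [ChartedSpace (Euc n) M]
    (D : ∀ p : M, Submodule ℝ (TangentSpace (𝓡 n) p)) (U : Set M) (f : M → ℝ) : Prop :=
  IsOpen U ∧ ContMDiffOn (𝓡 n) 𝓘(ℝ, ℝ) ∞ f U ∧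
    ∀ x ∈ U, mfderiv (𝓡 n) 𝓘(ℝ, ℝ) f x ≠ 0 ∧
      ∀ v : TangentSpace (𝓡 n) x, v ∈ D x ↔ mfderiv (𝓡 n) 𝓘(ℝ, ℝ) f x v = 0

/-- A smooth codimension-`1` foliation of `M`, given by its tangent spaces: a completely
integrable field of hyperplanes, i.e. one which is locally tangent to the level sets of smooth
submersions to `ℝ`. -/
structure Foliation where
  /-- the tangent space of the foliation at a point -/
  tangent : ∀ p : M, Submodule ℝ (TangentSpace (𝓡 n) p)
  integrable : ∀ p : M, ∃ (U : Set M) (f : M → ℝ), p ∈ U ∧ IsDistinguished tangent U f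

/-- A smooth nowhere-vanishing field of alternating `n`-forms on the `n`-manifold `M`. -/
structure VolumeForm where
  /-- the value of the form at a point -/
  form : ∀ p : M, (TangentSpace (𝓡 n) p) [⋀^Fin n]→ₗ[ℝ] ℝ
  smooth : ∀ e ∈ IsManifold.maximalAtlas (𝓡 n) ∞ M,
    ContDiffOn ℝ ∞ (fun y : Euc n => form (e.symm y)
      (fun i => mfderiv (𝓡 n) (𝓡 n) e.symm y (stdVec i))) e.target
  ne_zero : ∀ p : M, form p ≠ 0

/-- A regular codimension-`1` `n`-web on the `n`-manifold `M`: the tangent spaces of the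
foliations satisfy `codim ⋂ TF_i = ∑ codim TF_i` at each point. -/
structure Web where
  /-- the foliations of the web -/
  fol : Fin n → Foliation n M
  general_position : ∀ p : M,
    Module.finrank ℝ (TangentSpace (𝓡 n) p ⧸ (⨅ i, (fol i).tangent p)) =
      ∑ i, Module.finrank ℝ (TangentSpace (𝓡 n) p ⧸ (fol i).tangent p)

/-- A codimension-`1` divergence-free `n`-web on the `n`-manifold `M`. -/
structure DivergenceFreeWeb extends Web n M where
  /-- the volume form -/
  Ω : VolumeForm n M

end Foliations

namespace Foliation

variable {n : ℕ} {M : Type*} [TopologicalSpace M] [ChartedSpace (Euc n) M]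

/-- The leaf topology of a foliation, generated by the (small pieces of) level sets of
distinguished submersions. -/
@[reducible] def leafTopology (F : Foliation n M) : TopologicalSpace M :=
  TopologicalSpace.generateFrom
    {S | ∃ (U : Set M) (f : M → ℝ) (c : ℝ), IsDistinguished F.tangent U f ∧
      S = {x | x ∈ U ∧ f x = c}}

/-- The leaf through `p`: the connected component of `p` in the leaf topology. -/
def leaf (F : Foliation n M) (p : M) : Set M :=
  @connectedComponent M F.leafTopology p

/-- `S` is an open subset of a leaf (open in the topology of the leaf). -/
def IsOpenSubsetOfLeaf (F : Foliation n M) (S : Set M) : Prop :=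
  IsOpen[F.leafTopology] S ∧ ∃ p : M, S ⊆ F.leaf p

end Foliation

/-! ### Adapted charts and regions bounded by leaves -/

section Regions

variable {n : ℕ} {M : Type*} [TopologicalSpace M] [ChartedSpace (Euc n) M]

/-- The coordinate box spanned by `p` and `q` in the chart `e`: the points whose `i`-th
coordinate is between those of `p` and `q`, for all `i`. -/
def chartBox (e : OpenPartialHomeomorph M (Euc n)) (p q : M) : Set M :=
  {x | x ∈ e.source ∧ ∀ i, e x i ∈ Set.uIcc (e p i) (e q i)}

/-- The differential `dxᵢ` at `p` of the `i`-th coordinate of the chart `e`. -/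
def coordDifferential (e : OpenPartialHomeomorph M (Euc n)) (p : M) (i : Fin n) :
    TangentSpace (𝓡 n) p →ₗ[ℝ] ℝ :=
  (stdCoord i).toLinearMap ∘ₗ
    (mfderiv (𝓡 n) (𝓡 n) e p : TangentSpace (𝓡 n) p →L[ℝ] Euc n).toLinearMap

namespace Web

variable (W : Web n M)

/-- A chart adapted to the web: it is smooth, cubical, and the leaves of the `i`-th foliation are
locally the level sets of the `i`-th coordinate. -/
def IsAdaptedChart (e : OpenPartialHomeomorph M (Euc n)) : Prop :=
  e ∈ IsManifold.maximalAtlas (𝓡 n) ∞ M ∧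
  (∃ a b : Fin n → ℝ, e.target = {y | ∀ i, y i ∈ Set.Ioo (a i) (b i)}) ∧
  ∀ x ∈ e.source, ∀ i, (W.fol i).tangent x = LinearMap.ker (coordDifferential e x i)

/-- A region bounded by leaves: a coordinate box of some adapted chart. -/
def IsRegion (K : Set M) : Prop :=
  ∃ e, W.IsAdaptedChart e ∧ ∃ p ∈ e.source, ∃ q ∈ e.source, K = chartBox e p q

/-- The regions `A` and `B` are adjacent along a leaf of the `i`-th foliation. -/
def AdjacentAlong (i : Fin n) (A B : Set M) : Prop :=
  W.IsRegion A ∧ W.IsRegion B ∧ W.IsRegion (A ∪ B) ∧ ∃ p : M, A ∩ B ⊆ (W.fol i).leaf p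

/-- The open subset `F` of a leaf of the `i`-th foliation subdivides the region `K` into the
subregions `A` and `B`. -/
def Subdivides (i : Fin n) (F K A B : Set M) : Prop :=
  (W.fol i).IsOpenSubsetOfLeaf F ∧
  W.IsRegion K ∧ W.IsRegion A ∧ W.IsRegion B ∧ A ∪ B = K ∧ A ∩ B ⊆ F

/-- Open subsets `F`, `G` of leaves of the `i`-th and the `j`-th foliation subdivide the region
`K` into four subregions `A`, `B`, `C`, `D`, so that `F` separates `A ∪ B` from `C ∪ D`
and `G` separates `A ∪ D` from `B ∪ C`. -/
def SubdividesIntoFour (i j : Fin n) (F G K A B C D : Set M) : Prop :=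
  W.IsRegion A ∧ W.IsRegion B ∧ W.IsRegion C ∧ W.IsRegion D ∧
  W.Subdivides i F K (A ∪ B) (C ∪ D) ∧ W.Subdivides j G K (A ∪ D) (B ∪ C)

/-- Open subsets `F 0, …, F (k-1)` of leaves of the first `k` foliations subdivide the region `K`
into `2^k` subregions `R s`, where `s l` tells on which side of `F l` the subregion `R s` lies. -/
def SubdividesIntoPow {k : ℕ} (hk : k ≤ n) (F : Fin k → Set M) (K : Set M)
    (R : (Fin k → Bool) → Set M) : Prop :=
  (∀ s, W.IsRegion (R s)) ∧ (⋃ s, R s) = K ∧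
  ∀ l : Fin k, W.Subdivides (Fin.castLE hk l) (F l) K
    (⋃ s ∈ {s : Fin k → Bool | s l = false}, R s) (⋃ s ∈ {s : Fin k → Bool | s l = true}, R s)

end Web

end Regions

/-! ### Germs of diffeomorphisms -/

section Germs

variable {n : ℕ} {M : Type*} [TopologicalSpace M] [ChartedSpace (Euc n) M]

/-- `f` is smooth on a neighbourhood of `p` and fixes `p`. -/
def IsSmoothNear (n : ℕ) {M : Type*} [TopologicalSpace M] [ChartedSpace (Euc n) M]
    (p : M) (f : M → M) : Prop :=
  f p = p ∧ ∀ᶠ x in 𝓝 p, ContMDiffAt (𝓡 n) (𝓡 n) ∞ f x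

theorem IsSmoothNear.tendsto {p : M} {f : M → M} (hf : IsSmoothNear n p f) :
    Tendsto f (𝓝 p) (𝓝 p) := by
  have h := (hf.2.self_of_nhds).continuousAt.tendsto
  rwa [hf.1] at h

theorem IsSmoothNear.id (p : M) : IsSmoothNear n p (fun x : M => x) :=
  ⟨rfl, Eventually.of_forall fun _ => contMDiffAt_id⟩

theorem IsSmoothNear.comp {p : M} {f g : M → M} (hf : IsSmoothNear n p f)
    (hg : IsSmoothNear n p g) : IsSmoothNear n p (f ∘ g) := by
  refine ⟨by simp [hf.1, hg.1], ?_⟩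
  filter_upwards [hg.2, hg.tendsto.eventually hf.2] with x h1 h2
  exact ContMDiffAt.comp x h2 h1

/-- Functions smooth near `p` and fixing `p`, up to equality near `p`. -/
instance smoothGermSetoid (n : ℕ) {M : Type*} [TopologicalSpace M] [ChartedSpace (Euc n) M]
    (p : M) : Setoid {f : M → M // IsSmoothNear n p f} where
  r f g := f.1 =ᶠ[𝓝 p] g.1
  iseqv := ⟨fun _ => EventuallyEq.rfl, fun h => h.symm, fun h h' => h.trans h'⟩

/-- Germs at `p` of smooth maps `(M, p) → (M, p)`. -/
def SmoothGerm (n : ℕ) {M : Type*} [TopologicalSpace M] [ChartedSpace (Euc n) M] (p : M) :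
    Type _ :=
  Quotient (smoothGermSetoid n p)

/-- The germ of a map. -/
def SmoothGerm.mk {p : M} (f : M → M) (hf : IsSmoothNear n p f) : SmoothGerm n p :=
  Quotient.mk (smoothGermSetoid n p) ⟨f, hf⟩

/-- Germs form a monoid under composition. -/
instance (p : M) : Monoid (SmoothGerm n p) where
  mul := Quotient.map₂ (fun f g => ⟨f.1 ∘ g.1, f.2.comp g.2⟩) (by
    intro f f' hf g g' hg
    have h1 : f.1 ∘ g.1 =ᶠ[𝓝 p] f'.1 ∘ g.1 := g.2.tendsto.eventually hf
    have h2 : f'.1 ∘ g.1 =ᶠ[𝓝 p] f'.1 ∘ g'.1 := EventuallyEq.fun_comp hg f'.1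
    exact h1.trans h2)
  one := SmoothGerm.mk (fun x => x) (IsSmoothNear.id p)
  mul_assoc a b c := by
    induction a using Quotient.inductionOn
    induction b using Quotient.inductionOn
    induction c using Quotient.inductionOn
    rfl
  one_mul a := by
    induction a using Quotient.inductionOn
    rfl
  mul_one a := by
    induction a using Quotient.inductionOn
    rfl

/-- The group `Diff(M, p)` of germs at `p` of diffeomorphisms fixing `p`: the germs of smooth
maps which have a two-sided inverse germ. -/
abbrev DiffGerm (n : ℕ) {M : Type*} [TopologicalSpace M] [ChartedSpace (Euc n) M] (p : M) :
    Type _ :=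
  (SmoothGerm n p)ˣ

end Germs

/-! ### Divergence-free webs -/

namespace DivergenceFreeWeb

variable {n : ℕ} {M : Type*} [TopologicalSpace M] [ChartedSpace (Euc n) M]

/-- The coefficient `h` of the volume form in the chart `e`, as a function of the coordinates:
`Ω = h dx₁ ∧ ⋯ ∧ dxₙ`. -/
def density (W : DivergenceFreeWeb n M) (e : OpenPartialHomeomorph M (Euc n)) (y : Euc n) : ℝ :=
  W.Ω.form (e.symm y) (fun i => mfderiv (𝓡 n) (𝓡 n) e.symm y (stdVec i))

open Classical in
/-- The `Ω`-volume `|∫_C Ω|` of a connected compact set `C` lying in the domain of some smooth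
chart, computed in any such chart (the value does not depend on the chart). -/
def vol (W : DivergenceFreeWeb n M) (C : Set M) : ℝ :=
  if h : ∃ e ∈ IsManifold.maximalAtlas (𝓡 n) ∞ M, C ⊆ e.source then
    |∫ y in h.choose '' C, W.density h.choose y|
  else 0

/-- `e` is a local equivalence of divergence-free webs: a diffeomorphism between open subsets which
carries the foliations to the foliations, up to a permutation, and the volume form to the volume
form. -/
def IsLocalEquivalence {N : Type*} [TopologicalSpace N] [ChartedSpace (Euc n) N]
    (W : DivergenceFreeWeb n M) (W' : DivergenceFreeWeb n N) (e : OpenPartialHomeomorph M N) :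
    Prop :=
  ContMDiffOn (𝓡 n) (𝓡 n) ∞ e e.source ∧ ContMDiffOn (𝓡 n) (𝓡 n) ∞ e.symm e.target ∧
  (∃ σ : Equiv.Perm (Fin n), ∀ x ∈ e.source, ∀ i, ∀ v : TangentSpace (𝓡 n) x,
    v ∈ (W.fol i).tangent x ↔
      mfderiv (𝓡 n) (𝓡 n) e x v ∈ (W'.fol (σ i)).tangent (e x)) ∧
  ∀ x ∈ e.source, ∀ v : Fin n → TangentSpace (𝓡 n) x,
    W'.Ω.form (e x) (fun i => mfderiv (𝓡 n) (𝓡 n) e x (v i)) = W.Ω.form x v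

/-! #### Reflections and holonomy -/

/-- `r` represents the germ at `p` of the volume-preserving reflection through the `i`-th foliation
anchored at `p`: it is smooth, and, in an adapted chart centred at `p`, it maps each point `q`
near `p` that lies on none of the leaves through `p` to a point `r q ≠ q` such that
the regions `⟦p, q⟧` and `⟦p, r q⟧` are adjacent along the `i`-th foliation and have equal
`Ω`-volumes. -/
def IsReflection (W : DivergenceFreeWeb n M) (i : Fin n) (p : M) (r : M → M) : Prop :=
  IsSmoothNear n p r ∧
  ∃ e, W.IsAdaptedChart e ∧ p ∈ e.source ∧ e p = 0 ∧
    ∀ᶠ q in 𝓝 p, (∀ j, e q j ≠ 0) →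
      r q ∈ e.source ∧ r q ≠ q ∧
      W.AdjacentAlong i (chartBox e p q) (chartBox e p (r q)) ∧
      W.vol (chartBox e p q) = W.vol (chartBox e p (r q))

/-- The group `R_p` of germs generated by the volume-preserving reflections anchored at `p`. -/
def reflectionGroup (W : DivergenceFreeWeb n M) (p : M) : Subgroup (DiffGerm n p) :=
  Subgroup.closure {u | ∃ (i : Fin n) (r : M → M) (h : W.IsReflection i p r),
    (u : SmoothGerm n p) = SmoothGerm.mk r h.1}

/-- The volume-preserving reflection holonomy group `[R_p, R_p]` of the web at `p`. -/
def reflectionHolonomy (W : DivergenceFreeWeb n M) (p : M) : Subgroup (DiffGerm n p) :=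
  ⁅W.reflectionGroup p, W.reflectionGroup p⁆

/-! #### The nonuniformity tensor -/

/-- The second partial derivative `∂² log |h| / ∂xᵢ∂xⱼ` at the point with coordinates `y`, where
`Ω = h dx₁ ∧ ⋯ ∧ dxₙ` in the chart `e` (`Real.log h` is `log |h|`). -/
def logDensityPartial (W : DivergenceFreeWeb n M) (e : OpenPartialHomeomorph M (Euc n))
    (i j : Fin n) (y : Euc n) : ℝ :=
  fderiv ℝ (fun z => fderiv ℝ (fun z' => Real.log (W.density e z')) z (stdVec j)) y (stdVec i)

open Classical in
/-- The nonuniformity tensor `∑_{i ≠ j} (∂² log |h| / ∂xᵢ∂xⱼ) dxᵢ dxⱼ` at `p`, computed in any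
adapted chart around `p` (such charts exist and the value does not depend on the chart). -/
def nonuniformity (W : DivergenceFreeWeb n M) (p : M) :
    TangentSpace (𝓡 n) p →ₗ[ℝ] TangentSpace (𝓡 n) p →ₗ[ℝ] ℝ :=
  if h : ∃ e, W.IsAdaptedChart e ∧ p ∈ e.source then
    ∑ i, ∑ j ∈ Finset.univ.filter (fun j => i ≠ j),
      W.logDensityPartial h.choose i j (h.choose p) •
        (coordDifferential h.choose p i).smulRight (coordDifferential h.choose p j)
  else 0

end DivergenceFreeWeb

/-! ### The standard divergence-free web and local triviality -/

section Standard

variable (n : ℕ)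

/-- The foliation of `ℝⁿ` by the hyperplanes `xᵢ = const`. -/
def standardFoliation (i : Fin n) : Foliation n (Euc n) where
  tangent _ := LinearMap.ker (stdCoord i).toLinearMap
  integrable p := by
    refine ⟨Set.univ, stdCoord i, Set.mem_univ _, isOpen_univ, ?_, ?_⟩
    · exact (stdCoord i).contMDiff.contMDiffOn
    · intro x _
      rw [mfderiv_eq_fderiv, ContinuousLinearMap.fderiv]
      refine ⟨fun h => ?_, fun v => Iff.rfl⟩
      have h1 := DFunLike.congr_fun h (stdVec i)
      have h2 : (stdCoord i) (stdVec i) = 1 := by simp [stdCoord, stdVec]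
      exact (one_ne_zero : (1 : ℝ) ≠ 0) (h2.symm.trans h1)

/-- The form `dx₁ ∧ ⋯ ∧ dxₙ` on `ℝⁿ`. -/
def lebesgueForm : VolumeForm n (Euc n) where
  form _ := (EuclideanSpace.basisFun (Fin n) ℝ).toBasis.det
  smooth e he := by
    have h1 : ContDiffOn ℝ ∞ e.symm e.target :=
      (contMDiffOn_symm_of_mem_maximalAtlas he).contDiffOn
    have h2 : ContDiffOn ℝ ∞ (fderiv ℝ e.symm) e.target :=
      h1.fderiv_of_isOpen e.open_target (by simp)
    have h3 : ∀ i j : Fin n, ContDiffOn ℝ ∞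
        (fun y => stdCoord i (fderiv ℝ e.symm y (stdVec j))) e.target := fun i j =>
      (stdCoord i).contDiff.comp_contDiffOn (h2.clm_apply contDiffOn_const)
    have h4 : ContDiffOn ℝ ∞ (fun y => ∑ σ : Equiv.Perm (Fin n), ((Equiv.Perm.sign σ : ℤ) : ℝ) *
        ∏ i, stdCoord (σ i) (fderiv ℝ e.symm y (stdVec i))) e.target :=
      ContDiffOn.sum fun σ _ => contDiffOn_const.mul (contDiffOn_prod fun i _ => h3 _ _)
    refine h4.congr fun y _ => ?_
    simp only [mfderiv_eq_fderiv]
    refine (Matrix.det_apply' _).trans ?_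
    rfl
  ne_zero _ := (EuclideanSpace.basisFun (Fin n) ℝ).toBasis.det_ne_zero

/-- The standard divergence-free web on `ℝⁿ`: the foliations by the hyperplanes `xᵢ = const` and the
form `dx₁ ∧ ⋯ ∧ dxₙ`. -/
def standardWeb : DivergenceFreeWeb n (Euc n) where
  fol := standardFoliation n
  general_position p := by
    have h1 : (⨅ i, (standardFoliation n i).tangent p) = ⊥ := by
      rw [eq_bot_iff]
      intro v hv
      rw [Submodule.mem_iInf] at hv
      have h : (show Euc n from v) = 0 := by
        ext i
        exact hv i
      exact h
    have h2 : ∀ i, Module.finrank ℝ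
        (TangentSpace (𝓡 n) p ⧸ (standardFoliation n i).tangent p) = 1 := by
      intro i
      have hs : Function.Surjective (stdCoord i).toLinearMap := fun c => by
        refine ⟨c • stdVec i, ?_⟩
        simp [stdCoord, stdVec]
      have := ((stdCoord i).toLinearMap.quotKerEquivOfSurjective hs).finrank_eq
      rw [Module.finrank_self] at this
      exact this
    rw [h1, Finset.sum_congr rfl fun i _ => h2 i]
    have h3 := (Submodule.quotEquivOfEqBot (⊥ : Submodule ℝ (Euc n)) rfl).finrank_eq
    rw [finrank_euclideanSpace_fin] at h3
    simpa using! h3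
  Ω := lebesgueForm n

end Standard

/-- A divergence-free web is locally trivial if around each point it is locally equivalent to the
standard divergence-free web on `ℝⁿ`. -/
def DivergenceFreeWeb.IsLocallyTrivial {n : ℕ} {M : Type*} [TopologicalSpace M]
    [ChartedSpace (Euc n) M] (W : DivergenceFreeWeb n M) : Prop :=
  ∀ p : M, ∃ e : OpenPartialHomeomorph M (Euc n),
    p ∈ e.source ∧ W.IsLocalEquivalence (standardWeb n) e

end

/-!
All conditions are equivalent to the vanishing, in every adapted chart, of the mixed second
derivatives of `log |h|`, where `Ω = h dx₁ ∧ ⋯ ∧ dxₙ` (`DivergenceFreeWeb.MixedPartialsVanish`).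
Transition maps between adapted charts have the form `(xᵢ) ↦ (φᵢ(xᵢ))`, so they change `log |h|` by a
sum of functions of one variable and multiply its mixed derivatives by nonzero factors; hence it is
enough to look at one adapted chart around each point, and the condition is the vanishing of the
nonuniformity tensor. On a box the mixed derivatives vanish exactly when `|h|` is a product of
functions of the single coordinates
(`DivergenceFreeWeb.MixedPartialsVanish.exists_isProductDensity`).

For a product density, integrals over boxes are products of integrals over intervals. This gives
`ac = bd`, subdivisions into equal parts by the hyperplanes through the medians of the factors, and,
by taking primitives of the factors as new coordinates, local triviality. A volume-preserving
reflection then only exchanges the two sides of a hyperplane in such a way that the integral of one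
factor is preserved, so any two reflections at a point commute. In all of this one has to know that
the leaf pieces in the definitions of adjacency and subdivision appear in a chart as hyperplanes: a
leaf meets a chart in countably many plaques, by second countability, so a connected set in
a leaf and a chart lies in one plaque (`Web.IsAdaptedChart.eq_of_subset_leaf`).

Conversely, the subdivision conditions imply that, whenever `xᵢ = c` halves a box and `xⱼ = d` halves
one of the two halves, `xⱼ = d` also halves the other one (`BisectionCompatible`). By continuity and
repeated bisection the hyperplane `xⱼ = d` then halves every slab of the box, and the volume of a
part of the box is the product of its shares in the directions `i` and `j`
(`IsBisectionRect.mul_eq_mul`). Applied to small cubes this is a relation between the values of the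
density at the vertices of coordinate rectangles, which makes the double differences of `log |h|`
vanish (`BisectionCompatible.mul_eq_mul`). Only the case `k = n` of the subdivision into `2 ^ k` parts
is needed here.

For the holonomy, let `f(y)` be the mean value of `|h|` over the box spanned by `0` and `y` in an
adapted chart centred at `p`. The reflection in the direction `i` replaces `yᵢ` by the number `s` with
`s f(…, s, …) = -yᵢ f(y)`; the inverse function theorem shows that it exists and is a smooth involution
(`exists_involution`). If the reflections in the directions `i` and `j` commute, then a point, its
two reflections and their common reflection form a coordinate rectangle over which `log f` has
vanishing double difference, so `∂ᵢ∂ⱼ log f = 0` at `0`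
(`fderiv_fderiv_log_eq_zero_of_commute`). As `∂ᵢ∂ⱼ log f = ¼ ∂ᵢ∂ⱼ log |h|` at `0`
(`fderiv_fderiv_log_boxMean`), the mixed derivatives of `log |h|` vanish at `p`.
-/

/-! ### Adapted charts -/

theorem exists_cube_subset {n : ℕ} {y₀ : Euc n} {O : Set (Euc n)} (hO : O ∈ 𝓝 y₀) :
    ∃ ε > 0, ∀ y : Euc n, (∀ i, |y i - y₀ i| < ε) → y ∈ O := by
  have h1 : (WithLp.toLp 2 : (Fin n → ℝ) → Euc n) ⁻¹' O ∈ 𝓝 (WithLp.ofLp y₀) :=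
    (PiLp.continuous_toLp 2 _).continuousAt.preimage_mem_nhds hO
  obtain ⟨ε, hε, h⟩ := Metric.mem_nhds_iff.1 h1
  refine ⟨ε, hε, fun y hy => ?_⟩
  have : WithLp.ofLp y ∈ Metric.ball (WithLp.ofLp y₀) ε := by
    rw [Metric.mem_ball, dist_pi_lt_iff hε]
    intro i
    rw [Real.dist_eq]
    exact hy i
  exact h this

theorem isOpen_openBox {n : ℕ} (a b : Fin n → ℝ) :
    IsOpen {y : Euc n | ∀ i, y i ∈ Ioo (a i) (b i)} := by
  simp only [ofPred_forall]
  exact isOpen_iInter_of_finite fun i => isOpen_Ioo.preimage (stdCoord i).continuous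

theorem convex_openBox {n : ℕ} (a b : Fin n → ℝ) :
    Convex ℝ {y : Euc n | ∀ i, y i ∈ Ioo (a i) (b i)} := by
  simp only [ofPred_forall]
  exact convex_iInter fun i => (convex_Ioo (a i) (b i)).linear_preimage (stdCoord i).toLinearMap

/-- The inverse function theorem on open subsets of `ℝⁿ`. -/
theorem exists_localDiffeo {n : ℕ} {g : Euc n → Euc n} {V : Set (Euc n)} (hV : IsOpen V)
    (hg : ContDiffOn ℝ ∞ g V) (hinj : ∀ y ∈ V, Function.Injective (fderiv ℝ g y)) {a : Euc n}
    (ha : a ∈ V) :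
    ∃ ψ : OpenPartialHomeomorph (Euc n) (Euc n), a ∈ ψ.source ∧ ψ.source ⊆ V ∧ ⇑ψ = g ∧
      ContDiffOn ℝ ∞ ψ.symm ψ.target := by
  have hd : ∀ y ∈ V, ∃ L : Euc n ≃L[ℝ] Euc n, HasFDerivAt g (L : Euc n →L[ℝ] Euc n) y := by
    intro y hy
    have h1 : HasFDerivAt g (fderiv ℝ g y) y :=
      ((hg.contDiffAt (hV.mem_nhds hy)).differentiableAt (by simp)).hasFDerivAt
    refine ⟨(LinearEquiv.ofInjectiveEndo (fderiv ℝ g y).toLinearMap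
      (hinj y hy)).toContinuousLinearEquiv, ?_⟩
    convert! h1
  obtain ⟨L, hL⟩ := hd a ha
  have hga := hg.contDiffAt (hV.mem_nhds ha)
  let ψ := (hga.toOpenPartialHomeomorph g hL (by simp)).restrOpen V hV
  have hs : ψ.source = (hga.toOpenPartialHomeomorph g hL (by simp)).source ∩ V := rfl
  refine ⟨ψ, ⟨hga.mem_toOpenPartialHomeomorph_source hL (by simp), ha⟩, ?_, rfl, ?_⟩
  · rw [hs]; exact inter_subset_right
  · intro z hz
    have h2 : ψ.symm z ∈ V := by
      have := ψ.map_target hz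
      rw [hs] at this
      exact this.2
    obtain ⟨L', hL'⟩ := hd _ h2
    exact (ψ.contDiffAt_symm hz (f₀' := L') hL' (hg.contDiffAt (hV.mem_nhds h2))).contDiffWithinAt

section

variable {n : ℕ} {M : Type*} [TopologicalSpace M] [ChartedSpace (Euc n) M]

theorem Foliation.finrank_quotient (F : Foliation n M) (p : M) :
    Module.finrank ℝ (TangentSpace (𝓡 n) p ⧸ F.tangent p) = 1 := by
  obtain ⟨U, f, hp, -, -, h⟩ := F.integrable p
  obtain ⟨h1, h2⟩ := h p hp
  let φ : (TangentSpace (𝓡 n) p) →ₗ[ℝ] ℝ := (mfderiv (𝓡 n) 𝓘(ℝ, ℝ) f p).toLinearMap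
  have h3 : F.tangent p = LinearMap.ker φ := by
    ext v
    exact h2 v
  have hφ : φ ≠ 0 := fun h0 => h1 (by ext v; exact DFunLike.congr_fun h0 v)
  have := (φ.quotKerEquivOfSurjective (LinearMap.surjective hφ)).finrank_eq
  rw [h3, this, Module.finrank_self]

theorem Web.iInf_tangent (W : Web n M) (p : M) : ⨅ i, (W.fol i).tangent p = ⊥ := by
  have h := W.general_position p
  simp only [Foliation.finrank_quotient, Finset.sum_const, Finset.card_univ, Fintype.card_fin,
    smul_eq_mul, mul_one] at h
  have : FiniteDimensional ℝ (TangentSpace (𝓡 n) p) :=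
    inferInstanceAs (FiniteDimensional ℝ (Euc n))
  have h1 := Submodule.finrank_quotient_add_finrank (⨅ i, (W.fol i).tangent p)
  have h2 : Module.finrank ℝ (TangentSpace (𝓡 n) p) = n := finrank_euclideanSpace_fin
  rw [h2, h] at h1
  exact Submodule.finrank_eq_zero.1 (by omega)

theorem mdifferentiable_of_mem_maximalAtlas {e : OpenPartialHomeomorph M (Euc n)}
    (he : e ∈ IsManifold.maximalAtlas (𝓡 n) ∞ M) : e.MDifferentiable (𝓡 n) (𝓡 n) :=
  ⟨(contMDiffOn_of_mem_maximalAtlas he).mdifferentiableOn (by simp),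
    (contMDiffOn_symm_of_mem_maximalAtlas he).mdifferentiableOn (by simp)⟩

variable [IsManifold (𝓡 n) ∞ M]

/-- A smooth map to `ℝⁿ` whose level sets of the `i`-th coordinate are tangent to the `i`-th
foliation restricts to an adapted chart, because the tangent spaces of the foliations are in
general position. -/
theorem Web.exists_adaptedChart_of_map (W : Web n M) {U : Set M} (hU : IsOpen U) {f : M → Euc n}
    (hf : ContMDiffOn (𝓡 n) (𝓡 n) ∞ f U)
    (hker : ∀ x ∈ U, ∀ i, ∀ v : TangentSpace (𝓡 n) x,
      v ∈ (W.fol i).tangent x ↔ stdCoord i (mfderiv (𝓡 n) (𝓡 n) f x v) = 0) {p : M} (hp : p ∈ U) :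
    ∃ e, W.IsAdaptedChart e ∧ p ∈ e.source ∧ e.source ⊆ U ∧ EqOn e f e.source := by
  have hinj : ∀ x ∈ U, Function.Injective (mfderiv (𝓡 n) (𝓡 n) f x) := by
    intro x hx
    rw [injective_iff_map_eq_zero]
    intro v hv
    have h1 : v ∈ ⨅ i, (W.fol i).tangent x := by
      rw [Submodule.mem_iInf]
      intro i
      rw [hker x hx, hv]
      rfl
    rw [W.iInf_tangent] at h1
    exact h1
  set c := chartAt (Euc n) p with hc
  have hcm : c ∈ IsManifold.maximalAtlas (𝓡 n) ∞ M := IsManifold.chart_mem_maximalAtlas p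
  have hcd := mdifferentiable_of_mem_maximalAtlas hcm
  let V : Set (Euc n) := c.target ∩ c.symm ⁻¹' U
  have hV : IsOpen V := c.isOpen_inter_preimage_symm hU
  have hg : ContMDiffOn (𝓡 n) (𝓡 n) ∞ (f ∘ c.symm) V :=
    hf.comp ((contMDiffOn_symm_of_mem_maximalAtlas hcm).mono inter_subset_left)
      (fun y hy => hy.2)
  have hpV : c p ∈ V := by
    have h0 : p ∈ c.source := mem_chart_source _ p
    refine ⟨c.map_source h0, ?_⟩
    rw [mem_preimage, c.left_inv h0]
    exact hp
  obtain ⟨ψ, hψ1, hψ2, hψ3, hψ4⟩ := exists_localDiffeo hV hg.contDiffOn (by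
    intro y hy
    have h1 : MDifferentiableAt (𝓡 n) (𝓡 n) f (c.symm y) :=
      (hf.contMDiffAt (hU.mem_nhds hy.2)).mdifferentiableAt (by simp)
    have h2 := hcd.mdifferentiableAt_symm hy.1
    have h3 : fderiv ℝ (f ∘ c.symm) y = (mfderiv (𝓡 n) (𝓡 n) f (c.symm y)).comp
        (mfderiv (𝓡 n) (𝓡 n) c.symm y) := by
      rw [← mfderiv_eq_fderiv]
      exact mfderiv_comp y h1 h2
    have h4 : Function.Injective (mfderiv (𝓡 n) (𝓡 n) f (c.symm y) ∘
        mfderiv (𝓡 n) (𝓡 n) c.symm y) :=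
      (hinj _ hy.2).comp (hcd.symm.mfderiv_injective hy.1)
    rw [h3]
    exact h4) hpV
  have hpψ : f p ∈ ψ.target := by
    have := ψ.map_source hψ1
    rw [hψ3] at this
    simpa [c.left_inv (mem_chart_source _ p)] using! this
  -- shrinking to a cube makes the chart cubical
  obtain ⟨ε, hε, hcube⟩ := exists_cube_subset ((c.trans ψ).open_target.mem_nhds
    (show f p ∈ (c.trans ψ).target by
      refine ⟨hpψ, ?_⟩
      have h5 : ψ.symm (f p) = c p := by
        rw [← ψ.left_inv hψ1, hψ3]
        simp [hc]
      change ψ.symm (f p) ∈ c.target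
      rw [h5]
      exact hpV.1))
  let Q : Set (Euc n) := {y | ∀ i, y i ∈ Ioo (f p i - ε) (f p i + ε)}
  have hQ : IsOpen Q := isOpen_openBox _ _
  let e := (c.trans ψ).trans (OpenPartialHomeomorph.ofSet Q hQ)
  have hes : ∀ x, x ∈ e.source ↔ (x ∈ c.source ∧ c x ∈ ψ.source) ∧ ψ (c x) ∈ Q := by
    intro x
    simp [e]
  have hsub : e.source ⊆ U := by
    intro x hx
    have h1 := (hes x).1 hx
    have h2 := (hψ2 h1.1.2).2
    rwa [mem_preimage, c.left_inv h1.1.1] at h2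
  have heq : EqOn e f e.source := by
    intro x hx
    have h1 := (hes x).1 hx
    change ψ (c x) = f x
    rw [hψ3]
    simp [c.left_inv h1.1.1]
  have htarget : e.target = Q := by
    have h1 : e.target = Q ∩ (c.trans ψ).target := by simp [e, inter_comm]
    rw [h1, inter_eq_left]
    intro y hy
    refine hcube y fun i => ?_
    have := hy i
    rw [abs_lt]
    constructor <;> linarith [this.1, this.2]
  have hmem : e ∈ IsManifold.maximalAtlas (𝓡 n) ∞ M := by
    refine e.mem_maximalAtlas_of_contMDiffOn ((hf.mono hsub).congr heq) ?_
    have h1 : ContMDiffOn (𝓡 n) (𝓡 n) ∞ (c.symm ∘ ψ.symm) e.target := by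
      refine (contMDiffOn_symm_of_mem_maximalAtlas hcm).comp (hψ4.contMDiffOn.mono ?_) ?_
      · intro y hy
        have h2 : y ∈ (c.trans ψ).target := by
          simp only [e, mfld_simps] at hy
          simpa using hy.2
        exact h2.1
      · intro y hy
        have h2 : y ∈ (c.trans ψ).target := by
          simp only [e, mfld_simps] at hy
          simpa using hy.2
        exact h2.2
    exact h1
  refine ⟨e, ⟨hmem, ⟨_, _, htarget⟩, ?_⟩, ?_, hsub, heq⟩
  · intro x hx i
    ext v
    have h1 : mfderiv (𝓡 n) (𝓡 n) e x = mfderiv (𝓡 n) (𝓡 n) f x := by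
      refine Filter.EventuallyEq.mfderiv_eq ?_
      filter_upwards [e.open_source.mem_nhds hx] with z hz using heq hz
    rw [hker x (hsub hx), LinearMap.mem_ker]
    change _ ↔ stdCoord i (mfderiv (𝓡 n) (𝓡 n) e x v) = 0
    rw [h1]
    rfl
  · rw [hes]
    refine ⟨⟨mem_chart_source _ p, hψ1⟩, ?_⟩
    rw [hψ3]
    simp only [Q, hc, Function.comp, (chartAt (Euc n) p).left_inv (mem_chart_source _ p)]
    intro i
    constructor <;> linarith

end

section

variable {n : ℕ} {M : Type*} [TopologicalSpace M] [ChartedSpace (Euc n) M]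

theorem contMDiffOn_toEuc {f : Fin n → M → ℝ} {U : Set M}
    (hf : ∀ i, ContMDiffOn (𝓡 n) 𝓘(ℝ, ℝ) ∞ (f i) U) :
    ContMDiffOn (𝓡 n) (𝓡 n) ∞ (fun x => (WithLp.toLp 2 fun i => f i x : Euc n)) U := by
  have h1 : ContMDiffOn (𝓡 n) 𝓘(ℝ, Fin n → ℝ) ∞ (fun x i => f i x) U :=
    contMDiffOn_pi_space.2 hf
  exact ((PiLp.continuousLinearEquiv 2 ℝ (fun _ : Fin n => ℝ)).symm.contDiff.contMDiff).comp_contMDiffOn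
    h1

theorem stdCoord_mfderiv {f : M → Euc n} {x : M} (hf : MDifferentiableAt (𝓡 n) (𝓡 n) f x)
    (i : Fin n) (v : TangentSpace (𝓡 n) x) :
    stdCoord i (mfderiv (𝓡 n) (𝓡 n) f x v) =
      mfderiv (𝓡 n) 𝓘(ℝ, ℝ) (fun z => f z i) x v := by
  have h2 := (stdCoord i).hasMFDerivAt (x := f x)
  have := (h2.comp x hf.hasMFDerivAt).mfderiv
  have h3 : (fun z => f z i) = (stdCoord i) ∘ f := rfl
  rw [h3, this]
  rfl

theorem Web.exists_adaptedChart [IsManifold (𝓡 n) ∞ M] (W : Web n M) (p : M) :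
    ∃ e, W.IsAdaptedChart e ∧ p ∈ e.source ∧ e p = 0 := by
  choose U f hp hU using fun i => (W.fol i).integrable p
  have hUo : IsOpen (⋂ i, U i) := isOpen_iInter_of_finite fun i => (hU i).1
  have hsm : ∀ i, ContMDiffOn (𝓡 n) 𝓘(ℝ, ℝ) ∞ (fun x => f i x - f i p) (⋂ i, U i) := fun i =>
    ((hU i).2.1.mono (iInter_subset _ i)).sub contMDiffOn_const
  have hsm' := contMDiffOn_toEuc hsm
  obtain ⟨e, he, hpe, -, heq⟩ := W.exists_adaptedChart_of_map hUo hsm' (by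
    intro x hx i v
    have h1 := ((hU i).2.2 x (mem_iInter.1 hx i)).2 v
    rw [h1, stdCoord_mfderiv ((hsm'.contMDiffAt (hUo.mem_nhds hx)).mdifferentiableAt (by simp))]
    have h2 : MDifferentiableAt (𝓡 n) 𝓘(ℝ, ℝ) (f i) x :=
      ((hU i).2.1.contMDiffAt ((hU i).1.mem_nhds (mem_iInter.1 hx i))).mdifferentiableAt (by simp)
    have h3 : mfderiv (𝓡 n) 𝓘(ℝ, ℝ) (fun x => f i x - f i p) x =
        mfderiv (𝓡 n) 𝓘(ℝ, ℝ) (f i) x := by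
      have := mfderiv_sub h2 (mdifferentiableAt_const (c := f i p))
      rw [mfderiv_const] at this
      exact this.trans (sub_zero _)
    change _ ↔ mfderiv (𝓡 n) 𝓘(ℝ, ℝ) (fun x => f i x - f i p) x v = (0 : ℝ)
    rw [h3]
    exact Iff.rfl) (mem_iInter.2 hp)
  refine ⟨e, he, hpe, ?_⟩
  rw [heq hpe]
  ext i
  simp

/-! ### Transition maps -/

variable {e e' : OpenPartialHomeomorph M (Euc n)}

theorem contDiffOn_transition (he : e ∈ IsManifold.maximalAtlas (𝓡 n) ∞ M)
    (he' : e' ∈ IsManifold.maximalAtlas (𝓡 n) ∞ M) :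
    ContDiffOn ℝ ∞ (e' ∘ e.symm) (e.target ∩ e.symm ⁻¹' e'.source) :=
  ((contMDiffOn_of_mem_maximalAtlas he').comp
    ((contMDiffOn_symm_of_mem_maximalAtlas he).mono inter_subset_left)
    (fun _ hy => hy.2)).contDiffOn

theorem fderiv_transition (he : e ∈ IsManifold.maximalAtlas (𝓡 n) ∞ M)
    (he' : e' ∈ IsManifold.maximalAtlas (𝓡 n) ∞ M) {y : Euc n} (hy : y ∈ e.target)
    (hy' : e.symm y ∈ e'.source) (v : Euc n) :
    fderiv ℝ (e' ∘ e.symm) y v =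
      mfderiv (𝓡 n) (𝓡 n) e' (e.symm y) (mfderiv (𝓡 n) (𝓡 n) e.symm y v) := by
  rw [← mfderiv_eq_fderiv]
  rw [mfderiv_comp y ((mdifferentiable_of_mem_maximalAtlas he').mdifferentiableAt hy')
    ((mdifferentiable_of_mem_maximalAtlas he).mdifferentiableAt_symm hy)]
  rfl

theorem mfderiv_symm_eq_comp_transition (he : e ∈ IsManifold.maximalAtlas (𝓡 n) ∞ M)
    (he' : e' ∈ IsManifold.maximalAtlas (𝓡 n) ∞ M) {y : Euc n} (hy : y ∈ e.target)
    (hy' : e.symm y ∈ e'.source) (v : Euc n) :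
    (mfderiv (𝓡 n) (𝓡 n) e.symm y v : Euc n) =
      mfderiv (𝓡 n) (𝓡 n) e'.symm (e' (e.symm y)) (fderiv ℝ (e' ∘ e.symm) y v) := by
  rw [fderiv_transition he he' hy hy']
  have := (mdifferentiable_of_mem_maximalAtlas he').symm_comp_deriv hy'
  exact (DFunLike.congr_fun this (mfderiv (𝓡 n) (𝓡 n) e.symm y v)).symm

theorem alternatingMap_apply_linearMap (A : (Euc n) [⋀^Fin n]→ₗ[ℝ] ℝ) (L : Euc n →ₗ[ℝ] Euc n) :
    A (fun i => L (stdVec i)) = LinearMap.det L * A stdVec := by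
  have h1 := A.eq_smul_basis_det (EuclideanSpace.basisFun (Fin n) ℝ).toBasis
  have h2 : (⇑(EuclideanSpace.basisFun (Fin n) ℝ).toBasis : Fin n → Euc n) = stdVec := by
    ext i j
    simp [stdVec]
  have h3 := (EuclideanSpace.basisFun (Fin n) ℝ).toBasis.det_comp L
    (EuclideanSpace.basisFun (Fin n) ℝ).toBasis
  rw [Module.Basis.det_self, mul_one, h2] at h3
  rw [h2] at h1
  rw [h1]
  simp only [AlternatingMap.smul_apply, smul_eq_mul]
  have h4 : (L ∘ stdVec : Fin n → Euc n) = fun i => L (stdVec i) := rfl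
  rw [← h4, h3]
  have h5 := (EuclideanSpace.basisFun (Fin n) ℝ).toBasis.det_self
  rw [h2] at h5
  rw [h5]
  ring

namespace DivergenceFreeWeb

variable (W : DivergenceFreeWeb n M)

theorem density_transition (he : e ∈ IsManifold.maximalAtlas (𝓡 n) ∞ M)
    (he' : e' ∈ IsManifold.maximalAtlas (𝓡 n) ∞ M) {y : Euc n} (hy : y ∈ e.target)
    (hy' : e.symm y ∈ e'.source) :
    W.density e y = (fderiv ℝ (e' ∘ e.symm) y).det * W.density e' (e' (e.symm y)) := by
  have hx : e'.symm (e' (e.symm y)) = e.symm y := e'.left_inv hy'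
  let A : (Euc n) [⋀^Fin n]→ₗ[ℝ] ℝ :=
    (W.Ω.form (e'.symm (e' (e.symm y)))).compLinearMap
      (mfderiv (𝓡 n) (𝓡 n) e'.symm (e' (e.symm y))).toLinearMap
  have h1 := alternatingMap_apply_linearMap A (fderiv ℝ (e' ∘ e.symm) y).toLinearMap
  have h2 : W.density e y = A (fun i => fderiv ℝ (e' ∘ e.symm) y (stdVec i)) := by
    unfold density
    have h3 : (fun i => (mfderiv (𝓡 n) (𝓡 n) e.symm y (stdVec i) : Euc n)) = fun i =>
      mfderiv (𝓡 n) (𝓡 n) e'.symm (e' (e.symm y)) (fderiv ℝ (e' ∘ e.symm) y (stdVec i)) :=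
        funext fun i => mfderiv_symm_eq_comp_transition he he' hy hy' _
    change (W.Ω.form (e.symm y) : (Euc n) [⋀^Fin n]→ₗ[ℝ] ℝ) _ =
      (W.Ω.form (e'.symm (e' (e.symm y))) : (Euc n) [⋀^Fin n]→ₗ[ℝ] ℝ) _
    rw [hx]
    exact congrArg _ h3
  rw [h2]
  exact h1

theorem contDiffOn_density (he : e ∈ IsManifold.maximalAtlas (𝓡 n) ∞ M) :
    ContDiffOn ℝ ∞ (W.density e) e.target :=
  W.Ω.smooth e he

theorem density_ne_zero (he : e ∈ IsManifold.maximalAtlas (𝓡 n) ∞ M) {y : Euc n}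
    (hy : y ∈ e.target) : W.density e y ≠ 0 := by
  intro h0
  apply W.Ω.ne_zero (e.symm y)
  have hed := mdifferentiable_of_mem_maximalAtlas he
  let A : (Euc n) [⋀^Fin n]→ₗ[ℝ] ℝ :=
    (W.Ω.form (e.symm y)).compLinearMap (mfderiv (𝓡 n) (𝓡 n) e.symm y).toLinearMap
  have hA : A = 0 := by
    rw [A.eq_smul_basis_det (EuclideanSpace.basisFun (Fin n) ℝ).toBasis]
    have h1 : A (EuclideanSpace.basisFun (Fin n) ℝ).toBasis = 0 := by
      have h2 : (⇑(EuclideanSpace.basisFun (Fin n) ℝ).toBasis : Fin n → Euc n) = stdVec := by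
        ext i j
        simp [stdVec]
      rw [h2]
      exact h0
    rw [h1, zero_smul]
  ext v
  choose w hw using fun i => hed.symm.mfderiv_surjective hy (v i)
  have h3 : A w = 0 := by rw [hA]; rfl
  have h4 : A w = W.Ω.form (e.symm y) v := by
    rw [← funext hw]
    rfl
  rw [← h4, h3]
  rfl

end DivergenceFreeWeb

/-! ### Transition maps between adapted charts -/

namespace Web

variable {W : Web n M}

theorem IsAdaptedChart.mem_tangent_iff (he : W.IsAdaptedChart e) {x : M} (hx : x ∈ e.source)
    (i : Fin n) (v : TangentSpace (𝓡 n) x) :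
    v ∈ (W.fol i).tangent x ↔ stdCoord i (mfderiv (𝓡 n) (𝓡 n) e x v) = 0 := by
  rw [he.2.2 x hx i]
  rfl

theorem IsAdaptedChart.fderiv_transition_eq_zero_iff (he : W.IsAdaptedChart e)
    (he' : W.IsAdaptedChart e') {y : Euc n} (hy : y ∈ e.target) (hy' : e.symm y ∈ e'.source)
    (i : Fin n) (v : Euc n) :
    stdCoord i (fderiv ℝ (e' ∘ e.symm) y v) = 0 ↔ v i = 0 := by
  rw [fderiv_transition he.1 he'.1 hy hy']
  have h1 := he'.mem_tangent_iff hy' i (mfderiv (𝓡 n) (𝓡 n) e.symm y v)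
  have h2 := he.mem_tangent_iff (e.map_target hy) i (mfderiv (𝓡 n) (𝓡 n) e.symm y v)
  rw [← h1, h2]
  have h3 := DFunLike.congr_fun
    ((mdifferentiable_of_mem_maximalAtlas he.1).comp_symm_deriv hy) v
  have h4 : (mfderiv (𝓡 n) (𝓡 n) e (e.symm y) (mfderiv (𝓡 n) (𝓡 n) e.symm y v) : Euc n) = v := h3
  exact Iff.of_eq (congrArg (fun w : Euc n => stdCoord i w = 0) h4)

/-- The differential of a transition map between adapted charts is diagonal. -/
theorem IsAdaptedChart.fderiv_transition_apply (he : W.IsAdaptedChart e)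
    (he' : W.IsAdaptedChart e') {y : Euc n} (hy : y ∈ e.target) (hy' : e.symm y ∈ e'.source)
    (i : Fin n) (v : Euc n) :
    (fderiv ℝ (e' ∘ e.symm) y v) i = v i * (fderiv ℝ (e' ∘ e.symm) y (stdVec i)) i := by
  have h1 := (he.fderiv_transition_eq_zero_iff he' hy hy' i (v - v i • stdVec i)).2 (by simp)
  rw [map_sub, map_smul, map_sub, map_smul, sub_eq_zero] at h1
  exact h1

theorem IsAdaptedChart.fderiv_transition_self_ne_zero (he : W.IsAdaptedChart e)
    (he' : W.IsAdaptedChart e') {y : Euc n} (hy : y ∈ e.target) (hy' : e.symm y ∈ e'.source)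
    (i : Fin n) : (fderiv ℝ (e' ∘ e.symm) y (stdVec i)) i ≠ 0 := by
  intro h0
  have := (he.fderiv_transition_eq_zero_iff he' hy hy' i (stdVec i)).1 h0
  simp at this

theorem IsAdaptedChart.det_fderiv_transition (he : W.IsAdaptedChart e)
    (he' : W.IsAdaptedChart e') {y : Euc n} (hy : y ∈ e.target) (hy' : e.symm y ∈ e'.source) :
    (fderiv ℝ (e' ∘ e.symm) y).det = ∏ i, (fderiv ℝ (e' ∘ e.symm) y (stdVec i)) i := by
  have h1 : (fderiv ℝ (e' ∘ e.symm) y).det = LinearMap.det (fderiv ℝ (e' ∘ e.symm) y).toLinearMap :=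
    rfl
  rw [h1, ← LinearMap.det_toMatrix (EuclideanSpace.basisFun (Fin n) ℝ).toBasis]
  rw [Matrix.det_of_isUpperTriangular]
  · refine Finset.prod_congr rfl fun i _ => ?_
    simp [LinearMap.toMatrix_apply]
  · intro i j hij
    have hij : j ≠ i := ne_of_lt hij
    simp only [LinearMap.toMatrix_apply, OrthonormalBasis.coe_toBasis,
      EuclideanSpace.basisFun_apply, OrthonormalBasis.coe_toBasis_repr_apply,
      EuclideanSpace.basisFun_repr]
    have := he.fderiv_transition_apply he' hy hy' i (stdVec j)
    refine this.trans ?_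
    simp [hij.symm]

end Web

end

/-! ### Coordinate boxes -/

/-- The closed coordinate box of `ℝⁿ` with opposite vertices `a` and `b`; no order between the
coordinates of `a` and `b` is assumed. -/
def coordBox {n : ℕ} (a b : Fin n → ℝ) : Set (Euc n) := {y | ∀ k, y k ∈ uIcc (a k) (b k)}

section

variable {n : ℕ}

theorem convex_coordBox (a b : Fin n → ℝ) : Convex ℝ (coordBox a b) := by
  simp only [coordBox, ofPred_forall]
  exact convex_iInter fun i => (convex_uIcc (a i) (b i)).linear_preimage (stdCoord i).toLinearMap

theorem isClosed_coordBox (a b : Fin n → ℝ) : IsClosed (coordBox a b) := by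
  simp only [coordBox, ofPred_forall]
  exact isClosed_iInter fun i => isClosed_Icc.preimage (stdCoord i).continuous

theorem coordBox_eq_image (a b : Fin n → ℝ) :
    coordBox a b = WithLp.toLp 2 '' (Set.pi univ fun k => uIcc (a k) (b k)) := by
  ext y
  constructor
  · intro hy
    exact ⟨WithLp.ofLp y, fun k _ => hy k, rfl⟩
  · rintro ⟨z, hz, rfl⟩ k
    exact hz k (mem_univ k)

theorem isCompact_coordBox (a b : Fin n → ℝ) : IsCompact (coordBox a b) := by
  rw [coordBox_eq_image]
  exact (isCompact_univ_pi fun k => isCompact_uIcc).image (PiLp.continuous_toLp 2 _)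

theorem left_mem_coordBox (a b : Fin n → ℝ) : (WithLp.toLp 2 a : Euc n) ∈ coordBox a b :=
  fun _ => left_mem_uIcc

theorem right_mem_coordBox (a b : Fin n → ℝ) : (WithLp.toLp 2 b : Euc n) ∈ coordBox a b :=
  fun _ => right_mem_uIcc

theorem coordBox_subset_openBox {a b l u : Fin n → ℝ} (ha : ∀ i, a i ∈ Ioo (l i) (u i))
    (hb : ∀ i, b i ∈ Ioo (l i) (u i)) : coordBox a b ⊆ {y | ∀ i, y i ∈ Ioo (l i) (u i)} :=
  fun _ hy i => (ordConnected_Ioo.uIcc_subset (ha i) (hb i)) (hy i)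

/-- A function whose derivative vanishes in all directions tangent to the hyperplanes
`xᵢ = const` depends on the `i`-th coordinate only. -/
theorem eq_of_fderiv_eq_zero {S : Set (Euc n)} (hS : Convex ℝ S) {f : Euc n → ℝ}
    (hf : ∀ y ∈ S, DifferentiableAt ℝ f y) {i : Fin n}
    (h0 : ∀ y ∈ S, ∀ v : Euc n, v i = 0 → fderiv ℝ f y v = 0) {y y' : Euc n} (hy : y ∈ S)
    (hy' : y' ∈ S) (h : y i = y' i) : f y = f y' := by
  obtain ⟨z, hz, hz'⟩ := domain_mvt (f := f) (f' := fun y => fderiv ℝ f y)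
    (fun x hx => (hf x hx).hasFDerivAt.hasFDerivWithinAt) hS hy hy'
  rw [h0 z (hS.segment_subset hy hy' hz) _ (by simp [h])] at hz'
  linarith

/-- A map with invertible diagonal differentials maps coordinate boxes onto coordinate boxes. -/
theorem image_coordBox {a b : Fin n → ℝ} {φ : Euc n → Euc n}
    (hd : ∀ y ∈ coordBox a b, DifferentiableAt ℝ φ y)
    (hφ : ∀ y ∈ coordBox a b, ∀ i v, (fderiv ℝ φ y v) i = 0 ↔ v i = 0) :
    φ '' coordBox a b = coordBox (φ (WithLp.toLp 2 a)) (φ (WithLp.toLp 2 b)) := by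
  have hconv := convex_coordBox a b
  have hdi : ∀ i, ∀ y ∈ coordBox a b, HasFDerivAt (fun z => φ z i)
      ((stdCoord i).comp (fderiv ℝ φ y)) y := fun i y hy =>
    (stdCoord i).hasFDerivAt.comp y (hd y hy).hasFDerivAt
  have hdep : ∀ i, ∀ y ∈ coordBox a b, ∀ y' ∈ coordBox a b, y i = y' i ↔ φ y i = φ y' i := by
    intro i y hy y' hy'
    obtain ⟨z, hz, hz'⟩ := domain_mvt (f := fun z => φ z i)
      (f' := fun y => (stdCoord i).comp (fderiv ℝ φ y))
      (fun x hx => (hdi i x hx).hasFDerivWithinAt) hconv hy hy'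
    have h1 := hφ z (hconv.segment_subset hy hy' hz) i (y' - y)
    have h2 : (fderiv ℝ φ z (y' - y)) i = φ y' i - φ y i := hz'.symm
    rw [h2, PiLp.sub_apply, sub_eq_zero, sub_eq_zero] at h1
    rw [eq_comm, ← h1, eq_comm]
  let c : Fin n → ℝ → Euc n := fun i t => WithLp.toLp 2 (Function.update a i t)
  have hc : ∀ i, Continuous (c i) := fun i =>
    (PiLp.continuous_toLp 2 _).comp (continuous_const.update i continuous_id)
  have hci : ∀ i t, c i t i = t := fun i t => by simp [c]
  have hcm : ∀ i, ∀ t ∈ uIcc (a i) (b i), c i t ∈ coordBox a b := by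
    intro i t ht k
    by_cases hk : k = i
    · subst hk; simpa [c] using ht
    · simp [c, hk]
  let g : Fin n → ℝ → ℝ := fun i t => φ (c i t) i
  have hgc : ∀ i, ContinuousOn (g i) (uIcc (a i) (b i)) := by
    intro i t ht
    have h1 : ContinuousAt (fun z => φ z i) (c i t) := (hdi i _ (hcm i t ht)).continuousAt
    exact (ContinuousAt.comp (f := c i) (g := fun z => φ z i) h1
      (hc i).continuousAt).continuousWithinAt
  have hginj : ∀ i, InjOn (g i) (uIcc (a i) (b i)) := by
    intro i t ht t' ht' h
    have := (hdep i _ (hcm i t ht) _ (hcm i t' ht')).2 h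
    simpa [hci] using this
  have hga : ∀ i, g i (a i) = φ (WithLp.toLp 2 a) i := fun i => by simp [g, c]
  have hgb : ∀ i, g i (b i) = φ (WithLp.toLp 2 b) i := fun i =>
    (hdep i _ (hcm i _ right_mem_uIcc) _ (right_mem_coordBox a b)).1 (by simp [hci])
  have himg : ∀ i, g i '' uIcc (a i) (b i) =
      uIcc (φ (WithLp.toLp 2 a) i) (φ (WithLp.toLp 2 b) i) := by
    intro i
    refine subset_antisymm ?_ ?_
    · rw [← hga, ← hgb]
      rintro _ ⟨t, ht, rfl⟩
      have hm := (hgc i)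
      rcases ContinuousOn.strictMonoOn_of_injOn_Icc' (min_le_max) hm (hginj i) with h | h
      · exact h.monotoneOn.mapsTo_uIcc ht
      · exact h.antitoneOn.mapsTo_uIcc ht
    · rw [← hga, ← hgb]
      exact intermediate_value_uIcc (hgc i)
  ext w
  constructor
  · rintro ⟨y, hy, rfl⟩ i
    rw [← himg]
    exact ⟨y i, hy i, (hdep i _ (hcm i _ (hy i)) _ hy).1 (hci i _)⟩
  · intro hw
    have h1 : ∀ i, ∃ t ∈ uIcc (a i) (b i), g i t = w i := fun i => by
      have := hw i
      rwa [← himg] at this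
    choose t ht hgt using h1
    have hy : (WithLp.toLp 2 t : Euc n) ∈ coordBox a b := fun i => ht i
    refine ⟨_, hy, ?_⟩
    ext i
    rw [← hgt]
    exact (hdep i _ hy _ (hcm i _ (ht i))).1 (hci i _).symm

end

section

variable {n : ℕ} {M : Type*} [TopologicalSpace M] {e e' : OpenPartialHomeomorph M (Euc n)}

theorem left_mem_chartBox {p : M} (hp : p ∈ e.source) (q : M) : p ∈ chartBox e p q :=
  ⟨hp, fun _ => left_mem_uIcc⟩

theorem right_mem_chartBox {q : M} (p : M) (hq : q ∈ e.source) : q ∈ chartBox e p q :=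
  ⟨hq, fun _ => right_mem_uIcc⟩

namespace Web

variable [ChartedSpace (Euc n) M] {W : Web n M}

theorem IsAdaptedChart.coordBox_subset_target (he : W.IsAdaptedChart e) {a b : Euc n}
    (ha : a ∈ e.target) (hb : b ∈ e.target) : coordBox a b ⊆ e.target := by
  obtain ⟨-, ⟨l, u, h⟩, -⟩ := he
  rw [h] at ha hb ⊢
  exact coordBox_subset_openBox ha hb

theorem IsAdaptedChart.image_chartBox (he : W.IsAdaptedChart e) {p q : M} (hp : p ∈ e.source)
    (hq : q ∈ e.source) : e '' chartBox e p q = coordBox (e p) (e q) := by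
  ext y
  constructor
  · rintro ⟨x, hx, rfl⟩
    exact hx.2
  · intro hy
    have hyt := he.coordBox_subset_target (e.map_source hp) (e.map_source hq) hy
    refine ⟨e.symm y, ⟨e.map_target hyt, ?_⟩, e.right_inv hyt⟩
    rw [e.right_inv hyt]
    exact hy

/-- A coordinate box of an adapted chart is a coordinate box of each adapted chart whose domain
contains it. -/
theorem chartBox_eq_chartBox (he : W.IsAdaptedChart e) (he' : W.IsAdaptedChart e') {p q : M}
    (hp : p ∈ e.source) (hq : q ∈ e.source) (h : chartBox e p q ⊆ e'.source) :
    chartBox e p q = chartBox e' p q := by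
  have hsub := he.coordBox_subset_target (e.map_source hp) (e.map_source hq)
  have hmem : ∀ y ∈ coordBox (e p) (e q), y ∈ e.target ∧ e.symm y ∈ e'.source := by
    intro y hy
    refine ⟨hsub hy, h ⟨e.map_target (hsub hy), ?_⟩⟩
    rw [e.right_inv (hsub hy)]
    exact hy
  have himg := image_coordBox (a := e p) (b := e q) (φ := e' ∘ e.symm)
    (fun y hy => ((contDiffOn_transition he.1 he'.1).contDiffAt
      ((e.isOpen_inter_preimage_symm e'.open_source).mem_nhds (hmem y hy))).differentiableAt
      (by simp))
    (fun y hy i v => he.fderiv_transition_eq_zero_iff he' (hmem y hy).1 (hmem y hy).2 i v)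
  have h1 : (e' ∘ e.symm) (WithLp.toLp 2 (e p)) = e' p := congrArg e' (e.left_inv hp)
  have h2 : (e' ∘ e.symm) (WithLp.toLp 2 (e q)) = e' q := congrArg e' (e.left_inv hq)
  rw [h1, h2] at himg
  ext x
  constructor
  · intro hx
    refine ⟨h hx, ?_⟩
    change e' x ∈ coordBox (e' p) (e' q)
    rw [← himg]
    exact ⟨e x, hx.2, congrArg e' (e.left_inv hx.1)⟩
  · rintro ⟨hx, hx'⟩
    change e' x ∈ coordBox (e' p) (e' q) at hx'
    rw [← himg] at hx'
    obtain ⟨y, hy, hyx⟩ := hx'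
    have h3 : e.symm y = x := e'.injOn (hmem y hy).2 hx hyx
    rw [← h3]
    refine ⟨e.map_target (hsub hy), ?_⟩
    rw [e.right_inv (hsub hy)]
    exact hy

theorem IsRegion.exists_eq_chartBox {A : Set M} (hA : W.IsRegion A) (he : W.IsAdaptedChart e)
    (h : A ⊆ e.source) : ∃ p ∈ e.source, ∃ q ∈ e.source, A = chartBox e p q := by
  obtain ⟨e', he', p, hp, q, hq, rfl⟩ := hA
  exact ⟨p, h (left_mem_chartBox hp q), q, h (right_mem_chartBox p hq),
    chartBox_eq_chartBox he' he hp hq h⟩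

end Web

end

/-! ### The volume of a region -/

section

variable {n : ℕ}

/-- The integral of `g` over a coordinate box. -/
noncomputable def cellVol (g : Euc n → ℝ) (a b : Fin n → ℝ) : ℝ := ∫ y in coordBox a b, g y

/-- A continuous function without zeros has constant sign on a connected set. -/
theorem abs_setIntegral_eq {S : Set (Euc n)} (hS : IsPreconnected S) (hSm : MeasurableSet S)
    {g : Euc n → ℝ} (hg : ContinuousOn g S) (h0 : ∀ y ∈ S, g y ≠ 0) :
    |∫ y in S, g y| = ∫ y in S, |g y| := by
  have h1 : (∀ y ∈ S, 0 < g y) ∨ (∀ y ∈ S, g y < 0) := by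
    by_contra! hcon
    obtain ⟨⟨y, hy, hy'⟩, z, hz, hz'⟩ := hcon
    have := hS.intermediate_value hy hz hg
    obtain ⟨w, hw, hw'⟩ := this ⟨hy', hz'⟩
    exact h0 w hw hw'
  rcases h1 with h | h
  · rw [abs_of_nonneg (MeasureTheory.setIntegral_nonneg hSm fun y hy => (h y hy).le)]
    exact MeasureTheory.setIntegral_congr_fun hSm fun y hy => (abs_of_pos (h y hy)).symm
  · rw [abs_of_nonpos (MeasureTheory.setIntegral_nonpos hSm fun y hy => (h y hy).le),
      ← MeasureTheory.integral_neg]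
    exact MeasureTheory.setIntegral_congr_fun hSm fun y hy => (abs_of_neg (h y hy)).symm

variable {M : Type*} [TopologicalSpace M] [ChartedSpace (Euc n) M]
variable {e : OpenPartialHomeomorph M (Euc n)}

/-- The volume of a region in the adapted chart which defines it; by the change of variables formula
the chart chosen in the definition of the volume does not matter. -/
theorem DivergenceFreeWeb.vol_chartBox (W : DivergenceFreeWeb n M) (he : W.IsAdaptedChart e)
    {p q : M} (hp : p ∈ e.source) (hq : q ∈ e.source) :
    W.vol (chartBox e p q) = cellVol (fun y => |W.density e y|) (e p) (e q) := by
  have hex : ∃ e ∈ IsManifold.maximalAtlas (𝓡 n) ∞ M, chartBox e p q ⊆ e.source :=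
    ⟨e, he.1, fun x hx => hx.1⟩
  have hex' : ∃ e' ∈ IsManifold.maximalAtlas (𝓡 n) ∞ M, chartBox e p q ⊆ e'.source :=
    ⟨e, he.1, fun x hx => hx.1⟩
  have hvol : W.vol (chartBox e p q) =
    |∫ y in hex'.choose '' chartBox e p q, W.density hex'.choose y| := dif_pos hex'
  obtain ⟨he', hsub⟩ := hex'.choose_spec
  rw [hvol]
  generalize hex'.choose = e' at he' hsub
  set B := coordBox (e p) (e q) with hB
  have hBt : B ⊆ e.target := he.coordBox_subset_target (e.map_source hp) (e.map_source hq)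
  have himg : e '' chartBox e p q = B := he.image_chartBox hp hq
  have hBs : ∀ y ∈ B, e.symm y ∈ e'.source := by
    intro y hy
    rw [← himg] at hy
    obtain ⟨x, hx, rfl⟩ := hy
    rw [e.left_inv hx.1]
    exact hsub hx
  have himg' : e' '' chartBox e p q = (e' ∘ e.symm) '' B := by
    rw [← himg, image_image]
    refine image_congr fun x hx => ?_
    simp [e.left_inv hx.1]
  have hdiff : ∀ y ∈ B, ContDiffAt ℝ ∞ (e' ∘ e.symm) y := fun y hy =>
    (contDiffOn_transition he.1 he').contDiffAt
      ((e.isOpen_inter_preimage_symm e'.open_source).mem_nhds ⟨hBt hy, hBs y hy⟩)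
  have hcont : ContinuousOn (e' ∘ e.symm) B := fun y hy =>
    (hdiff y hy).continuousAt.continuousWithinAt
  have hinj : InjOn (e' ∘ e.symm) B := by
    intro y hy z hz h
    exact e.symm.injOn (hBt hy) (hBt hz) (e'.injOn (hBs y hy) (hBs z hz) h)
  have hBc : IsCompact B := isCompact_coordBox _ _
  have hBm : MeasurableSet B := (isClosed_coordBox _ _).measurableSet
  have hsub' : (e' ∘ e.symm) '' B ⊆ e'.target := by
    rintro _ ⟨y, hy, rfl⟩
    exact e'.map_source (hBs y hy)
  rw [himg', abs_setIntegral_eq ((convex_coordBox _ _).isPreconnected.image _ hcont)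
    (hBc.image_of_continuousOn hcont).isClosed.measurableSet
    ((W.contDiffOn_density he').continuousOn.mono hsub')
    (fun y hy => W.density_ne_zero he' (hsub' hy)),
    MeasureTheory.integral_image_eq_integral_abs_det_fderiv_smul _ hBm
      (fun y hy => ((hdiff y hy).differentiableAt (by simp)).hasFDerivAt.hasFDerivWithinAt) hinj]
  refine MeasureTheory.setIntegral_congr_fun hBm fun y hy => ?_
  simp only [smul_eq_mul, Function.comp]
  rw [W.density_transition he.1 he' (hBt hy) (hBs y hy), abs_mul]

end

/-! ### Leaves and plaques -/

section

variable {n : ℕ} {M : Type*} [TopologicalSpace M] [ChartedSpace (Euc n) M]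
variable {e e' : OpenPartialHomeomorph M (Euc n)} {W : Web n M}

/-- The plaque of the chart `e` given by the equation `xᵢ = c`. -/
def plaque (e : OpenPartialHomeomorph M (Euc n)) (i : Fin n) (c : ℝ) : Set M :=
  {x | x ∈ e.source ∧ e x i = c}

theorem Web.IsAdaptedChart.isDistinguished (he : W.IsAdaptedChart e) (i : Fin n) :
    IsDistinguished (W.fol i).tangent e.source (fun x => e x i) := by
  have hed := mdifferentiable_of_mem_maximalAtlas he.1
  refine ⟨e.open_source, ?_, fun x hx => ⟨?_, fun v => ?_⟩⟩
  · exact (stdCoord i).contDiff.contMDiff.comp_contMDiffOn (contMDiffOn_of_mem_maximalAtlas he.1)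
  · intro h0
    obtain ⟨v, hv⟩ := hed.mfderiv_surjective hx (stdVec i)
    have h1 := stdCoord_mfderiv (hed.mdifferentiableAt hx) i v
    have h2 : stdCoord i (mfderiv (𝓡 n) (𝓡 n) e x v) = stdCoord i (stdVec i) :=
      congrArg (fun w : Euc n => stdCoord i w) hv
    rw [h2] at h1
    have h3 : mfderiv (𝓡 n) 𝓘(ℝ, ℝ) (fun z => e z i) x v = (0 : ℝ) := by
      rw [h0]; rfl
    rw [h3] at h1
    simp at h1
  · rw [he.mem_tangent_iff hx, stdCoord_mfderiv (hed.mdifferentiableAt hx)]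
    exact Iff.rfl

theorem Web.IsAdaptedChart.isOpen_plaque (he : W.IsAdaptedChart e) (i : Fin n) (c : ℝ) :
    IsOpen[(W.fol i).leafTopology] (plaque e i c) :=
  TopologicalSpace.isOpen_generateFrom_of_mem ⟨e.source, _, c, he.isDistinguished i, rfl⟩

/-- Near a point of an adapted chart, a distinguished function of the `i`-th foliation is a function
of the `i`-th coordinate. -/
theorem Web.IsAdaptedChart.eventually_eq_of_isDistinguished (he : W.IsAdaptedChart e) {i : Fin n}
    {U : Set M} {f : M → ℝ} (hf : IsDistinguished (W.fol i).tangent U f) {x : M}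
    (hx : x ∈ e.source) (hxU : x ∈ U) : ∀ᶠ x' in 𝓝 x, e x' i = e x i → f x' = f x := by
  have hed := mdifferentiable_of_mem_maximalAtlas he.1
  have hV : e.target ∩ e.symm ⁻¹' U ∈ 𝓝 (e x) := by
    refine (e.isOpen_inter_preimage_symm hf.1).mem_nhds ⟨e.map_source hx, ?_⟩
    rwa [mem_preimage, e.left_inv hx]
  obtain ⟨ε, hε, hball⟩ := Metric.mem_nhds_iff.1 hV
  have hd : ∀ y ∈ Metric.ball (e x) ε, DifferentiableAt ℝ (f ∘ e.symm) y ∧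
      ∀ v : Euc n, v i = 0 → fderiv ℝ (f ∘ e.symm) y v = 0 := by
    intro y hy
    have h1 := hed.mdifferentiableAt_symm (hball hy).1
    have h2 : MDifferentiableAt (𝓡 n) 𝓘(ℝ, ℝ) f (e.symm y) :=
      (hf.2.1.contMDiffAt (hf.1.mem_nhds (hball hy).2)).mdifferentiableAt (by simp)
    refine ⟨(h2.comp y h1).differentiableAt, fun v hv => ?_⟩
    rw [← mfderiv_eq_fderiv, mfderiv_comp y h2 h1]
    refine ((hf.2.2 _ (hball hy).2).2 _).1 ?_
    rw [he.mem_tangent_iff (e.map_target (hball hy).1)]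
    have h3 := DFunLike.congr_fun (hed.comp_symm_deriv (hball hy).1) v
    exact (congrArg (fun w : Euc n => stdCoord i w) h3).trans hv
  filter_upwards [(e.continuousAt hx).preimage_mem_nhds (Metric.ball_mem_nhds _ hε),
    e.open_source.mem_nhds hx] with x' hx' hx's h
  have := eq_of_fderiv_eq_zero (convex_ball (e x) ε) (fun y hy => (hd y hy).1)
    (fun y hy => (hd y hy).2) hx' (Metric.mem_ball_self hε) h
  simpa [e.left_inv hx, e.left_inv hx's] using this

theorem Web.IsAdaptedChart.isPreconnected_plaque (he : W.IsAdaptedChart e) (i : Fin n) (c : ℝ) :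
    @IsPreconnected M (W.fol i).leafTopology (plaque e i c) := by
  let S : Set (Euc n) := {y | y ∈ e.target ∧ y i = c}
  have hS : IsPreconnected S := by
    obtain ⟨-, ⟨l, u, h⟩, -⟩ := he
    have h1 : S = {y | ∀ i, y i ∈ Ioo (l i) (u i)} ∩ stdCoord i ⁻¹' {c} := by
      rw [← h]; rfl
    rw [h1]
    exact ((convex_openBox l u).inter
      ((convex_singleton c).linear_preimage (stdCoord i).toLinearMap)).isPreconnected
  have himg : plaque e i c = e.symm '' S := by
    ext x
    constructor
    · rintro ⟨hx, rfl⟩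
      exact ⟨e x, ⟨e.map_source hx, rfl⟩, e.left_inv hx⟩
    · rintro ⟨y, ⟨hy, rfl⟩, rfl⟩
      exact ⟨e.map_target hy, by rw [e.right_inv hy]⟩
  rw [himg]
  refine @IsPreconnected.image (Euc n) M _ (W.fol i).leafTopology S hS e.symm ?_
  rw [@continuousOn_iff_continuous_domRestrict (Euc n) M _ (W.fol i).leafTopology]
  refine continuous_generateFrom_iff.2 ?_
  rintro _ ⟨U, f, c', hf, rfl⟩
  rw [isOpen_iff_mem_nhds]
  rintro ⟨y, hy⟩ ⟨hyU, hyc⟩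
  have h1 := he.eventually_eq_of_isDistinguished hf (e.map_target hy.1) hyU
  have h2 := (e.symm.continuousAt hy.1).eventually (h1.and (hf.1.mem_nhds hyU))
  have h3 : ∀ᶠ z : S in 𝓝 ⟨y, hy⟩, (e (e.symm z) i = e (e.symm y) i → f (e.symm z) = f (e.symm y))
      ∧ e.symm z ∈ U := (continuous_subtype_val.tendsto (⟨y, hy⟩ : S)).eventually h2
  filter_upwards [h3] with z hz
  refine ⟨hz.2, (hz.1 ?_).trans hyc⟩
  rw [e.right_inv z.2.1, e.right_inv hy.1, z.2.2, hy.2]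

theorem Web.IsAdaptedChart.plaque_subset_leaf (he : W.IsAdaptedChart e) {i : Fin n} {c : ℝ}
    {p : M} (hp : p ∈ plaque e i c) : plaque e i c ⊆ (W.fol i).leaf p :=
  @IsPreconnected.subset_connectedComponent M (W.fol i).leafTopology p _
    (he.isPreconnected_plaque i c) hp

theorem Web.IsAdaptedChart.isOpenSubsetOfLeaf_plaque (he : W.IsAdaptedChart e) {i : Fin n} {c : ℝ}
    {p : M} (hp : p ∈ plaque e i c) : (W.fol i).IsOpenSubsetOfLeaf (plaque e i c) :=
  ⟨he.isOpen_plaque i c, p, he.plaque_subset_leaf hp⟩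

/-- A distinguished function is locally constant on the plaques of any adapted chart, hence takes
countably many values there. -/
theorem Web.IsAdaptedChart.countable_image_plaque [SecondCountableTopology M]
    (he : W.IsAdaptedChart e) {i : Fin n}
    {U : Set M} {f : M → ℝ} (hf : IsDistinguished (W.fol i).tangent U f) (c : ℝ) :
    (f '' (plaque e i c ∩ U)).Countable := by
  let P : Set M := plaque e i c ∩ U
  refine Set.PairwiseDisjoint.countable_of_isOpen (s := fun v => {x : P | f x = v}) ?_ ?_ ?_
  · intro v _ v' _ hvv'
    rw [Function.onFun, disjoint_left]
    intro x hx hx'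
    exact hvv' (hx.symm.trans hx')
  · intro v _
    rw [isOpen_iff_mem_nhds]
    rintro ⟨x, hx⟩ hxv
    have h1 := he.eventually_eq_of_isDistinguished hf hx.1.1 hx.2
    have h2 : ∀ᶠ z : P in 𝓝 ⟨x, hx⟩, e z i = e x i → f z = f x :=
      (continuous_subtype_val.tendsto (⟨x, hx⟩ : P)).eventually h1
    filter_upwards [h2] with z hz
    exact (hz (z.2.1.2.trans hx.1.2.symm)).trans hxv
  · rintro _ ⟨x, hx, rfl⟩
    exact ⟨⟨x, hx⟩, rfl⟩

variable [IsManifold (𝓡 n) ∞ M] [SecondCountableTopology M]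

/-- A leaf of a foliation of a second countable manifold is contained in a countable union of
plaques: starting from one plaque and passing to the plaques of a countable atlas which meet those
already reached, one obtains a countable union which is open and closed in the leaf topology. -/
theorem Web.exists_countable_cover_leaf (W : Web n M) (i : Fin n) (p : M) :
    ∃ (E : M → OpenPartialHomeomorph M (Euc n)) (S : Set (M × ℝ)), (∀ x, W.IsAdaptedChart (E x)) ∧
      S.Countable ∧ (W.fol i).leaf p ⊆ ⋃ t ∈ S, plaque (E t.1) i t.2 := by
  choose E hE hEs _ using W.exists_adaptedChart
  obtain ⟨s, hs, hcov⟩ := TopologicalSpace.countable_cover_nhds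
    (fun x => (E x).open_source.mem_nhds (hEs x))
  let P : M × ℝ → Set M := fun t => plaque (E t.1) i t.2
  let N : M × ℝ → Set (M × ℝ) := fun t => {t' | t'.1 ∈ s ∧ (P t ∩ P t').Nonempty}
  have hN : ∀ t, (N t).Countable := by
    intro t
    have h1 : N t ⊆ ⋃ x ∈ s, Prod.mk x ''
        ((fun z => E x z i) '' (plaque (E t.1) i t.2 ∩ (E x).source)) := by
      rintro ⟨x, c⟩ ⟨hx, z, hz, hz', hzc⟩
      exact mem_biUnion hx ⟨c, ⟨z, ⟨hz, hz'⟩, hzc⟩, rfl⟩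
    exact (hs.biUnion fun x _ => ((hE t.1).countable_image_plaque
      ((hE x).isDistinguished i) t.2).image _).mono h1
  let S : ℕ → Set (M × ℝ) := fun m => Nat.rec {(p, E p p i)} (fun _ T => ⋃ t ∈ T, N t) m
  have hS : ∀ m, (S m).Countable := by
    intro m
    induction m with
    | zero => exact countable_singleton _
    | succ m ih => exact ih.biUnion fun t _ => hN t
  refine ⟨E, ⋃ m, S m, hE, countable_iUnion hS, ?_⟩
  have hclopen : @IsClopen M (W.fol i).leafTopology (⋃ t ∈ ⋃ m, S m, P t) := by
    have hopen : ∀ z c, IsOpen[(W.fol i).leafTopology] (plaque (E z) i c) := fun z c =>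
      (hE z).isOpen_plaque i c
    have hsub : ∀ x ∈ (⋃ t ∈ ⋃ m, S m, P t)ᶜ, ∃ z c, plaque (E z) i c ⊆ (⋃ t ∈ ⋃ m, S m, P t)ᶜ ∧
        x ∈ plaque (E z) i c := by
      intro x hx
      obtain ⟨z, hz, hxz⟩ := mem_iUnion₂.1 (hcov.symm ▸ mem_univ x : x ∈ ⋃ x ∈ s, (E x).source)
      refine ⟨z, E z x i, ?_, hxz, rfl⟩
      intro w hw hw'
      obtain ⟨t, ht, hwt⟩ := mem_iUnion₂.1 hw'
      obtain ⟨m, hm⟩ := mem_iUnion.1 ht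
      have hxP : x ∈ P (z, E z x i) := ⟨hxz, rfl⟩
      exact hx (mem_biUnion (mem_iUnion.2 ⟨m + 1, mem_biUnion hm ⟨hz, w, hwt, hw⟩⟩) hxP)
    generalize (W.fol i).leafTopology = τ at hopen ⊢
    refine ⟨(@isOpen_compl_iff M _ τ).1 (isOpen_iff_forall_mem_open.2 fun x hx => ?_),
      @isOpen_biUnion M _ τ _ _ fun t _ => hopen _ _⟩
    obtain ⟨z, c, h1, h2⟩ := hsub x hx
    exact ⟨_, h1, hopen z c, h2⟩
  exact @IsClopen.connectedComponent_subset M (W.fol i).leafTopology _ _ hclopen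
    (mem_biUnion (mem_iUnion.2 ⟨0, rfl⟩) ⟨hEs p, rfl⟩)

/-- A connected subset of a leaf which lies in the domain of an adapted chart lies in one plaque. -/
theorem Web.IsAdaptedChart.eq_of_subset_leaf (he : W.IsAdaptedChart e) {i : Fin n} {p : M}
    {S : Set M} (hS : IsPreconnected S) (hSe : S ⊆ e.source) (hSp : S ⊆ (W.fol i).leaf p) {x y : M}
    (hx : x ∈ S) (hy : y ∈ S) : e x i = e y i := by
  obtain ⟨E, T, hE, hT, hcov⟩ := W.exists_countable_cover_leaf i p
  have h1 : ((fun z => e z i) '' S).Countable := by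
    refine (hT.biUnion fun t _ => (hE t.1).countable_image_plaque (he.isDistinguished i) t.2).mono ?_
    rintro _ ⟨z, hz, rfl⟩
    obtain ⟨t, ht, hzt⟩ := mem_iUnion₂.1 (hcov (hSp hz))
    exact mem_biUnion ht ⟨z, ⟨hzt, hSe hz⟩, rfl⟩
  have h2 : IsPreconnected ((fun z => e z i) '' S) :=
    hS.image _ ((stdCoord i).continuous.comp_continuousOn (e.continuousOn.mono hSe))
  exact h1.isTotallyDisconnected _ subset_rfl h2 ⟨x, hx, rfl⟩ ⟨y, hy, rfl⟩

end

/-! ### Volumes of coordinate boxes -/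

section

open MeasureTheory

variable {n : ℕ}

theorem volume_hyperplane (i : Fin n) (c : ℝ) : volume {y : Euc n | y i = c} = 0 := by
  have h := (PiLp.volume_preserving_ofLp (Fin n)).measure_preimage
    (s := {f : Fin n → ℝ | f i = c})
    (measurableSet_eq_fun (measurable_pi_apply i) measurable_const).nullMeasurableSet
  have h2 : volume {f : Fin n → ℝ | f i = c} = 0 := by
    rw [volume_pi]
    exact Measure.pi_hyperplane (fun _ : Fin n => (volume : Measure ℝ)) i c
  rw [h2] at h
  exact h

theorem setIntegral_coordBox (f : Euc n → ℝ) (a b : Fin n → ℝ) :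
    ∫ y in coordBox a b, f y =
      ∫ z in Set.pi univ (fun k => uIcc (a k) (b k)), f (WithLp.toLp 2 z) := by
  have h := (PiLp.volume_preserving_toLp (Fin n)).setIntegral_preimage_emb
    (MeasurableEquiv.toLp 2 (Fin n → ℝ)).measurableEmbedding f (coordBox a b)
  rw [← h]
  congr 2
  ext z
  exact (mem_univ_pi (f := z)).symm

theorem volume_coordBox (a b : Fin n → ℝ) :
    volume (coordBox a b) = ∏ k, ENNReal.ofReal |b k - a k| := by
  have h := (PiLp.volume_preserving_ofLp (Fin n)).measure_preimage
    (s := Set.pi univ (fun k => uIcc (a k) (b k)))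
    (MeasurableSet.univ_pi fun k => measurableSet_uIcc).nullMeasurableSet
  have h2 : coordBox a b = WithLp.ofLp ⁻¹' Set.pi univ (fun k => uIcc (a k) (b k)) := by
    ext y
    exact (mem_univ_pi (f := y.ofLp)).symm
  rw [h2, h, volume_pi_pi]
  simp

theorem volume_real_coordBox (a b : Fin n → ℝ) :
    volume.real (coordBox a b) = ∏ k, |b k - a k| := by
  rw [Measure.real, volume_coordBox, ENNReal.toReal_prod]
  simp

theorem measurableSet_coordBox (a b : Fin n → ℝ) : MeasurableSet (coordBox a b) :=
  (isClosed_coordBox a b).measurableSet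

theorem ContinuousOn.integrableOn_coordBox {g : Euc n → ℝ} {a b : Fin n → ℝ}
    (hg : ContinuousOn g (coordBox a b)) : IntegrableOn g (coordBox a b) :=
  hg.integrableOn_compact (isCompact_coordBox a b)

theorem coordBox_update_right {a b : Fin n → ℝ} {i : Fin n} {c : ℝ} (hc : c ∈ uIcc (a i) (b i)) :
    coordBox a (Function.update b i c) ⊆ coordBox a b := by
  intro y hy k
  by_cases hk : k = i
  · subst hk
    have := hy k
    rw [Function.update_self] at this
    exact uIcc_subset_uIcc_left hc this
  · have := hy k
    rwa [Function.update_of_ne hk] at this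

theorem coordBox_update_left {a b : Fin n → ℝ} {i : Fin n} {c : ℝ} (hc : c ∈ uIcc (a i) (b i)) :
    coordBox (Function.update a i c) b ⊆ coordBox a b := by
  intro y hy k
  by_cases hk : k = i
  · subst hk
    have := hy k
    rw [Function.update_self] at this
    exact uIcc_subset_uIcc_right hc this
  · have := hy k
    rwa [Function.update_of_ne hk] at this

theorem coordBox_union {a b : Fin n → ℝ} {i : Fin n} {c : ℝ} (hc : c ∈ uIcc (a i) (b i)) :
    coordBox a (Function.update b i c) ∪ coordBox (Function.update a i c) b = coordBox a b := by
  refine subset_antisymm (union_subset (coordBox_update_right hc) (coordBox_update_left hc)) ?_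
  intro y hy
  have h1 : y i ∈ uIcc (a i) c ∪ uIcc c (b i) := uIcc_subset_uIcc_union_uIcc (hy i)
  rcases h1 with h1 | h1
  · left
    intro k
    by_cases hk : k = i
    · subst hk; rwa [Function.update_self]
    · rw [Function.update_of_ne hk]; exact hy k
  · right
    intro k
    by_cases hk : k = i
    · subst hk; rwa [Function.update_self]
    · rw [Function.update_of_ne hk]; exact hy k

theorem coordBox_inter {a b : Fin n → ℝ} {i : Fin n} {c : ℝ} (hc : c ∈ uIcc (a i) (b i)) :
    coordBox a (Function.update b i c) ∩ coordBox (Function.update a i c) b ⊆ {y | y i = c} := by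
  rintro y ⟨h1, h2⟩
  have h1 := h1 i
  have h2 := h2 i
  rw [Function.update_self] at h1 h2
  rw [mem_uIcc] at *
  change y i = c
  rcases h1 with h1 | h1 <;> rcases h2 with h2 | h2 <;> rcases hc with hc | hc <;>
    apply le_antisymm <;> linarith

/-- Cutting a box along a coordinate hyperplane. -/
theorem cellVol_cut {g : Euc n → ℝ} {a b : Fin n → ℝ} (hg : ContinuousOn g (coordBox a b))
    {i : Fin n} {c : ℝ} (hc : c ∈ uIcc (a i) (b i)) :
    cellVol g a b =
      cellVol g a (Function.update b i c) + cellVol g (Function.update a i c) b := by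
  unfold cellVol
  conv_lhs => rw [← coordBox_union hc]
  refine setIntegral_union₀ ?_ (measurableSet_coordBox _ _).nullMeasurableSet
    (hg.integrableOn_coordBox.mono_set (coordBox_update_right hc))
    (hg.integrableOn_coordBox.mono_set (coordBox_update_left hc))
  exact measure_mono_null (coordBox_inter hc) (volume_hyperplane i c)

theorem cellVol_nonneg {g : Euc n → ℝ} {a b : Fin n → ℝ} (h0 : ∀ y ∈ coordBox a b, 0 ≤ g y) :
    0 ≤ cellVol g a b :=
  setIntegral_nonneg (measurableSet_coordBox a b) h0

theorem le_cellVol {g : Euc n → ℝ} {a b : Fin n → ℝ} (hg : ContinuousOn g (coordBox a b)) {m : ℝ}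
    (hm : ∀ y ∈ coordBox a b, m ≤ g y) : m * ∏ k, |b k - a k| ≤ cellVol g a b := by
  have h1 : ∫ _ in coordBox a b, m = m * ∏ k, |b k - a k| := by
    rw [setIntegral_const, volume_real_coordBox, smul_eq_mul, mul_comm]
  rw [← h1]
  exact setIntegral_mono_on (integrableOn_const (isCompact_coordBox a b).measure_lt_top.ne)
    hg.integrableOn_coordBox (measurableSet_coordBox a b) hm

theorem cellVol_le {g : Euc n → ℝ} {a b : Fin n → ℝ} (hg : ContinuousOn g (coordBox a b)) {m : ℝ}
    (hm : ∀ y ∈ coordBox a b, g y ≤ m) : cellVol g a b ≤ m * ∏ k, |b k - a k| := by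
  have h1 : ∫ _ in coordBox a b, m = m * ∏ k, |b k - a k| := by
    rw [setIntegral_const, volume_real_coordBox, smul_eq_mul, mul_comm]
  rw [← h1]
  exact setIntegral_mono_on hg.integrableOn_coordBox
    (integrableOn_const (isCompact_coordBox a b).measure_lt_top.ne)
    (measurableSet_coordBox a b) hm

/-- The mean value theorem for integrals over a box. -/
theorem exists_cellVol_eq {g : Euc n → ℝ} {a b : Fin n → ℝ} (hg : ContinuousOn g (coordBox a b)) :
    ∃ ξ ∈ coordBox a b, cellVol g a b = g ξ * ∏ k, |b k - a k| := by
  have hne : (coordBox a b).Nonempty := ⟨_, left_mem_coordBox a b⟩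
  obtain ⟨y, hy, hmin⟩ := (isCompact_coordBox a b).exists_isMinOn hne hg
  obtain ⟨z, hz, hmax⟩ := (isCompact_coordBox a b).exists_isMaxOn hne hg
  have h1 := le_cellVol hg (m := g y) hmin
  have h2 := cellVol_le hg (m := g z) hmax
  by_cases h0 : ∏ k, |b k - a k| = 0
  · refine ⟨y, hy, ?_⟩
    rw [h0] at h1 h2 ⊢
    linarith
  · have hpos : 0 < ∏ k, |b k - a k| :=
      lt_of_le_of_ne (Finset.prod_nonneg fun _ _ => abs_nonneg _) (Ne.symm h0)
    have h3 : cellVol g a b / ∏ k, |b k - a k| ∈ Icc (g y) (g z) :=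
      ⟨(le_div_iff₀ hpos).2 h1, (div_le_iff₀ hpos).2 h2⟩
    obtain ⟨ξ, hξ, hξ'⟩ :=
      (convex_coordBox a b).isPreconnected.intermediate_value hy hz hg h3
    exact ⟨ξ, hξ, by rw [hξ', div_mul_cancel₀ _ h0]⟩

theorem cellVol_pos {g : Euc n → ℝ} {a b : Fin n → ℝ} (hg : ContinuousOn g (coordBox a b))
    (h0 : ∀ y ∈ coordBox a b, 0 < g y) (hab : ∀ k, a k ≠ b k) : 0 < cellVol g a b := by
  obtain ⟨ξ, hξ, h⟩ := exists_cellVol_eq hg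
  rw [h]
  exact mul_pos (h0 ξ hξ) (Finset.prod_pos fun k _ => abs_pos.2 (sub_ne_zero.2 (hab k).symm))

theorem cellVol_eq_zero {g : Euc n → ℝ} {a b : Fin n → ℝ} {k : Fin n} (hab : a k = b k) :
    cellVol g a b = 0 := by
  refine setIntegral_measure_zero _ ?_
  rw [volume_coordBox]
  exact Finset.prod_eq_zero (Finset.mem_univ k) (by simp [hab])

/-- Fubini's theorem for a product density. -/
theorem cellVol_prod {g : Euc n → ℝ} {a b : Fin n → ℝ} {κ : ℝ} {γ : Fin n → ℝ → ℝ}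
    (hg : ∀ y ∈ coordBox a b, g y = κ * ∏ k, γ k (y k)) :
    cellVol g a b = κ * ∏ k, ∫ t in uIcc (a k) (b k), γ k t := by
  unfold cellVol
  rw [setIntegral_congr_fun (measurableSet_coordBox a b) hg, integral_const_mul,
    setIntegral_coordBox]
  congr 1
  rw [volume_pi, Measure.restrict_pi_pi]
  exact integral_fintype_prod_eq_prod (fun k t => γ k t)

end

/-! ### Mixed partial derivatives -/

section

variable {n : ℕ} {E F : Type*} [NormedAddCommGroup E] [NormedSpace ℝ E] [NormedAddCommGroup F]
  [NormedSpace ℝ F]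

theorem ContDiffOn.fderiv_apply_const {f : E → F} {O : Set E} (hO : IsOpen O)
    (hf : ContDiffOn ℝ ∞ f O) (v : E) : ContDiffOn ℝ ∞ (fun z => fderiv ℝ f z v) O :=
  (hf.fderiv_of_isOpen hO (by simp)).clm_apply contDiffOn_const

theorem ContDiffOn.differentiableAt_of_isOpen {f : E → F} {O : Set E} (hO : IsOpen O)
    (hf : ContDiffOn ℝ ∞ f O) {y : E} (hy : y ∈ O) : DifferentiableAt ℝ f y :=
  (hf.contDiffAt (hO.mem_nhds hy)).differentiableAt (by simp)

theorem ContDiffOn.fderiv_fderiv_comm {f : E → F} {O : Set E} (hO : IsOpen O)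
    (hf : ContDiffOn ℝ ∞ f O) {y : E} (hy : y ∈ O) (u v : E) :
    fderiv ℝ (fun z => fderiv ℝ f z v) y u = fderiv ℝ (fun z => fderiv ℝ f z u) y v := by
  have h1 : DifferentiableAt ℝ (fderiv ℝ f) y :=
    (hf.fderiv_of_isOpen hO (m := ∞) (by simp)).differentiableAt_of_isOpen hO hy
  have h2 : ∀ w, fderiv ℝ (fun z => fderiv ℝ f z w) y = (fderiv ℝ (fderiv ℝ f) y).flip w := by
    intro w
    have := (h1.hasFDerivAt.clm_apply (hasFDerivAt_const w y)).fderiv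
    rw [this]
    ext x
    simp
  rw [h2, h2]
  have h3 := (hf.contDiffAt (hO.mem_nhds hy)).isSymmSndFDerivAt (by
    rw [minSmoothness_of_isRCLikeNormedField]; exact WithTop.coe_le_coe.2 le_top)
  exact h3 u v

/-- The point obtained from `y` by replacing the `k`-th coordinate by `t`. -/
noncomputable def setCoord (y : Euc n) (k : Fin n) (t : ℝ) : Euc n :=
  WithLp.toLp 2 (Function.update y k t)

@[simp] theorem setCoord_self (y : Euc n) (k : Fin n) (t : ℝ) : setCoord y k t k = t := by
  simp [setCoord]

theorem setCoord_of_ne (y : Euc n) {k l : Fin n} (h : l ≠ k) (t : ℝ) :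
    setCoord y k t l = y l := by
  simp [setCoord, h]

@[simp] theorem setCoord_eq_self (y : Euc n) (k : Fin n) : setCoord y k (y k) = y := by
  simp [setCoord]

theorem setCoord_eq_add (y : Euc n) (k : Fin n) (t : ℝ) :
    setCoord y k t = y + (t - y k) • stdVec k := by
  ext l
  by_cases h : l = k
  · subst h; simp
  · simp [setCoord_of_ne y h, h]

theorem hasDerivAt_setCoord (y : Euc n) (k : Fin n) (t : ℝ) :
    HasDerivAt (setCoord y k) (stdVec k) t := by
  have h : setCoord y k = fun t => y + (t - y k) • stdVec k := funext (setCoord_eq_add y k)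
  rw [h]
  simpa using (((hasDerivAt_id t).sub_const (y k)).smul_const (stdVec k)).const_add y

theorem continuous_setCoord (y : Euc n) (k : Fin n) : Continuous (setCoord y k) :=
  continuous_iff_continuousAt.2 fun t => (hasDerivAt_setCoord y k t).continuousAt

theorem Euc.eq_sum (v : Euc n) : v = ∑ k, v k • stdVec k := by
  ext l
  simp [Finset.sum_apply, Pi.single_apply]

theorem fderiv_apply_eq_sum (f : Euc n → F) (y v : Euc n) :
    fderiv ℝ f y v = ∑ k, v k • fderiv ℝ f y (stdVec k) := by
  conv_lhs => rw [Euc.eq_sum v]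
  simp

/-- A function on an open box whose mixed partial derivatives vanish is a sum of functions of one
variable. -/
theorem sub_eq_sum_of_mixedPartials_eq_zero {L : Euc n → ℝ} {l u : Fin n → ℝ}
    (hL : ContDiffOn ℝ ∞ L {y | ∀ i, y i ∈ Ioo (l i) (u i)})
    (h0 : ∀ i j, i ≠ j → ∀ y : Euc n, (∀ i, y i ∈ Ioo (l i) (u i)) →
      fderiv ℝ (fun z => fderiv ℝ L z (stdVec j)) y (stdVec i) = 0) {y₀ y : Euc n}
    (hy₀ : ∀ i, y₀ i ∈ Ioo (l i) (u i)) (hy : ∀ i, y i ∈ Ioo (l i) (u i)) :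
    L y - L y₀ = ∑ k, (L (setCoord y₀ k (y k)) - L y₀) := by
  set T : Set (Euc n) := {y | ∀ i, y i ∈ Ioo (l i) (u i)} with hT
  have hTo : IsOpen T := isOpen_openBox l u
  have hTc : Convex ℝ T := convex_openBox l u
  have hmem : ∀ z ∈ T, ∀ k, setCoord y₀ k (z k) ∈ T := by
    intro z hz k i
    by_cases h : i = k
    · subst h; rw [setCoord_self]; exact hz i
    · rw [setCoord_of_ne y₀ h]; exact hy₀ i
  have hdep : ∀ k, ∀ z ∈ T, fderiv ℝ L (setCoord y₀ k (z k)) (stdVec k) =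
      fderiv ℝ L z (stdVec k) := by
    intro k z hz
    refine eq_of_fderiv_eq_zero (i := k) hTc (f := fun z => fderiv ℝ L z (stdVec k)) (fun y hy =>
      (hL.fderiv_apply_const hTo (stdVec k)).differentiableAt_of_isOpen hTo hy) ?_ (hmem z hz k) hz
      (setCoord_self _ _ _)
    intro y hy v hv
    rw [fderiv_apply_eq_sum]
    refine Finset.sum_eq_zero fun i _ => ?_
    by_cases h : i = k
    · subst h; rw [hv, zero_smul]
    · rw [h0 i k h y hy, smul_zero]
  have hd : ∀ z ∈ T, HasFDerivAt (fun z => L z - ∑ k, L (setCoord y₀ k (z k)))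
      (0 : Euc n →L[ℝ] ℝ) z := by
    intro z hz
    have h1 : ∀ k, HasFDerivAt (fun z : Euc n => L (setCoord y₀ k (z k)))
        ((fderiv ℝ L z (stdVec k)) • stdCoord k) z := by
      intro k
      have h2 : HasFDerivAt L (fderiv ℝ L (setCoord y₀ k (z k))) (setCoord y₀ k (z k)) :=
        (hL.differentiableAt_of_isOpen hTo (hmem z hz k)).hasFDerivAt
      have h3 := h2.comp_hasDerivAt (z k) (hasDerivAt_setCoord y₀ k (z k))
      have h4 := h3.comp_hasFDerivAt z (stdCoord k).hasFDerivAt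
      rw [hdep k z hz] at h4
      exact h4
    have h5 := (hL.differentiableAt_of_isOpen hTo hz).hasFDerivAt.sub
      (HasFDerivAt.fun_sum fun k (_ : k ∈ Finset.univ) => h1 k)
    convert! h5 using 1
    ext v
    have := fderiv_apply_eq_sum L z v
    simp [this, mul_comm]
  have hconst := hTc.is_const_of_fderivWithin_eq_zero (𝕜 := ℝ)
    (f := fun z => L z - ∑ k, L (setCoord y₀ k (z k)))
    (fun z hz => (hd z hz).differentiableAt.differentiableWithinAt)
    (fun z hz => (hd z hz).hasFDerivWithinAt.fderivWithin (hTo.uniqueDiffWithinAt hz)) hy hy₀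
  simp only [setCoord_eq_self] at hconst
  rw [Finset.sum_sub_distrib]
  linarith

end

section

variable {n : ℕ} {M : Type*} [TopologicalSpace M] [ChartedSpace (Euc n) M]
variable {e e' : OpenPartialHomeomorph M (Euc n)}

namespace DivergenceFreeWeb

variable (W : DivergenceFreeWeb n M)

theorem contDiffOn_log_density (he : e ∈ IsManifold.maximalAtlas (𝓡 n) ∞ M) :
    ContDiffOn ℝ ∞ (fun y => Real.log (W.density e y)) e.target :=
  (W.contDiffOn_density he).log fun _ hy => W.density_ne_zero he hy

/-- Transformation rule of the mixed second derivatives of the logarithm of the density. The `i`-th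
component of the transition map depends on the `i`-th coordinate only, so the logarithm of its
Jacobian is a sum of functions of one variable and does not contribute. -/
theorem logDensityPartial_transition (he : W.IsAdaptedChart e) (he' : W.IsAdaptedChart e')
    {y : Euc n} (hy : y ∈ e.target) (hy' : e.symm y ∈ e'.source) {i j : Fin n} (hij : i ≠ j) :
    W.logDensityPartial e i j y =
      (fderiv ℝ (e' ∘ e.symm) y (stdVec i)) i * (fderiv ℝ (e' ∘ e.symm) y (stdVec j)) j *
        W.logDensityPartial e' i j (e' (e.symm y)) := by
  set φ := e' ∘ e.symm with hφ
  set O := e.target ∩ e.symm ⁻¹' e'.source with hOdef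
  have hO : IsOpen O := e.isOpen_inter_preimage_symm e'.open_source
  have hφO : ContDiffOn ℝ ∞ φ O := contDiffOn_transition he.1 he'.1
  have hyO : y ∈ O := ⟨hy, hy'⟩
  have hφt : ∀ z ∈ O, φ z ∈ e'.target := fun z hz => e'.map_source hz.2
  -- the diagonal entries of the differential of the transition map, and below their logarithms `N`
  let A : Fin n → Euc n → ℝ := fun k z => (fderiv ℝ φ z (stdVec k)) k
  let L' : Euc n → ℝ := fun z => Real.log (W.density e' z)
  have hL' : ContDiffOn ℝ ∞ L' e'.target := W.contDiffOn_log_density he'.1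
  have hA0 : ∀ k, ∀ z ∈ O, A k z ≠ 0 := fun k z hz =>
    he.fderiv_transition_self_ne_zero he' hz.1 hz.2 k
  have hAk : ∀ k v, ∀ z ∈ O, (fderiv ℝ φ z v) k = v k * A k z := fun k v z hz =>
    he.fderiv_transition_apply he' hz.1 hz.2 k v
  have hφk : ∀ k, ContDiffOn ℝ ∞ (fun z => φ z k) O := fun k =>
    (stdCoord k).contDiff.comp_contDiffOn hφO
  have hφkd : ∀ k v, ∀ z ∈ O, fderiv ℝ (fun z => φ z k) z v = v k * A k z := by
    intro k v z hz
    rw [← hAk k v z hz]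
    have := (stdCoord k).hasFDerivAt.comp z (hφO.differentiableAt_of_isOpen hO hz).hasFDerivAt
    exact congrArg (fun l => l v) this.fderiv
  have hA : ∀ k, ContDiffOn ℝ ∞ (A k) O := by
    intro k
    refine ((hφk k).fderiv_apply_const hO (stdVec k)).congr fun z hz => ?_
    rw [hφkd k _ z hz]
    simp
  have hAd : ∀ k v, v k = 0 → ∀ z ∈ O, fderiv ℝ (A k) z v = 0 := by
    intro k v hv z hz
    have h1 : A k =ᶠ[𝓝 z] fun z => fderiv ℝ (fun z => φ z k) z (stdVec k) := by
      filter_upwards [hO.mem_nhds hz] with w hw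
      rw [hφkd k _ w hw]
      simp
    have h2 : (fun z => fderiv ℝ (fun z => φ z k) z v) =ᶠ[𝓝 z] fun _ => 0 := by
      filter_upwards [hO.mem_nhds hz] with w hw
      rw [hφkd k _ w hw, hv, zero_mul]
    rw [h1.fderiv_eq, (hφk k).fderiv_fderiv_comm hO hz, h2.fderiv_eq]
    simp
  let N : Fin n → Euc n → ℝ := fun k z => Real.log (A k z)
  have hN : ∀ k, ContDiffOn ℝ ∞ (N k) O := fun k => (hA k).log (hA0 k)
  have hNd : ∀ k v, v k = 0 → ∀ z ∈ O, fderiv ℝ (N k) z v = 0 := by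
    intro k v hv z hz
    have := (((hA k).differentiableAt_of_isOpen hO hz).hasFDerivAt.log (hA0 k z hz)).fderiv
    have h2 : fderiv ℝ (N k) z v = (A k z)⁻¹ * fderiv ℝ (A k) z v :=
      congrArg (fun l => l v) this
    rw [h2, hAd k v hv z hz, mul_zero]
  have hL : ∀ z ∈ O, Real.log (W.density e z) = L' (φ z) + ∑ k, N k z := by
    intro z hz
    rw [W.density_transition he.1 he'.1 hz.1 hz.2, he.det_fderiv_transition he' hz.1 hz.2]
    change Real.log ((∏ k, A k z) * W.density e' (φ z)) = _
    rw [Real.log_mul (Finset.prod_ne_zero_iff.2 fun k _ => hA0 k z hz)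
        (W.density_ne_zero he'.1 (hφt z hz)), Real.log_prod (fun k _ => hA0 k z hz), add_comm]
  have hφstd : ∀ k, ∀ z ∈ O, fderiv ℝ φ z (stdVec k) = A k z • stdVec k := by
    intro k z hz
    ext m
    rw [hAk m _ z hz]
    by_cases h : m = k
    · subst h; simp
    · simp [h]
  have hcomp : ∀ (G : Euc n → ℝ), ContDiffOn ℝ ∞ G e'.target → ∀ k, ∀ z ∈ O,
      fderiv ℝ (fun z => G (φ z)) z (stdVec k) = A k z * fderiv ℝ G (φ z) (stdVec k) := by
    intro G hG k z hz
    have h1 := (hG.differentiableAt_of_isOpen e'.open_target (hφt z hz)).hasFDerivAt.comp z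
      (hφO.differentiableAt_of_isOpen hO hz).hasFDerivAt
    have h2 : fderiv ℝ (fun z => G (φ z)) z (stdVec k) =
      fderiv ℝ G (φ z) (fderiv ℝ φ z (stdVec k)) := congrArg (fun l => l (stdVec k)) h1.fderiv
    rw [h2, hφstd k z hz, map_smul, smul_eq_mul]
  have hGd : ∀ (G : Euc n → ℝ), ContDiffOn ℝ ∞ G e'.target → ∀ z ∈ O,
      DifferentiableAt ℝ (fun z => G (φ z)) z := fun G hG z hz =>
    (hG.differentiableAt_of_isOpen e'.open_target (hφt z hz)).comp z
      (hφO.differentiableAt_of_isOpen hO hz)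
  have hfirst : ∀ z ∈ O, fderiv ℝ (fun z => Real.log (W.density e z)) z (stdVec j) =
      A j z * fderiv ℝ L' (φ z) (stdVec j) + fderiv ℝ (N j) z (stdVec j) := by
    intro z hz
    have h1 : (fun z => Real.log (W.density e z)) =ᶠ[𝓝 z] fun z => L' (φ z) + ∑ k, N k z := by
      filter_upwards [hO.mem_nhds hz] with w hw using hL w hw
    have h2 : DifferentiableAt ℝ (fun z => ∑ k, N k z) z :=
      DifferentiableAt.fun_sum fun k _ => (hN k).differentiableAt_of_isOpen hO hz
    rw [h1.fderiv_eq, fderiv_fun_add (hGd L' hL' z hz) h2, _root_.add_apply,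
      hcomp L' hL' j z hz,
      fderiv_fun_sum fun k _ => (hN k).differentiableAt_of_isOpen hO hz,
      _root_.sum_apply]
    congr 1
    refine Finset.sum_eq_single_of_mem j (Finset.mem_univ j) fun k _ hk => ?_
    exact hNd k _ (by simp [hk]) z hz
  let G : Euc n → ℝ := fun z => fderiv ℝ L' z (stdVec j)
  have hG : ContDiffOn ℝ ∞ G e'.target := hL'.fderiv_apply_const e'.open_target _
  have h1 : (fun z => fderiv ℝ (fun z => Real.log (W.density e z)) z (stdVec j)) =ᶠ[𝓝 y]
      fun z => A j z * G (φ z) + fderiv ℝ (N j) z (stdVec j) := by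
    filter_upwards [hO.mem_nhds hyO] with w hw using hfirst w hw
  have h2 : fderiv ℝ (fun z => fderiv ℝ (N j) z (stdVec j)) y (stdVec i) = 0 := by
    rw [(hN j).fderiv_fderiv_comm hO hyO]
    have : (fun z => fderiv ℝ (N j) z (stdVec i)) =ᶠ[𝓝 y] fun _ => 0 := by
      filter_upwards [hO.mem_nhds hyO] with w hw using hNd j _ (by simp [hij.symm]) w hw
    rw [this.fderiv_eq]
    simp
  have hAj := (hA j).differentiableAt_of_isOpen hO hyO
  unfold logDensityPartial
  rw [h1.fderiv_eq, fderiv_fun_add (hAj.fun_mul (hGd G hG y hyO))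
    (((hN j).fderiv_apply_const hO _).differentiableAt_of_isOpen hO hyO),
    _root_.add_apply, h2, fderiv_fun_mul hAj (hGd G hG y hyO),
    _root_.add_apply, _root_.smul_apply,
    _root_.smul_apply, hAd j _ (by simp [hij.symm]) y hyO, hcomp G hG i y hyO]
  simp only [smul_eq_mul, mul_zero, add_zero]
  change _ = A i y * A j y * fderiv ℝ G (φ y) (stdVec i)
  ring

/-- The mixed second derivatives of the logarithm of the density vanish in every adapted chart. -/
def MixedPartialsVanish : Prop :=
  ∀ e, W.IsAdaptedChart e → ∀ i j, i ≠ j → ∀ y ∈ e.target, W.logDensityPartial e i j y = 0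

variable {W}

/-- It is enough to know at each point that the mixed derivatives vanish in one adapted chart. -/
theorem mixedPartialsVanish_of_exists [IsManifold (𝓡 n) ∞ M]
    (h : ∀ p : M, ∃ e, W.IsAdaptedChart e ∧ p ∈ e.source ∧
      ∀ i j, i ≠ j → W.logDensityPartial e i j (e p) = 0) : W.MixedPartialsVanish := by
  intro e he i j hij y hy
  obtain ⟨e', he', hp, h0⟩ := h (e.symm y)
  rw [W.logDensityPartial_transition he he' hy hp hij, h0 i j hij, mul_zero]

theorem mixedPartialsVanish_iff_nonuniformity [IsManifold (𝓡 n) ∞ M] :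
    W.MixedPartialsVanish ↔ ∀ p : M, W.nonuniformity p = 0 := by
  have hex : ∀ p : M, ∃ e, W.IsAdaptedChart e ∧ p ∈ e.source := fun p => by
    obtain ⟨e, he, hp, -⟩ := W.exists_adaptedChart p
    exact ⟨e, he, hp⟩
  constructor
  · intro h p
    unfold nonuniformity
    rw [dif_pos (hex p)]
    refine Finset.sum_eq_zero fun i _ => Finset.sum_eq_zero fun j hj => ?_
    obtain ⟨h1, h2⟩ := (hex p).choose_spec
    rw [h _ h1 i j (Finset.mem_filter.1 hj).2 _ ((hex p).choose.map_source h2), zero_smul]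
  · intro h
    refine mixedPartialsVanish_of_exists fun p => ?_
    have hp := h p
    unfold nonuniformity at hp
    rw [dif_pos (hex p)] at hp
    obtain ⟨he, hpe⟩ := (hex p).choose_spec
    generalize (hex p).choose = e at he hpe hp
    refine ⟨e, he, hpe, fun i j hij => ?_⟩
    have hsurj := (mdifferentiable_of_mem_maximalAtlas he.1).mfderiv_surjective hpe
    obtain ⟨u, hu⟩ := hsurj (stdVec i)
    obtain ⟨v, hv⟩ := hsurj (stdVec j)
    have hu' : ∀ k, coordDifferential e p k u = (stdVec i : Euc n) k := fun k =>
      congrArg (fun w : Euc n => stdCoord k w) hu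
    have hv' : ∀ k, coordDifferential e p k v = (stdVec j : Euc n) k := fun k =>
      congrArg (fun w : Euc n => stdCoord k w) hv
    have h1 := DFunLike.congr_fun (DFunLike.congr_fun hp u) v
    simp only [LinearMap.sum_apply, LinearMap.smul_apply, LinearMap.smulRight_apply, hu', hv',
      smul_eq_mul, LinearMap.zero_apply] at h1
    rw [Finset.sum_eq_single_of_mem i (Finset.mem_univ i),
      Finset.sum_eq_single_of_mem j (by simp [hij])] at h1
    · simpa using h1
    · intro k _ hk
      simp [hk]
    · intro k _ hk
      refine Finset.sum_eq_zero fun l _ => ?_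
      simp [hk]

end DivergenceFreeWeb

end

/-! ### Integrals of positive functions over intervals -/

section

open MeasureTheory

theorem setIntegral_Icc_add {γ : ℝ → ℝ} {s c t : ℝ} (hγ : ContinuousOn γ (Icc s t)) (hsc : s ≤ c)
    (hct : c ≤ t) : ∫ x in Icc s t, γ x = (∫ x in Icc s c, γ x) + ∫ x in Icc c t, γ x := by
  rw [← Icc_union_Icc_eq_Icc hsc hct] at hγ ⊢
  refine setIntegral_union₀ ?_ measurableSet_Icc.nullMeasurableSet
    ((hγ.mono subset_union_left).integrableOn_Icc) ((hγ.mono subset_union_right).integrableOn_Icc)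
  refine measure_mono_null (t := {c}) ?_ (by simp)
  rintro x ⟨h1, h2⟩
  exact le_antisymm h1.2 h2.1

theorem setIntegral_Icc_pos {γ : ℝ → ℝ} {s t : ℝ} (hγ : ContinuousOn γ (Icc s t)) (hst : s < t)
    (h0 : ∀ x ∈ Icc s t, 0 < γ x) : 0 < ∫ x in Icc s t, γ x := by
  rw [integral_Icc_eq_integral_Ioc, ← intervalIntegral.integral_of_le hst.le]
  refine intervalIntegral.intervalIntegral_pos_of_pos_on ?_ (fun x hx => h0 x ⟨hx.1.le, hx.2.le⟩)
    hst
  exact ContinuousOn.intervalIntegrable (by rwa [uIcc_of_le hst.le])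

/-- The median of a density on an interval. -/
theorem exists_bisection {γ : ℝ → ℝ} {s t : ℝ} (hγ : ContinuousOn γ (uIcc s t)) :
    ∃ c ∈ uIcc s t, ∫ x in uIcc s c, γ x = ∫ x in uIcc c t, γ x := by
  wlog hst : s ≤ t generalizing s t
  · rw [uIcc_comm] at hγ
    obtain ⟨c, hc, h⟩ := this hγ (le_of_not_ge hst)
    refine ⟨c, by rwa [uIcc_comm], ?_⟩
    rw [uIcc_comm s c, uIcc_comm c t, h]
  rw [uIcc_of_le hst] at hγ ⊢
  have h1 : ContinuousOn (fun c => (∫ x in Icc s c, γ x) - ∫ x in Icc c t, γ x) (Icc s t) := by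
    have h2 := intervalIntegral.continuousOn_primitive_Icc (μ := volume) hγ.integrableOn_Icc
    refine (h2.sub (continuousOn_const (c := ∫ x in Icc s t, γ x) |>.sub h2)).congr ?_
    intro c hc
    have := setIntegral_Icc_add hγ hc.1 hc.2
    simp only [Pi.sub_apply]
    rw [this]
    ring
  have h3 : (0 : ℝ) ∈ uIcc ((∫ x in Icc s s, γ x) - ∫ x in Icc s t, γ x)
      ((∫ x in Icc s t, γ x) - ∫ x in Icc t t, γ x) := by
    simp only [Icc_self, Measure.restrict_singleton, Real.volume_singleton, zero_smul,
      integral_zero_measure, sub_zero, zero_sub]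
    rw [mem_uIcc]
    rcases le_total 0 (∫ x in Icc s t, γ x) with h | h
    · exact Or.inl ⟨by linarith, h⟩
    · exact Or.inr ⟨h, by linarith⟩
  obtain ⟨c, hc, hc'⟩ := intermediate_value_uIcc (by rwa [uIcc_of_le hst]) h3
  rw [uIcc_of_le hst] at hc
  refine ⟨c, hc, ?_⟩
  rw [uIcc_of_le hc.1, uIcc_of_le hc.2]
  simp only at hc'
  linarith

theorem eq_of_setIntegral_uIcc_eq {γ : ℝ → ℝ} {l u : ℝ} (hγ : ContinuousOn γ (Ioo l u))
    (hpos : ∀ x ∈ Ioo l u, 0 < γ x) (h0 : (0 : ℝ) ∈ Ioo l u) {s t : ℝ} (hs : s ∈ Ioo l u)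
    (ht : t ∈ Ioo l u) (hst : 0 < s * t)
    (h : ∫ x in uIcc 0 s, γ x = ∫ x in uIcc 0 t, γ x) : s = t := by
  wlog hle : s ≤ t generalizing s t
  · exact (this ht hs (by rwa [mul_comm]) h.symm (le_of_not_ge hle)).symm
  by_contra hne
  have hlt : s < t := lt_of_le_of_ne hle hne
  have hsub : ∀ {a b : ℝ}, a ∈ Ioo l u → b ∈ Ioo l u → Icc a b ⊆ Ioo l u := fun ha hb x hx =>
    ⟨ha.1.trans_le hx.1, hx.2.trans_lt hb.2⟩
  have hst' := setIntegral_Icc_pos (hγ.mono (hsub hs ht)) hlt fun x hx => hpos x (hsub hs ht hx)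
  rcases pos_and_pos_or_neg_and_neg_of_mul_pos hst with h1 | h1
  · rw [uIcc_of_le h1.1.le, uIcc_of_le h1.2.le,
      setIntegral_Icc_add (hγ.mono (hsub h0 ht)) h1.1.le hle] at h
    linarith
  · rw [uIcc_of_ge h1.1.le, uIcc_of_ge h1.2.le,
      setIntegral_Icc_add (hγ.mono (hsub hs h0)) hle h1.2.le] at h
    linarith

end

/-! ### Product densities -/

section

variable {n : ℕ}

/-- `g` is, on the open box with vertices `l` and `u`, a positive constant times a product of
positive continuous functions `γ k` of the single coordinates. -/
structure IsProductDensity (g : Euc n → ℝ) (l u : Fin n → ℝ) (κ : ℝ) (γ : Fin n → ℝ → ℝ) :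
    Prop where
  pos : 0 < κ
  continuousOn : ∀ k, ContinuousOn (γ k) (Ioo (l k) (u k))
  factor_pos : ∀ k, ∀ t ∈ Ioo (l k) (u k), 0 < γ k t
  eq_prod : ∀ y : Euc n, (∀ k, y k ∈ Ioo (l k) (u k)) → g y = κ * ∏ k, γ k (y k)

theorem IsProductDensity.cellVol_eq {g : Euc n → ℝ} {l u : Fin n → ℝ} {κ : ℝ}
    {γ : Fin n → ℝ → ℝ} (h : IsProductDensity g l u κ γ) {a b : Fin n → ℝ}
    (ha : ∀ k, a k ∈ Ioo (l k) (u k)) (hb : ∀ k, b k ∈ Ioo (l k) (u k)) :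
    cellVol g a b = κ * ∏ k, ∫ t in uIcc (a k) (b k), γ k t :=
  cellVol_prod fun y hy => h.eq_prod y (coordBox_subset_openBox ha hb hy)

/-- The volumes of the four corner boxes cut out by two hyperplanes satisfy `ac = bd`. -/
theorem IsProductDensity.corner_mul_corner {g : Euc n → ℝ} {l u : Fin n → ℝ} {κ : ℝ}
    {γ : Fin n → ℝ → ℝ} (h : IsProductDensity g l u κ γ) {a b : Fin n → ℝ}
    (ha : ∀ k, a k ∈ Ioo (l k) (u k)) (hb : ∀ k, b k ∈ Ioo (l k) (u k)) {i j : Fin n}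
    (hij : i ≠ j) {c d : ℝ} (hc : c ∈ Ioo (l i) (u i)) (hd : d ∈ Ioo (l j) (u j)) :
    cellVol g a (Function.update (Function.update b i c) j d) *
        cellVol g (Function.update (Function.update a i c) j d) b =
      cellVol g (Function.update a j d) (Function.update b i c) *
        cellVol g (Function.update a i c) (Function.update b j d) := by
  have hupd : ∀ (f : Fin n → ℝ) (i : Fin n) (c : ℝ), (∀ k, f k ∈ Ioo (l k) (u k)) →
      c ∈ Ioo (l i) (u i) → ∀ k, Function.update f i c k ∈ Ioo (l k) (u k) := by
    intro f i c hf hc k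
    by_cases hk : k = i
    · subst hk; rwa [Function.update_self]
    · rw [Function.update_of_ne hk]; exact hf k
  have hmul : ∀ A B C D : ℝ, A * B = C * D → κ * A * (κ * B) = κ * C * (κ * D) :=
    fun A B C D h => by linear_combination κ * κ * h
  rw [h.cellVol_eq ha (hupd _ _ _ (hupd _ _ _ hb hc) hd),
    h.cellVol_eq (hupd _ _ _ (hupd _ _ _ ha hc) hd) hb,
    h.cellVol_eq (hupd _ _ _ ha hd) (hupd _ _ _ hb hc),
    h.cellVol_eq (hupd _ _ _ ha hc) (hupd _ _ _ hb hd)]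
  refine hmul _ _ _ _ ?_
  rw [← Finset.prod_mul_distrib, ← Finset.prod_mul_distrib]
  refine Finset.prod_congr rfl fun k _ => ?_
  by_cases hki : k = i
  · subst hki
    simp [hij]
  · by_cases hkj : k = j
    · subst hkj
      simp [hki, mul_comm]
    · simp [hki, hkj]

variable {M : Type*} [TopologicalSpace M] [ChartedSpace (Euc n) M]
variable {e : OpenPartialHomeomorph M (Euc n)} {W : DivergenceFreeWeb n M}

namespace DivergenceFreeWeb

theorem density_div_pos (he : W.IsAdaptedChart e) {y y₀ : Euc n} (hy : y ∈ e.target)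
    (hy₀ : y₀ ∈ e.target) : 0 < W.density e y / W.density e y₀ := by
  have hconn : IsPreconnected e.target := by
    obtain ⟨-, ⟨l, u, h⟩, -⟩ := he
    rw [h]
    exact (convex_openBox l u).isPreconnected
  have hc : ContinuousOn (fun y => W.density e y / W.density e y₀) e.target :=
    (W.contDiffOn_density he.1).continuousOn.div_const _
  by_contra! hneg
  have h1 : (1 : ℝ) = W.density e y₀ / W.density e y₀ :=
    (div_self (W.density_ne_zero he.1 hy₀)).symm
  have h2 : (0 : ℝ) ∈ (fun y => W.density e y / W.density e y₀) '' e.target :=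
    hconn.intermediate_value hy hy₀ hc ⟨hneg, by rw [← h1]; norm_num⟩
  obtain ⟨z, hz, hz'⟩ := h2
  exact div_ne_zero (W.density_ne_zero he.1 hz) (W.density_ne_zero he.1 hy₀) hz'

theorem setCoord_mem_target (he : W.IsAdaptedChart e) {y y₀ : Euc n} (hy : y ∈ e.target)
    (hy₀ : y₀ ∈ e.target) (k : Fin n) : setCoord y₀ k (y k) ∈ e.target := by
  obtain ⟨-, ⟨l, u, h⟩, -⟩ := he
  rw [h] at hy hy₀ ⊢
  intro i
  by_cases hi : i = k
  · subst hi; rw [setCoord_self]; exact hy i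
  · rw [setCoord_of_ne y₀ hi]; exact hy₀ i

theorem MixedPartialsVanish.density_eq (hP : W.MixedPartialsVanish) (he : W.IsAdaptedChart e)
    {y y₀ : Euc n} (hy : y ∈ e.target) (hy₀ : y₀ ∈ e.target) :
    W.density e y = W.density e y₀ *
      ∏ k, (W.density e (setCoord y₀ k (y k)) / W.density e y₀) := by
  have h0 := W.density_ne_zero he.1 hy₀
  obtain ⟨l, u, h⟩ := he.2.1
  have hy' := hy
  have hy₀' := hy₀
  rw [h] at hy' hy₀'
  have h1 := sub_eq_sum_of_mixedPartials_eq_zero (L := fun z => Real.log (W.density e z))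
    (h ▸ W.contDiffOn_log_density he.1)
    (fun i j hij z hz => hP e he i j hij z (by rw [h]; exact hz)) hy₀' hy'
  have hne := W.density_ne_zero he.1 hy
  have hnk : ∀ k, W.density e (setCoord y₀ k (y k)) ≠ 0 := fun k =>
    W.density_ne_zero he.1 (setCoord_mem_target he hy hy₀ k)
  have h2 : Real.log (W.density e y / W.density e y₀) =
      Real.log (∏ k, (W.density e (setCoord y₀ k (y k)) / W.density e y₀)) := by
    rw [Real.log_div hne h0, Real.log_prod fun k _ => div_ne_zero (hnk k) h0, h1]
    exact Finset.sum_congr rfl fun k _ => (Real.log_div (hnk k) h0).symm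
  have h3 := Real.log_injOn_pos (density_div_pos he hy hy₀)
    (Finset.prod_pos fun k _ => density_div_pos he (setCoord_mem_target he hy hy₀ k) hy₀) h2
  rw [← h3, mul_div_cancel₀ _ h0]

theorem MixedPartialsVanish.exists_isProductDensity (hP : W.MixedPartialsVanish)
    (he : W.IsAdaptedChart e) {l u : Fin n → ℝ} (h : e.target = {y | ∀ k, y k ∈ Ioo (l k) (u k)})
    {y₀ : Euc n} (hy₀ : y₀ ∈ e.target) :
    ∃ κ γ, IsProductDensity (fun y => |W.density e y|) l u κ γ := by
  have hmem : ∀ k, ∀ t ∈ Ioo (l k) (u k), setCoord y₀ k t ∈ e.target := by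
    intro k t ht
    rw [h] at hy₀ ⊢
    intro i
    by_cases hi : i = k
    · subst hi; rwa [setCoord_self]
    · rw [setCoord_of_ne y₀ hi]; exact hy₀ i
  refine ⟨|W.density e y₀|, fun k t => W.density e (setCoord y₀ k t) / W.density e y₀,
    abs_pos.2 (W.density_ne_zero he.1 hy₀), fun k => ?_, fun k t ht =>
      density_div_pos he (hmem k t ht) hy₀, fun y hy => ?_⟩
  · exact ((W.contDiffOn_density he.1).continuousOn.comp (continuous_setCoord y₀ k).continuousOn
      (hmem k)).div_const _
  · have hy' : y ∈ e.target := by rw [h]; exact hy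
    simp only
    rw [hP.density_eq he hy' hy₀, abs_mul, abs_of_pos (a := ∏ k, _)]
    exact Finset.prod_pos fun k _ => density_div_pos he (hmem k _ (hy k)) hy₀

end DivergenceFreeWeb

end

/-! ### Subdivisions in an adapted chart -/

section

open MeasureTheory

variable {n : ℕ}

theorem update_mem_box {l u f : Fin n → ℝ} (hf : ∀ k, f k ∈ Ioo (l k) (u k)) {i : Fin n} {c : ℝ}
    (hc : c ∈ Ioo (l i) (u i)) (k : Fin n) : Function.update f i c k ∈ Ioo (l k) (u k) := by
  by_cases hk : k = i
  · subst hk; rwa [Function.update_self]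
  · rw [Function.update_of_ne hk]; exact hf k

/-- If a convex set is the union of two closed sets which meet only in the hyperplane `xᵢ = c`
and of which none is contained in that hyperplane, then they lie on different sides of it. -/
theorem split_of_inter_subset_hyperplane {K X Y : Set (Euc n)} (hK : Convex ℝ K) (hX : IsClosed X)
    (hY : IsClosed Y) (hXY : X ∪ Y = K) {i : Fin n} {c : ℝ} (hi : X ∩ Y ⊆ {y | y i = c})
    (hXc : ¬ X ⊆ {y | y i = c}) (hYc : ¬ Y ⊆ {y | y i = c}) :
    (X ⊆ {y | y i ≤ c} ∧ Y ⊆ {y | c ≤ y i}) ∨ (X ⊆ {y | c ≤ y i} ∧ Y ⊆ {y | y i ≤ c}) := by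
  obtain ⟨x, hx, hxc⟩ := not_subset.1 hXc
  obtain ⟨y, hy, hyc⟩ := not_subset.1 hYc
  have key : ∀ H : Set ℝ, Convex ℝ H → c ∉ H →
      (∀ z ∈ X, z i ∉ H) ∨ (∀ z ∈ Y, z i ∉ H) := by
    intro H hH hc
    by_contra! hcon
    obtain ⟨⟨z, hz, hzH⟩, w, hw, hwH⟩ := hcon
    have h1 : IsPreconnected (K ∩ stdCoord i ⁻¹' H) :=
      (hK.inter (hH.linear_preimage (stdCoord i).toLinearMap)).isPreconnected
    obtain ⟨v, ⟨-, hvH⟩, hv⟩ := isPreconnected_closed_iff.1 h1 X Y hX hY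
      (by rw [hXY]; exact inter_subset_left) ⟨z, ⟨hXY ▸ Or.inl hz, hzH⟩, hz⟩
      ⟨w, ⟨hXY ▸ Or.inr hw, hwH⟩, hw⟩
    have : v i = c := hi hv
    exact hc (this ▸ hvH)
  rcases key (Iio c) (convex_Iio c) (by simp) with h1 | h1 <;>
    rcases key (Ioi c) (convex_Ioi c) (by simp) with h2 | h2
  · exact absurd (le_antisymm (not_lt.1 (h2 x hx)) (not_lt.1 (h1 x hx))) hxc
  · exact Or.inr ⟨fun z hz => (not_lt.1 (h1 z hz) : c ≤ z i), fun z hz => (not_lt.1 (h2 z hz) : z i ≤ c)⟩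
  · exact Or.inl ⟨fun z hz => (not_lt.1 (h2 z hz) : z i ≤ c), fun z hz => (not_lt.1 (h1 z hz) : c ≤ z i)⟩
  · exact absurd (le_antisymm (not_lt.1 (h2 y hy)) (not_lt.1 (h1 y hy))) hyc

theorem setIntegral_eq_zero_of_subset_hyperplane {g : Euc n → ℝ} {A : Set (Euc n)} {i : Fin n}
    {c : ℝ} (h : A ⊆ {y | y i = c}) : ∫ y in A, g y = 0 :=
  setIntegral_measure_zero _ (measure_mono_null h (volume_hyperplane i c))

theorem setIntegral_eq_of_diff_subset_hyperplanes {g : Euc n → ℝ} {A Q : Set (Euc n)} {i j : Fin n}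
    {c d : ℝ} (hAQ : A ⊆ Q) (h : ∀ y ∈ Q, y ∉ A → y i = c ∨ y j = d) :
    ∫ y in A, g y = ∫ y in Q, g y := by
  refine setIntegral_congr_set ?_
  refine (hAQ.eventuallyLE).antisymm (ae_le_set.2 ?_)
  refine measure_mono_null (t := {y | y i = c} ∪ {y | y j = d}) (fun y hy => h y hy.1 hy.2) ?_
  exact measure_union_null (volume_hyperplane i c) (volume_hyperplane j d)

theorem mem_coordBox_update_right {a b : Fin n → ℝ} {i : Fin n} {c : ℝ} (hab : ∀ k, a k ≤ b k)
    (hc : c ∈ Icc (a i) (b i)) (y : Euc n) :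
    y ∈ coordBox a (Function.update b i c) ↔ y ∈ coordBox a b ∧ y i ≤ c := by
  constructor
  · intro hy
    refine ⟨coordBox_update_right (by rwa [uIcc_of_le (hab i)]) hy, ?_⟩
    have := hy i
    rw [Function.update_self, uIcc_of_le hc.1] at this
    exact this.2
  · rintro ⟨hy, hyc⟩ k
    by_cases hk : k = i
    · subst hk
      have := hy k
      rw [uIcc_of_le (hab k)] at this
      rw [Function.update_self, uIcc_of_le hc.1]
      exact ⟨this.1, hyc⟩
    · rw [Function.update_of_ne hk]; exact hy k

theorem mem_coordBox_update_left {a b : Fin n → ℝ} {i : Fin n} {c : ℝ} (hab : ∀ k, a k ≤ b k)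
    (hc : c ∈ Icc (a i) (b i)) (y : Euc n) :
    y ∈ coordBox (Function.update a i c) b ↔ y ∈ coordBox a b ∧ c ≤ y i := by
  constructor
  · intro hy
    refine ⟨coordBox_update_left (by rwa [uIcc_of_le (hab i)]) hy, ?_⟩
    have := hy i
    rw [Function.update_self, uIcc_of_le hc.2] at this
    exact this.1
  · rintro ⟨hy, hyc⟩ k
    by_cases hk : k = i
    · subst hk
      have := hy k
      rw [uIcc_of_le (hab k)] at this
      rw [Function.update_self, uIcc_of_le hc.2]
      exact ⟨hyc, this.2⟩
    · rw [Function.update_of_ne hk]; exact hy k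

theorem le_update_right {a b : Fin n → ℝ} {i : Fin n} {c : ℝ} (hab : ∀ k, a k ≤ b k)
    (hc : a i ≤ c) (k : Fin n) : a k ≤ Function.update b i c k := by
  by_cases hk : k = i
  · subst hk; rwa [Function.update_self]
  · rw [Function.update_of_ne hk]; exact hab k

theorem update_left_le {a b : Fin n → ℝ} {i : Fin n} {c : ℝ} (hab : ∀ k, a k ≤ b k)
    (hc : c ≤ b i) (k : Fin n) : Function.update a i c k ≤ b k := by
  by_cases hk : k = i
  · subst hk; rwa [Function.update_self]
  · rw [Function.update_of_ne hk]; exact hab k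

/-- Four sets which cover a box and lie in the four quadrants cut out by two hyperplanes are, up to
null sets, the corresponding four corner boxes. -/
theorem setIntegral_eq_cellVol_of_quadrants {g : Euc n → ℝ} {a b : Fin n → ℝ}
    (hab : ∀ k, a k ≤ b k) {i j : Fin n} (hij : i ≠ j) {c d : ℝ} (hc : c ∈ Icc (a i) (b i))
    (hd : d ∈ Icc (a j) (b j)) {A B C D : Set (Euc n)} (hU : A ∪ B ∪ (C ∪ D) = coordBox a b)
    (hA : ∀ y ∈ A, y i ≤ c ∧ y j ≤ d) (hB : ∀ y ∈ B, y i ≤ c ∧ d ≤ y j)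
    (hC : ∀ y ∈ C, c ≤ y i ∧ d ≤ y j) (hD : ∀ y ∈ D, c ≤ y i ∧ y j ≤ d) :
    ∫ y in A, g y = cellVol g a (Function.update (Function.update b i c) j d) ∧
    ∫ y in B, g y = cellVol g (Function.update a j d) (Function.update b i c) ∧
    ∫ y in C, g y = cellVol g (Function.update (Function.update a i c) j d) b ∧
    ∫ y in D, g y = cellVol g (Function.update a i c) (Function.update b j d) := by
  have hmem : ∀ y, y ∈ coordBox a b ↔ (y ∈ A ∨ y ∈ B) ∨ (y ∈ C ∨ y ∈ D) := by
    intro y; rw [← hU]; rfl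
  have e1 : ∀ y, y ∈ coordBox a (Function.update (Function.update b i c) j d) ↔
      (y ∈ coordBox a b ∧ y i ≤ c) ∧ y j ≤ d := fun y => by
    rw [mem_coordBox_update_right (le_update_right hab hc.1) (by rwa [Function.update_of_ne hij.symm]),
      mem_coordBox_update_right hab hc]
  have e2 : ∀ y, y ∈ coordBox (Function.update (Function.update a i c) j d) b ↔
      (y ∈ coordBox a b ∧ c ≤ y i) ∧ d ≤ y j := fun y => by
    rw [mem_coordBox_update_left (update_left_le hab hc.2) (by rwa [Function.update_of_ne hij.symm]),
      mem_coordBox_update_left hab hc]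
  have e3 : ∀ y, y ∈ coordBox (Function.update a j d) (Function.update b i c) ↔
      (y ∈ coordBox a b ∧ y i ≤ c) ∧ d ≤ y j := fun y => by
    rw [mem_coordBox_update_left (le_update_right hab hc.1) (by rwa [Function.update_of_ne hij.symm]),
      mem_coordBox_update_right hab hc]
  have e4 : ∀ y, y ∈ coordBox (Function.update a i c) (Function.update b j d) ↔
      (y ∈ coordBox a b ∧ c ≤ y i) ∧ y j ≤ d := fun y => by
    rw [mem_coordBox_update_right (update_left_le hab hc.2) (by rwa [Function.update_of_ne hij.symm]),
      mem_coordBox_update_left hab hc]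
  unfold cellVol
  refine ⟨setIntegral_eq_of_diff_subset_hyperplanes (i := i) (j := j) (c := c) (d := d) ?_ ?_,
    setIntegral_eq_of_diff_subset_hyperplanes (i := i) (j := j) (c := c) (d := d) ?_ ?_,
    setIntegral_eq_of_diff_subset_hyperplanes (i := i) (j := j) (c := c) (d := d) ?_ ?_,
    setIntegral_eq_of_diff_subset_hyperplanes (i := i) (j := j) (c := c) (d := d) ?_ ?_⟩
  · exact fun y hy => (e1 y).2 ⟨⟨(hmem y).2 (by tauto), (hA y hy).1⟩, (hA y hy).2⟩
  · intro y hy hyA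
    obtain ⟨⟨h1, h2⟩, h3⟩ := (e1 y).1 hy
    rcases (hmem y).1 h1 with (h | h) | (h | h)
    · exact absurd h hyA
    · exact Or.inr (le_antisymm h3 (hB y h).2)
    · exact Or.inl (le_antisymm h2 (hC y h).1)
    · exact Or.inl (le_antisymm h2 (hD y h).1)
  · exact fun y hy => (e3 y).2 ⟨⟨(hmem y).2 (by tauto), (hB y hy).1⟩, (hB y hy).2⟩
  · intro y hy hyA
    obtain ⟨⟨h1, h2⟩, h3⟩ := (e3 y).1 hy
    rcases (hmem y).1 h1 with (h | h) | (h | h)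
    · exact Or.inr (le_antisymm (hA y h).2 h3)
    · exact absurd h hyA
    · exact Or.inl (le_antisymm h2 (hC y h).1)
    · exact Or.inl (le_antisymm h2 (hD y h).1)
  · exact fun y hy => (e2 y).2 ⟨⟨(hmem y).2 (by tauto), (hC y hy).1⟩, (hC y hy).2⟩
  · intro y hy hyA
    obtain ⟨⟨h1, h2⟩, h3⟩ := (e2 y).1 hy
    rcases (hmem y).1 h1 with (h | h) | (h | h)
    · exact Or.inl (le_antisymm (hA y h).1 h2)
    · exact Or.inl (le_antisymm (hB y h).1 h2)
    · exact absurd h hyA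
    · exact Or.inr (le_antisymm (hD y h).2 h3)
  · exact fun y hy => (e4 y).2 ⟨⟨(hmem y).2 (by tauto), (hD y hy).1⟩, (hD y hy).2⟩
  · intro y hy hyA
    obtain ⟨⟨h1, h2⟩, h3⟩ := (e4 y).1 hy
    rcases (hmem y).1 h1 with (h | h) | (h | h)
    · exact Or.inl (le_antisymm (hA y h).1 h2)
    · exact Or.inl (le_antisymm (hB y h).1 h2)
    · exact Or.inr (le_antisymm h3 (hC y h).2)
    · exact absurd h hyA

/-- The relation `ac = bd` for four sets which subdivide a box up to null sets. -/
theorem IsProductDensity.mul_eq_mul {g : Euc n → ℝ} {l u : Fin n → ℝ} {κ : ℝ}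
    {γ : Fin n → ℝ → ℝ} (h : IsProductDensity g l u κ γ) {a b : Fin n → ℝ}
    (ha : ∀ k, a k ∈ Ioo (l k) (u k)) (hb : ∀ k, b k ∈ Ioo (l k) (u k)) (hab : ∀ k, a k ≤ b k)
    {i j : Fin n} (hij : i ≠ j) {c d : ℝ} (hc : c ∈ Icc (a i) (b i)) (hd : d ∈ Icc (a j) (b j))
    {A B C D : Set (Euc n)} (hU : A ∪ B ∪ (C ∪ D) = coordBox a b)
    (hA : ∀ y ∈ A, y i ≤ c ∧ y j ≤ d) (hB : ∀ y ∈ B, y i ≤ c ∧ d ≤ y j)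
    (hC : ∀ y ∈ C, c ≤ y i ∧ d ≤ y j) (hD : ∀ y ∈ D, c ≤ y i ∧ y j ≤ d) :
    (∫ y in A, g y) * (∫ y in C, g y) = (∫ y in B, g y) * ∫ y in D, g y := by
  obtain ⟨h1, h2, h3, h4⟩ :=
    setIntegral_eq_cellVol_of_quadrants (g := g) hab hij hc hd hU hA hB hC hD
  rw [h1, h2, h3, h4]
  exact h.corner_mul_corner ha hb hij ⟨(ha i).1.trans_le hc.1, hc.2.trans_lt (hb i).2⟩
    ⟨(ha j).1.trans_le hd.1, hd.2.trans_lt (hb j).2⟩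

end

section

open MeasureTheory

variable {n : ℕ} {M : Type*} [TopologicalSpace M] [ChartedSpace (Euc n) M]
variable {e : OpenPartialHomeomorph M (Euc n)}

theorem Web.IsRegion.exists_image_eq {W : Web n M} {A : Set M} (hA : W.IsRegion A)
    (he : W.IsAdaptedChart e) (h : A ⊆ e.source) :
    ∃ a ∈ e.target, ∃ b ∈ e.target, e '' A = coordBox a b := by
  obtain ⟨p, hp, q, hq, rfl⟩ := hA.exists_eq_chartBox he h
  exact ⟨e p, e.map_source hp, e q, e.map_source hq, he.image_chartBox hp hq⟩

theorem DivergenceFreeWeb.vol_region {W : DivergenceFreeWeb n M} {A : Set M} (hA : W.IsRegion A)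
    (he : W.IsAdaptedChart e) (h : A ⊆ e.source) :
    W.vol A = ∫ y in e '' A, |W.density e y| := by
  obtain ⟨p, hp, q, hq, rfl⟩ := hA.exists_eq_chartBox he h
  rw [W.vol_chartBox he hp hq, he.image_chartBox hp hq]
  rfl

/-- A subset of a leaf meets the intersection of two regions of an adapted chart in one plaque. -/
theorem Web.exists_level_of_inter_subset_leaf [IsManifold (𝓡 n) ∞ M] [SecondCountableTopology M]
    {W : Web n M} {A B : Set M} (hA : W.IsRegion A) (hB : W.IsRegion B) (he : W.IsAdaptedChart e)
    (hAe : A ⊆ e.source) (hBe : B ⊆ e.source) {i : Fin n} {p : M}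
    (hp : A ∩ B ⊆ (W.fol i).leaf p) : ∃ c, e '' A ∩ e '' B ⊆ {y | y i = c} := by
  obtain ⟨a, ha, b, hb, hab⟩ := hA.exists_image_eq he hAe
  obtain ⟨a', ha', b', hb', hab'⟩ := hB.exists_image_eq he hBe
  have hinter : e '' A ∩ e '' B = e '' (A ∩ B) :=
    (e.injOn.image_inter hAe hBe).symm
  rcases (A ∩ B).eq_empty_or_nonempty with h0 | ⟨x, hx⟩
  · refine ⟨0, ?_⟩
    rw [hinter, h0, image_empty]
    exact empty_subset _
  refine ⟨e x i, ?_⟩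
  have hconn : IsPreconnected (A ∩ B) := by
    have h1 : A ∩ B = e.symm '' (coordBox a b ∩ coordBox a' b') := by
      rw [← hab, ← hab', hinter]
      exact (e.symm_image_image_of_subset_source (inter_subset_left.trans hAe)).symm
    rw [h1]
    refine ((convex_coordBox a b).inter (convex_coordBox a' b')).isPreconnected.image _ ?_
    exact e.continuousOn_symm.mono (inter_subset_left.trans (he.coordBox_subset_target ha hb))
  rw [hinter]
  rintro _ ⟨z, hz, rfl⟩
  exact he.eq_of_subset_leaf hconn (inter_subset_left.trans hAe) hp hz hx

theorem Web.Subdivides.exists_level [IsManifold (𝓡 n) ∞ M] [SecondCountableTopology M]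
    {W : Web n M} {i : Fin n} {F K A B : Set M} (h : W.Subdivides i F K A B)
    (he : W.IsAdaptedChart e) (hK : K ⊆ e.source) :
    (e '' A ∪ e '' B = e '' K) ∧ IsClosed (e '' A) ∧ IsClosed (e '' B) ∧
      ∃ c, e '' A ∩ e '' B ⊆ {y | y i = c} := by
  obtain ⟨⟨-, p, hp⟩, -, hA, hB, hU, hi⟩ := h
  have hAe : A ⊆ e.source := (subset_union_left.trans hU.subset).trans hK
  have hBe : B ⊆ e.source := (subset_union_right.trans hU.subset).trans hK
  obtain ⟨a, ha, b, hb, hab⟩ := hA.exists_image_eq he hAe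
  obtain ⟨a', ha', b', hb', hab'⟩ := hB.exists_image_eq he hBe
  refine ⟨by rw [← image_union, hU], ?_, ?_,
    W.exists_level_of_inter_subset_leaf hA hB he hAe hBe (hi.trans hp)⟩
  · rw [hab]; exact isClosed_coordBox _ _
  · rw [hab']; exact isClosed_coordBox _ _

theorem coordBox_min_max {n : ℕ} (a b : Fin n → ℝ) :
    coordBox (fun k => min (a k) (b k)) (fun k => max (a k) (b k)) = coordBox a b := by
  ext y
  refine forall_congr' fun k => ?_
  rw [uIcc_of_le min_le_max]
  exact Iff.rfl

/-- If the web has product densities, the volumes of four subregions satisfy `ac = bd`. When one of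
the two cuts is degenerate, both products vanish; otherwise the subregions are the corner boxes, up
to null sets and up to exchanging the sides of the two cuts. -/
theorem DivergenceFreeWeb.MixedPartialsVanish.mul_eq_mul [IsManifold (𝓡 n) ∞ M]
    [SecondCountableTopology M] {W : DivergenceFreeWeb n M} (hP : W.MixedPartialsVanish)
    {i j : Fin n} {F G K A B C D : Set M} (hij : i ≠ j)
    (h : W.SubdividesIntoFour i j F G K A B C D) :
    W.vol A * W.vol C = W.vol B * W.vol D := by
  obtain ⟨hA, hB, hC, hD, hF, hG⟩ := h
  obtain ⟨e, he, p, hp, q, hq, hK⟩ := hF.2.1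
  have hKe : K ⊆ e.source := by rw [hK]; exact fun x hx => hx.1
  have hUK : A ∪ B ∪ (C ∪ D) = K := hF.2.2.2.2.1
  have hAe : A ⊆ e.source := fun x hx => hKe (hUK ▸ Or.inl (Or.inl hx))
  have hBe : B ⊆ e.source := fun x hx => hKe (hUK ▸ Or.inl (Or.inr hx))
  have hCe : C ⊆ e.source := fun x hx => hKe (hUK ▸ Or.inr (Or.inl hx))
  have hDe : D ⊆ e.source := fun x hx => hKe (hUK ▸ Or.inr (Or.inr hx))
  rw [vol_region hA he hAe, vol_region hB he hBe, vol_region hC he hCe, vol_region hD he hDe]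
  obtain ⟨hU, hXc, hYc, c, hc⟩ := hF.exists_level he hKe
  obtain ⟨hU', hXc', hYc', d, hd⟩ := hG.exists_level he hKe
  rw [image_union, image_union] at hU hU' hc hd
  rw [image_union] at hXc hYc hXc' hYc'
  generalize e '' A = A at *
  generalize e '' B = B at *
  generalize e '' C = C at *
  generalize e '' D = D at *
  -- a pair of regions inside a hyperplane has volume zero
  by_cases z1 : A ∪ B ⊆ {y | y i = c}
  · rw [setIntegral_eq_zero_of_subset_hyperplane (subset_union_left.trans z1),
      setIntegral_eq_zero_of_subset_hyperplane (subset_union_right.trans z1), zero_mul, zero_mul]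
  by_cases z2 : C ∪ D ⊆ {y | y i = c}
  · rw [setIntegral_eq_zero_of_subset_hyperplane (subset_union_left.trans z2),
      setIntegral_eq_zero_of_subset_hyperplane (subset_union_right.trans z2), mul_zero, mul_zero]
  by_cases z3 : A ∪ D ⊆ {y | y j = d}
  · rw [setIntegral_eq_zero_of_subset_hyperplane (subset_union_left.trans z3),
      setIntegral_eq_zero_of_subset_hyperplane (subset_union_right.trans z3), zero_mul, mul_zero]
  by_cases z4 : B ∪ C ⊆ {y | y j = d}
  · rw [setIntegral_eq_zero_of_subset_hyperplane (subset_union_left.trans z4),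
      setIntegral_eq_zero_of_subset_hyperplane (subset_union_right.trans z4), mul_zero, zero_mul]
  obtain ⟨l, u, hlu⟩ := he.2.1
  obtain ⟨κ, γ, hprod⟩ := hP.exists_isProductDensity he hlu (e.map_source hp)
  have hep := e.map_source hp
  have heq := e.map_source hq
  rw [hlu] at hep heq
  have hKimg : e '' K = coordBox (fun k => min (e p k) (e q k)) (fun k => max (e p k) (e q k)) := by
    rw [coordBox_min_max, hK, he.image_chartBox hp hq]
  rw [hKimg] at hU hU'
  set a := fun k => min (e p k) (e q k) with ha
  set b := fun k => max (e p k) (e q k) with hb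
  have hab : ∀ k, a k ≤ b k := fun k => min_le_max
  have haI : ∀ k, a k ∈ Ioo (l k) (u k) := fun k =>
    ⟨lt_min (hep k).1 (heq k).1, (min_le_left _ _).trans_lt (hep k).2⟩
  have hbI : ∀ k, b k ∈ Ioo (l k) (u k) := fun k =>
    ⟨(hep k).1.trans_le (le_max_left _ _), max_lt (hep k).2 (heq k).2⟩
  have hmemK : ∀ y, y ∈ A ∪ B ∪ (C ∪ D) → ∀ k, y k ∈ Icc (a k) (b k) := by
    intro y hy k
    rw [hU] at hy
    have := hy k
    rwa [uIcc_of_le (hab k)] at this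
  have hconv : Convex ℝ (coordBox a b) := convex_coordBox a b
  have s1 := split_of_inter_subset_hyperplane hconv hXc hYc hU hc z1 z2
  have s2 := split_of_inter_subset_hyperplane hconv hXc' hYc' hU' hd z3 z4
  have hcI : c ∈ Icc (a i) (b i) := by
    obtain ⟨x, hx, -⟩ := not_subset.1 z1
    obtain ⟨y, hy, -⟩ := not_subset.1 z2
    have hx' := hmemK x (Or.inl hx) i
    have hy' := hmemK y (Or.inr hy) i
    rcases s1 with ⟨h1, h2⟩ | ⟨h1, h2⟩
    · exact ⟨hx'.1.trans (h1 hx), (h2 hy : c ≤ y i).trans hy'.2⟩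
    · exact ⟨hy'.1.trans (h2 hy), (h1 hx : c ≤ x i).trans hx'.2⟩
  have hdI : d ∈ Icc (a j) (b j) := by
    obtain ⟨x, hx, -⟩ := not_subset.1 z3
    obtain ⟨y, hy, -⟩ := not_subset.1 z4
    have hx' := hmemK x (by rw [hU, ← hU']; exact Or.inl hx) j
    have hy' := hmemK y (by rw [hU, ← hU']; exact Or.inr hy) j
    rcases s2 with ⟨h1, h2⟩ | ⟨h1, h2⟩
    · exact ⟨hx'.1.trans (h1 hx), (h2 hy : d ≤ y j).trans hy'.2⟩
    · exact ⟨hy'.1.trans (h2 hy), (h1 hx : d ≤ x j).trans hx'.2⟩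
  have key := fun {A B C D : Set (Euc n)} => hprod.mul_eq_mul haI hbI hab hij hcI hdI
    (A := A) (B := B) (C := C) (D := D)
  rcases s1 with ⟨h1, h2⟩ | ⟨h1, h2⟩ <;> rcases s2 with ⟨h3, h4⟩ | ⟨h3, h4⟩
  · exact key hU (fun y hy => ⟨h1 (Or.inl hy), h3 (Or.inl hy)⟩)
      (fun y hy => ⟨h1 (Or.inr hy), h4 (Or.inl hy)⟩) (fun y hy => ⟨h2 (Or.inl hy), h4 (Or.inr hy)⟩)
      (fun y hy => ⟨h2 (Or.inr hy), h3 (Or.inr hy)⟩)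
  · exact (key (by rw [union_comm B, union_comm D]; exact hU)
      (fun y hy => ⟨h1 (Or.inr hy), h4 (Or.inl hy)⟩)
      (fun y hy => ⟨h1 (Or.inl hy), h3 (Or.inl hy)⟩) (fun y hy => ⟨h2 (Or.inr hy), h3 (Or.inr hy)⟩)
      (fun y hy => ⟨h2 (Or.inl hy), h4 (Or.inr hy)⟩)).symm
  · have := (key (by rw [union_comm B, union_comm D, union_comm]; exact hU)
      (fun y hy => ⟨h2 (Or.inr hy), h3 (Or.inr hy)⟩)
      (fun y hy => ⟨h2 (Or.inl hy), h4 (Or.inr hy)⟩) (fun y hy => ⟨h1 (Or.inr hy), h4 (Or.inl hy)⟩)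
      (fun y hy => ⟨h1 (Or.inl hy), h3 (Or.inl hy)⟩))
    linarith
  · have := key (by rw [union_comm]; exact hU)
      (fun y hy => ⟨h2 (Or.inl hy), h4 (Or.inr hy)⟩)
      (fun y hy => ⟨h2 (Or.inr hy), h3 (Or.inr hy)⟩) (fun y hy => ⟨h1 (Or.inl hy), h3 (Or.inl hy)⟩)
      (fun y hy => ⟨h1 (Or.inr hy), h4 (Or.inl hy)⟩)
    linarith

end

/-! ### Coordinate boxes as regions -/

section

variable {n : ℕ} {M : Type*} [TopologicalSpace M] {e : OpenPartialHomeomorph M (Euc n)}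

/-- The points of the chart `e` whose coordinates lie in the box spanned by `a` and `b`. -/
def boxRegion (e : OpenPartialHomeomorph M (Euc n)) (a b : Fin n → ℝ) : Set M :=
  e.source ∩ e ⁻¹' coordBox a b

theorem boxRegion_subset (a b : Fin n → ℝ) : boxRegion e a b ⊆ e.source := inter_subset_left

theorem boxRegion_union (a b a' b' : Fin n → ℝ) :
    boxRegion e a b ∪ boxRegion e a' b' = e.source ∩ e ⁻¹' (coordBox a b ∪ coordBox a' b') := by
  rw [preimage_union, inter_union_distrib_left]; rfl

theorem boxRegion_cut {a b : Fin n → ℝ} {i : Fin n} {c : ℝ} (hc : c ∈ uIcc (a i) (b i)) :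
    boxRegion e a (Function.update b i c) ∪ boxRegion e (Function.update a i c) b =
      boxRegion e a b := by
  rw [boxRegion_union, coordBox_union hc]; rfl

theorem boxRegion_inter {a b : Fin n → ℝ} {i : Fin n} {c : ℝ} (hc : c ∈ uIcc (a i) (b i)) :
    boxRegion e a (Function.update b i c) ∩ boxRegion e (Function.update a i c) b ⊆
      plaque e i c :=
  fun _ hx => ⟨hx.1.1, coordBox_inter hc ⟨hx.1.2, hx.2.2⟩⟩

variable {l u a b : Fin n → ℝ}

theorem boxRegion_eq_chartBox (hlu : e.target = {y | ∀ k, y k ∈ Ioo (l k) (u k)})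
    (ha : ∀ k, a k ∈ Ioo (l k) (u k)) (hb : ∀ k, b k ∈ Ioo (l k) (u k)) :
    ∃ p ∈ e.source, ∃ q ∈ e.source, (∀ k, e p k = a k) ∧ (∀ k, e q k = b k) ∧
      boxRegion e a b = chartBox e p q := by
  have ha' : (WithLp.toLp 2 a : Euc n) ∈ e.target := by rw [hlu]; exact ha
  have hb' : (WithLp.toLp 2 b : Euc n) ∈ e.target := by rw [hlu]; exact hb
  refine ⟨_, e.map_target ha', _, e.map_target hb', ?_, ?_, ?_⟩
  · rw [e.right_inv ha']; exact fun _ => rfl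
  · rw [e.right_inv hb']; exact fun _ => rfl
  · unfold chartBox
    rw [e.right_inv ha', e.right_inv hb']
    rfl

theorem image_boxRegion (hlu : e.target = {y | ∀ k, y k ∈ Ioo (l k) (u k)}) (ha : ∀ k, a k ∈ Ioo (l k) (u k))
    (hb : ∀ k, b k ∈ Ioo (l k) (u k)) : e '' boxRegion e a b = coordBox a b := by
  have : coordBox a b ⊆ e.target := by rw [hlu]; exact coordBox_subset_openBox ha hb
  refine Subset.antisymm ?_ fun y hy => ?_
  · rintro _ ⟨x, hx, rfl⟩
    exact hx.2
  · refine ⟨e.symm y, ⟨e.map_target (this hy), ?_⟩, e.right_inv (this hy)⟩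
    rw [mem_preimage, e.right_inv (this hy)]
    exact hy

variable [ChartedSpace (Euc n) M] {W : Web n M}

theorem Web.IsAdaptedChart.isRegion_boxRegion (he : W.IsAdaptedChart e)
    (hlu : e.target = {y | ∀ k, y k ∈ Ioo (l k) (u k)}) (ha : ∀ k, a k ∈ Ioo (l k) (u k))
    (hb : ∀ k, b k ∈ Ioo (l k) (u k)) : W.IsRegion (boxRegion e a b) := by
  obtain ⟨p, hp, q, hq, -, -, h⟩ := boxRegion_eq_chartBox hlu ha hb
  exact ⟨e, he, p, hp, q, hq, h⟩

theorem DivergenceFreeWeb.vol_boxRegion {W : DivergenceFreeWeb n M} (he : W.IsAdaptedChart e)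
    (hlu : e.target = {y | ∀ k, y k ∈ Ioo (l k) (u k)}) (ha : ∀ k, a k ∈ Ioo (l k) (u k))
    (hb : ∀ k, b k ∈ Ioo (l k) (u k)) :
    W.vol (boxRegion e a b) = cellVol (fun y => |W.density e y|) a b := by
  rw [vol_region (he.isRegion_boxRegion hlu ha hb) he (boxRegion_subset a b),
    image_boxRegion hlu ha hb]
  rfl

theorem Web.IsAdaptedChart.isOpenSubsetOfLeaf_plaque_of_mem [IsManifold (𝓡 n) ∞ M]
    (he : W.IsAdaptedChart e)
    (hlu : e.target = {y | ∀ k, y k ∈ Ioo (l k) (u k)}) (ha : ∀ k, a k ∈ Ioo (l k) (u k))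
    {i : Fin n} {c : ℝ} (hc : c ∈ Ioo (l i) (u i)) :
    (W.fol i).IsOpenSubsetOfLeaf (plaque e i c) := by
  have h : (WithLp.toLp 2 (Function.update a i c) : Euc n) ∈ e.target := by
    rw [hlu]; exact update_mem_box ha hc
  refine he.isOpenSubsetOfLeaf_plaque (p := e.symm (WithLp.toLp 2 (Function.update a i c)))
    ⟨e.map_target h, ?_⟩
  rw [e.right_inv h]
  exact Function.update_self i c a

/-- A coordinate hyperplane cuts a coordinate box into two regions. -/
theorem Web.IsAdaptedChart.subdivides_boxRegion [IsManifold (𝓡 n) ∞ M] (he : W.IsAdaptedChart e)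
    (hlu : e.target = {y | ∀ k, y k ∈ Ioo (l k) (u k)}) (ha : ∀ k, a k ∈ Ioo (l k) (u k))
    (hb : ∀ k, b k ∈ Ioo (l k) (u k)) {i : Fin n} {c : ℝ} (hc : c ∈ uIcc (a i) (b i)) :
    W.Subdivides i (plaque e i c) (boxRegion e a b) (boxRegion e a (Function.update b i c))
      (boxRegion e (Function.update a i c) b) := by
  have hc' : c ∈ Ioo (l i) (u i) := ordConnected_Ioo.uIcc_subset (ha i) (hb i) hc
  exact ⟨he.isOpenSubsetOfLeaf_plaque_of_mem hlu ha hc', he.isRegion_boxRegion hlu ha hb,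
    he.isRegion_boxRegion hlu ha (update_mem_box hb hc'),
    he.isRegion_boxRegion hlu (update_mem_box ha hc') hb, boxRegion_cut hc, boxRegion_inter hc⟩

/-- A region of a web with product densities is cut into parts of equal volume by the hyperplanes
through the medians of the factors of the density. -/
theorem DivergenceFreeWeb.MixedPartialsVanish.exists_subdividesIntoPow [IsManifold (𝓡 n) ∞ M]
    {W : DivergenceFreeWeb n M} (hP : W.MixedPartialsVanish) {K : Set M} (hK : W.IsRegion K)
    {k : ℕ} (hk : k ≤ n) :
    ∃ (F : Fin k → Set M) (R : (Fin k → Bool) → Set M),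
      W.SubdividesIntoPow hk F K R ∧ ∀ s t, W.vol (R s) = W.vol (R t) := by
  obtain ⟨e, he, p, hp, q, hq, rfl⟩ := hK
  obtain ⟨l, u, hlu⟩ := he.2.1
  obtain ⟨κ, γ, hprod⟩ := hP.exists_isProductDensity he hlu (e.map_source hp)
  have ha : ∀ m, (e p).ofLp m ∈ Ioo (l m) (u m) := by
    have := e.map_source hp
    rwa [hlu] at this
  have hb : ∀ m, (e q).ofLp m ∈ Ioo (l m) (u m) := by
    have := e.map_source hq
    rwa [hlu] at this
  rw [show chartBox e p q = boxRegion e (e p).ofLp (e q).ofLp from rfl]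
  generalize (e p).ofLp = a at *
  generalize (e q).ofLp = b at *
  have hIoo : ∀ m, uIcc (a m) (b m) ⊆ Ioo (l m) (u m) := fun m =>
    ordConnected_Ioo.uIcc_subset (ha m) (hb m)
  choose c hc hceq using fun m => exists_bisection ((hprod.continuousOn m).mono (hIoo m))
  -- opposite vertices of the cell with sign pattern `s`; only the first `k` coordinates are cut
  let lo : (Fin k → Bool) → Fin n → ℝ := fun s m =>
    if h : m.1 < k then (if s ⟨m.1, h⟩ then c m else a m) else a m
  let hi : (Fin k → Bool) → Fin n → ℝ := fun s m =>
    if h : m.1 < k then (if s ⟨m.1, h⟩ then b m else c m) else b m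
  have hlo : ∀ s m, lo s m ∈ Ioo (l m) (u m) := by
    intro s m
    dsimp only [lo]
    split_ifs
    exacts [hIoo m (hc m), ha m, ha m]
  have hhi : ∀ s m, hi s m ∈ Ioo (l m) (u m) := by
    intro s m
    dsimp only [hi]
    split_ifs
    exacts [hb m, hIoo m (hc m), hb m]
  have hmem : ∀ s (y : Euc n), y ∈ coordBox (lo s) (hi s) → y ∈ coordBox a b ∧
      ∀ m : Fin k, y (Fin.castLE hk m) ∈ if s m then uIcc (c (Fin.castLE hk m)) (b (Fin.castLE hk m))
        else uIcc (a (Fin.castLE hk m)) (c (Fin.castLE hk m)) := by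
    intro s y hy
    refine ⟨fun m => ?_, fun m => ?_⟩
    · have := hy m
      dsimp only [lo, hi] at this
      split_ifs at this
      · exact uIcc_subset_uIcc_right (hc m) this
      · exact uIcc_subset_uIcc_left (hc m) this
      · exact this
    · have := hy (Fin.castLE hk m)
      simp only [lo, hi, Fin.val_castLE, m.2, dite_true, Fin.eta] at this
      split_ifs at this ⊢ <;> exact this
  have hmem' : ∀ s (y : Euc n), y ∈ coordBox a b → (∀ m : Fin k, y (Fin.castLE hk m) ∈
      if s m then uIcc (c (Fin.castLE hk m)) (b (Fin.castLE hk m))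
        else uIcc (a (Fin.castLE hk m)) (c (Fin.castLE hk m))) → y ∈ coordBox (lo s) (hi s) := by
    intro s y hy hys m
    dsimp only [lo, hi]
    by_cases h : m.1 < k
    · have := hys ⟨m.1, h⟩
      simp only [h, dite_true]
      split_ifs at this ⊢ <;> exact this
    · simp only [h, dite_false]
      exact hy m
  -- a sign pattern for the cell containing a given point
  have hex : ∀ y : Euc n, y ∈ coordBox a b → ∃ s : Fin k → Bool, ∀ m : Fin k,
      (y (Fin.castLE hk m) ∈ if s m then uIcc (c (Fin.castLE hk m)) (b (Fin.castLE hk m))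
        else uIcc (a (Fin.castLE hk m)) (c (Fin.castLE hk m))) := by
    intro y hy
    have : ∀ m : Fin k, ∃ t : Bool,
        y (Fin.castLE hk m) ∈ if t then uIcc (c (Fin.castLE hk m)) (b (Fin.castLE hk m))
          else uIcc (a (Fin.castLE hk m)) (c (Fin.castLE hk m)) := by
      intro m
      rcases uIcc_subset_uIcc_union_uIcc (b := c (Fin.castLE hk m)) (hy (Fin.castLE hk m)) with h | h
      · exact ⟨false, by simpa using h⟩
      · exact ⟨true, by simpa using h⟩
    exact ⟨_, fun m => (this m).choose_spec⟩
  have hside : ∀ (l : Fin k) (β : Bool), (⋃ s ∈ {s : Fin k → Bool | s l = β},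
      boxRegion e (lo s) (hi s)) = {x | x ∈ boxRegion e a b ∧ e x (Fin.castLE hk l) ∈
        if β then uIcc (c (Fin.castLE hk l)) (b (Fin.castLE hk l))
        else uIcc (a (Fin.castLE hk l)) (c (Fin.castLE hk l))} := by
    intro l β
    refine Subset.antisymm (iUnion₂_subset fun s hs x hx => ?_) fun x hx => ?_
    · obtain ⟨h1, h2⟩ := hmem s _ hx.2
      have := h2 l
      rw [show s l = β from hs] at this
      exact ⟨⟨hx.1, h1⟩, this⟩
    · obtain ⟨s, hs⟩ := hex (e x) hx.1.2
      refine mem_iUnion₂.2 ⟨Function.update s l β, mem_ofPred.2 (Function.update_self l β s), hx.1.1, ?_⟩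
      refine hmem' _ _ hx.1.2 fun m => ?_
      by_cases hm : m = l
      · subst hm
        rw [Function.update_self]
        exact hx.2
      · rw [Function.update_of_ne hm]
        exact hs m
  refine ⟨fun m => plaque e (Fin.castLE hk m) (c (Fin.castLE hk m)),
    fun s => boxRegion e (lo s) (hi s), ⟨fun s => he.isRegion_boxRegion hlu (hlo s) (hhi s),
      Subset.antisymm (iUnion_subset fun s x hx => ⟨hx.1, (hmem s _ hx.2).1⟩) fun x hx => ?_,
      fun m => ?_⟩, fun s t => ?_⟩
  · obtain ⟨s, hs⟩ := hex (e x) hx.2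
    exact mem_iUnion.2 ⟨s, hx.1, hmem' s _ hx.2 hs⟩
  · convert! he.subdivides_boxRegion hlu ha hb (hc (Fin.castLE hk m)) using 1
    · rw [hside]
      ext x
      refine ⟨fun hx => ⟨hx.1.1, fun j => ?_⟩, fun hx =>
        ⟨⟨hx.1, coordBox_update_right (hc (Fin.castLE hk m)) hx.2⟩, ?_⟩⟩
      · by_cases hj : j = Fin.castLE hk m
        · subst hj
          rw [Function.update_self]
          exact hx.2
        · rw [Function.update_of_ne hj]
          exact hx.1.2 j
      · have := hx.2 (Fin.castLE hk m)
        rwa [Function.update_self] at this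
    · rw [hside]
      ext x
      refine ⟨fun hx => ⟨hx.1.1, fun j => ?_⟩, fun hx =>
        ⟨⟨hx.1, coordBox_update_left (hc (Fin.castLE hk m)) hx.2⟩, ?_⟩⟩
      · by_cases hj : j = Fin.castLE hk m
        · subst hj
          rw [Function.update_self]
          exact hx.2
        · rw [Function.update_of_ne hj]
          exact hx.1.2 j
      · have := hx.2 (Fin.castLE hk m)
        rwa [Function.update_self] at this
  · rw [DivergenceFreeWeb.vol_boxRegion he hlu (hlo s) (hhi s),
      DivergenceFreeWeb.vol_boxRegion he hlu (hlo t) (hhi t),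
      hprod.cellVol_eq (hlo s) (hhi s), hprod.cellVol_eq (hlo t) (hhi t)]
    congr 1
    refine Finset.prod_congr rfl fun m _ => ?_
    dsimp only [lo, hi]
    split_ifs
    exacts [rfl, (hceq m).symm, hceq m, rfl, rfl]

end

/-! ### Bisections of boxes -/

section

open MeasureTheory

variable {n : ℕ}

/-- Whenever hyperplanes `xᵢ = c` and `xⱼ = d` cut a box with the density `g` so that the first
halves the box and the second halves the part where `xᵢ ≤ c`, the second also halves the
part where `xᵢ ≥ c`. -/
def BisectionCompatible (g : Euc n → ℝ) (l u : Fin n → ℝ) : Prop :=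
  ∀ a b : Fin n → ℝ, (∀ k, a k ∈ Ioo (l k) (u k)) → (∀ k, b k ∈ Ioo (l k) (u k)) →
    (∀ k, a k < b k) → ∀ i j : Fin n, i ≠ j → ∀ c ∈ Ioo (a i) (b i), ∀ d ∈ Ioo (a j) (b j),
    cellVol g a (Function.update b i c) = cellVol g (Function.update a i c) b →
    cellVol g a (Function.update (Function.update b i c) j d) =
      cellVol g (Function.update a j d) (Function.update b i c) →
    cellVol g (Function.update a i c) (Function.update b j d) =
      cellVol g (Function.update (Function.update a i c) j d) b

/-- A hyperplane `xᵢ = c` which halves a box is unique. -/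
theorem eq_of_cellVol_eq {g : Euc n → ℝ} {a b : Fin n → ℝ} (hg : ContinuousOn g (coordBox a b))
    (h0 : ∀ y ∈ coordBox a b, 0 < g y) (hab : ∀ k, a k < b k) {i : Fin n} {c c' : ℝ}
    (hc : c ∈ Icc (a i) (b i)) (hc' : c' ∈ Icc (a i) (b i))
    (h : cellVol g a (Function.update b i c) = cellVol g (Function.update a i c) b)
    (h' : cellVol g a (Function.update b i c') = cellVol g (Function.update a i c') b) :
    c = c' := by
  wlog hlt : c ≤ c' generalizing c c'
  · exact (this hc' hc h' h (le_of_not_ge hlt)).symm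
  by_contra hne
  have hlt : c < c' := lt_of_le_of_ne hlt hne
  have hu : uIcc (a i) (b i) = Icc (a i) (b i) := uIcc_of_le (hab i).le
  have hc1 := hu ▸ hc
  have hc1' := hu ▸ hc'
  have e1 := cellVol_cut hg hc1
  have e2 := cellVol_cut hg hc1'
  have hs := coordBox_update_right (a := a) (b := b) hc1'
  have e3 := cellVol_cut (a := a) (b := Function.update b i c') (i := i) (c := c) (hg.mono hs) (by
    rw [Function.update_self, uIcc_of_le hc'.1]; exact ⟨hc.1, hlt.le⟩)
  rw [Function.update_idem] at e3
  have hs' : coordBox (Function.update a i c) (Function.update b i c') ⊆ coordBox a b := by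
    refine (coordBox_update_left (a := a) (b := Function.update b i c') (i := i) (c := c) ?_).trans hs
    rw [Function.update_self, uIcc_of_le hc'.1]; exact ⟨hc.1, hlt.le⟩
  have e4 : 0 < cellVol g (Function.update a i c) (Function.update b i c') := by
    refine cellVol_pos (hg.mono hs') (fun y hy => h0 y (hs' hy)) fun k => ?_
    by_cases hk : k = i
    · subst hk
      simpa using hlt.ne
    · simpa [hk] using (hab k).ne
  linarith

end

section

variable {n : ℕ} {M : Type*} [TopologicalSpace M] [ChartedSpace (Euc n) M]
variable {e : OpenPartialHomeomorph M (Euc n)} {W : DivergenceFreeWeb n M}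

namespace DivergenceFreeWeb

theorem continuousOn_abs_density (W : DivergenceFreeWeb n M) (he : W.IsAdaptedChart e) :
    ContinuousOn (fun y => |W.density e y|) e.target :=
  (W.contDiffOn_density he.1).continuousOn.abs

theorem abs_density_pos (W : DivergenceFreeWeb n M) (he : W.IsAdaptedChart e) {y : Euc n}
    (hy : y ∈ e.target) : 0 < |W.density e y| :=
  abs_pos.2 (W.density_ne_zero he.1 hy)

variable {l u : Fin n → ℝ}

theorem bisectionCompatible_of_four [IsManifold (𝓡 n) ∞ M]
    (h3 : ∀ (i j : Fin n) (F G K A B C D : Set M), i ≠ j → W.SubdividesIntoFour i j F G K A B C D →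
        W.vol A + W.vol B = W.vol C + W.vol D → W.vol A = W.vol B →
        W.vol A = W.vol B ∧ W.vol B = W.vol C ∧ W.vol C = W.vol D)
    (he : W.IsAdaptedChart e) (hlu : e.target = {y | ∀ k, y k ∈ Ioo (l k) (u k)}) :
    BisectionCompatible (fun y => |W.density e y|) l u := by
  intro a b ha hb hab i j hij c hc d hd hcc hdd
  have hcu : c ∈ uIcc (a i) (b i) := by rw [uIcc_of_le (hab i).le]; exact Ioo_subset_Icc_self hc
  have hdu : d ∈ uIcc (a j) (b j) := by rw [uIcc_of_le (hab j).le]; exact Ioo_subset_Icc_self hd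
  have hcI : c ∈ Ioo (l i) (u i) := ordConnected_Ioo.uIcc_subset (ha i) (hb i) hcu
  have hdI : d ∈ Ioo (l j) (u j) := ordConnected_Ioo.uIcc_subset (ha j) (hb j) hdu
  have hbc := update_mem_box hb hcI
  have hac := update_mem_box ha hcI
  have hbd := update_mem_box hb hdI
  have had := update_mem_box ha hdI
  have hbcd := update_mem_box hbc hdI
  have hacd := update_mem_box hac hdI
  have hd1 : d ∈ uIcc (a j) (Function.update b i c j) := by rwa [Function.update_of_ne hij.symm]
  have hd2 : d ∈ uIcc (Function.update a i c j) (b j) := by rwa [Function.update_of_ne hij.symm]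
  have hc1 : c ∈ uIcc (a i) (Function.update b j d i) := by rwa [Function.update_of_ne hij]
  have hc2 : c ∈ uIcc (Function.update a j d i) (b i) := by rwa [Function.update_of_ne hij]
  have e1 := boxRegion_cut (e := e) hd1
  have e2 := boxRegion_cut (e := e) hd2
  have e3 := boxRegion_cut (e := e) hc1
  have e4 := boxRegion_cut (e := e) hc2
  rw [Function.update_comm hij.symm] at e3 e4
  have key := h3 i j (plaque e i c) (plaque e j d) (boxRegion e a b)
    (boxRegion e a (Function.update (Function.update b i c) j d))
    (boxRegion e (Function.update a j d) (Function.update b i c))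
    (boxRegion e (Function.update (Function.update a i c) j d) b)
    (boxRegion e (Function.update a i c) (Function.update b j d)) hij
    ⟨he.isRegion_boxRegion hlu ha hbcd, he.isRegion_boxRegion hlu had hbc,
      he.isRegion_boxRegion hlu hacd hb, he.isRegion_boxRegion hlu hac hbd, by
      rw [e1, union_comm, e2]
      exact he.subdivides_boxRegion hlu ha hb hcu, by
      rw [e3, e4]
      exact he.subdivides_boxRegion hlu ha hb hdu⟩
  rw [vol_boxRegion he hlu ha hbcd, vol_boxRegion he hlu had hbc, vol_boxRegion he hlu hacd hb,
    vol_boxRegion he hlu hac hbd] at key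
  have hbox : ∀ {a b : Fin n → ℝ}, (∀ k, a k ∈ Ioo (l k) (u k)) → (∀ k, b k ∈ Ioo (l k) (u k)) →
      ContinuousOn (fun y => |W.density e y|) (coordBox a b) := fun ha hb =>
    (W.continuousOn_abs_density he).mono (by rw [hlu]; exact coordBox_subset_openBox ha hb)
  have t1 := cellVol_cut (hbox ha hbc) hd1
  have t2 := cellVol_cut (hbox hac hb) hd2
  exact (key (by linarith) hdd).2.2.symm

end DivergenceFreeWeb

end

section

open MeasureTheory

variable {n : ℕ} {M : Type*} [TopologicalSpace M] [ChartedSpace (Euc n) M]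
variable {e : OpenPartialHomeomorph M (Euc n)} {W : DivergenceFreeWeb n M}

/-- The sign patterns with prescribed signs at two places are equinumerous for all choices of
the two signs. -/
theorem card_sign_pattern {i j : Fin n} (hij : i ≠ j) (α β α' β' : Bool) :
    Nat.card {s : Fin n → Bool // s i = α ∧ s j = β} =
      Nat.card {s : Fin n → Bool // s i = α' ∧ s j = β'} := by
  have main : ∀ α β α' β' : Bool, ∀ s : {s : Fin n → Bool // s i = α ∧ s j = β},
      (Function.update (Function.update s.1 i α') j β') i = α' ∧
        (Function.update (Function.update s.1 i α') j β') j = β' := by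
    intro α β α' β' s
    simp [hij]
  refine Nat.card_congr ⟨fun s => ⟨_, main α β α' β' s⟩, fun s => ⟨_, main α' β' α β s⟩, ?_, ?_⟩
  · rintro ⟨s, rfl, rfl⟩
    ext k
    by_cases hk : k = i
    · subst hk; simp [hij]
    · by_cases hk' : k = j
      · subst hk'; simp
      · simp [hk, hk']
  · rintro ⟨s, rfl, rfl⟩
    ext k
    by_cases hk : k = i
    · subst hk; simp [hij]
    · by_cases hk' : k = j
      · subst hk'; simp
      · simp [hk, hk']

variable {l u : Fin n → ℝ}

/-- The subdivision of a box into `2 ^ n` cells of equal volume yields, for two directions `i` and `j`,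
four unions of `2 ^ (n - 2)` cells which are the corner boxes of two hyperplanes up to null sets. As
the hyperplanes which halve a box are unique, they are those given in `BisectionCompatible`. -/
theorem DivergenceFreeWeb.bisectionCompatible_of_pow [IsManifold (𝓡 n) ∞ M]
    [SecondCountableTopology M]
    (h4 : ∀ K : Set M, W.IsRegion K → ∃ (F : Fin n → Set M) (R : (Fin n → Bool) → Set M),
          W.SubdividesIntoPow le_rfl F K R ∧ ∀ s t, W.vol (R s) = W.vol (R t))
    (he : W.IsAdaptedChart e) (hlu : e.target = {y | ∀ k, y k ∈ Ioo (l k) (u k)}) :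
    BisectionCompatible (fun y => |W.density e y|) l u := by
  intro a b ha hb hab i j hij c hc d hd hcc hdd
  set g : Euc n → ℝ := fun y => |W.density e y| with hgdef
  have hab' : ∀ k, a k ≤ b k := fun k => (hab k).le
  have hbt : coordBox a b ⊆ e.target := by rw [hlu]; exact coordBox_subset_openBox ha hb
  have hg : ContinuousOn g (coordBox a b) := (W.continuousOn_abs_density he).mono hbt
  have hg0 : ∀ y ∈ coordBox a b, 0 < g y := fun y hy => W.abs_density_pos he (hbt hy)
  obtain ⟨F, R, ⟨hR, hRU, hsub⟩, hvol⟩ := h4 _ (he.isRegion_boxRegion hlu ha hb)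
  have hRK : ∀ s, R s ⊆ boxRegion e a b := fun s => hRU ▸ subset_iUnion R s
  have hRe : ∀ s, R s ⊆ e.source := fun s => (hRK s).trans (boxRegion_subset a b)
  have hKimg := image_boxRegion hlu ha hb
  have hSK : ∀ s, e '' R s ⊆ coordBox a b := fun s => hKimg ▸ image_mono (hRK s)
  have hSm : ∀ s, NullMeasurableSet (e '' R s) volume := by
    intro s
    obtain ⟨a', -, b', -, h⟩ := (hR s).exists_image_eq he (hRe s)
    rw [h]
    exact (measurableSet_coordBox _ _).nullMeasurableSet
  have hlev := fun m : Fin n => (hsub m).exists_level he (boxRegion_subset a b)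
  simp only [image_iUnion₂] at hlev
  rw [hKimg] at hlev
  choose hU hX hY z hz using hlev
  have hmemT : ∀ {β : Bool} {m : Fin n} {s : Fin n → Bool}, s m = β →
      e '' R s ⊆ ⋃ s ∈ {s : Fin n → Bool | s m = β}, e '' R s := fun {β m s} h =>
    subset_iUnion₂ (s := fun s (_ : s ∈ {s : Fin n → Bool | s m = β}) => e '' R s) s h
  have hdisj : ∀ s t, s ≠ t → volume (e '' R s ∩ e '' R t) = 0 := by
    have hdisj' : ∀ s t (m : Fin n), s m = false → t m = true →
        volume (e '' R s ∩ e '' R t) = 0 := fun s t m hs ht =>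
      measure_mono_null ((inter_subset_inter (hmemT hs) (hmemT ht)).trans (hz m))
        (volume_hyperplane m (z m))
    intro s t hst
    obtain ⟨m, hm⟩ := Function.ne_iff.1 hst
    cases hs : s m <;> cases ht : t m
    · exact absurd (hs.trans ht.symm) hm
    · exact hdisj' s t m hs ht
    · rw [inter_comm]; exact hdisj' t s m ht hs
    · exact absurd (hs.trans ht.symm) hm
  -- all the cells have the same volume `r`
  obtain ⟨r, hr⟩ : ∃ r, ∀ s, ∫ y in e '' R s, g y = r :=
    ⟨W.vol (R fun _ => false), fun s => by
      rw [hvol _ s, DivergenceFreeWeb.vol_region (hR s) he (hRe s)]⟩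
  have hsum : ∀ T : Set (Fin n → Bool), ∫ y in ⋃ s : T, e '' R s, g y = Nat.card T * r := by
    intro T
    have h1 := (hasSum_integral_iUnion_ae (f := g) (fun s : T => hSm s)
      (fun s t hst => hdisj s t fun h => hst (Subtype.ext h))
      (hg.integrableOn_coordBox.mono_set (iUnion_subset fun s => hSK s))).tsum_eq
    have : Fintype T := Fintype.ofFinite _
    rw [← h1, tsum_fintype]
    simp only [hr]
    rw [Finset.sum_const, Nat.card_eq_fintype_card, Finset.card_univ, nsmul_eq_mul]
  have hr0 : r ≠ 0 := by
    intro h0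
    have h1 := hsum univ
    rw [h0, mul_zero] at h1
    have h2 : (⋃ s : (univ : Set (Fin n → Bool)), e '' R s) = coordBox a b := by
      rw [← hKimg, ← hRU, image_iUnion]
      exact iUnion_subtype _ _ |>.trans (by simp)
    rw [h2] at h1
    exact (cellVol_pos hg hg0 fun k => (hab k).ne).ne' h1
  have hnot : ∀ (β : Bool) (m : Fin n),
      ¬ (⋃ s ∈ {s : Fin n → Bool | s m = β}, e '' R s) ⊆ {y | y m = z m} := by
    intro β m hcon
    refine hr0 ?_
    rw [← hr fun _ => β]
    exact setIntegral_eq_zero_of_subset_hyperplane ((hmemT rfl).trans hcon)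
  have hsplit := fun m => split_of_inter_subset_hyperplane (convex_coordBox a b) (hX m) (hY m)
    (hU m) (hz m) (hnot false m) (hnot true m)
  -- the cells on the lower side of the `m`-th hyperplane are those whose `m`-th sign is `o m`
  have horient : ∀ m, ∃ o : Bool, ∀ s, (s m = o → e '' R s ⊆ {y | y m ≤ z m}) ∧
      (s m = !o → e '' R s ⊆ {y | z m ≤ y m}) := by
    intro m
    rcases hsplit m with ⟨h1, h2⟩ | ⟨h1, h2⟩
    · exact ⟨false, fun s => ⟨fun h => (hmemT h).trans h1, fun h => (hmemT h).trans h2⟩⟩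
    · exact ⟨true, fun s => ⟨fun h => (hmemT h).trans h2, fun h => (hmemT h).trans h1⟩⟩
  choose o ho using horient
  have hzI : ∀ m, z m ∈ Icc (a m) (b m) := by
    intro m
    have hne : ∀ s, (e '' R s).Nonempty := fun s => by
      obtain ⟨a', -, b', -, h⟩ := (hR s).exists_image_eq he (hRe s)
      rw [h]
      exact ⟨_, left_mem_coordBox _ _⟩
    obtain ⟨x, hx⟩ := hne fun _ => o m
    obtain ⟨y, hy⟩ := hne fun _ => !o m
    have hx1 := hSK _ hx m
    have hy1 := hSK _ hy m
    rw [uIcc_of_le (hab' m)] at hx1 hy1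
    exact ⟨hx1.1.trans ((ho m fun _ => o m).1 rfl hx), ((ho m fun _ => !o m).2 rfl hy : z m ≤ y m).trans hy1.2⟩
  let Q : Bool → Bool → Set (Euc n) := fun α β =>
    ⋃ s : {s : Fin n → Bool | s i = α ∧ s j = β}, e '' R s
  have hQ : ∀ α β α' β', ∫ y in Q α β, g y = ∫ y in Q α' β', g y := by
    intro α β α' β'
    rw [hsum, hsum]
    congr 2
    exact card_sign_pattern hij α β α' β'
  have hQU : Q (o i) (o j) ∪ Q (o i) (!o j) ∪ (Q (!o i) (!o j) ∪ Q (!o i) (o j)) =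
      coordBox a b := by
    have hQS : ∀ α β, Q α β ⊆ coordBox a b := fun α β => iUnion_subset fun s => hSK s
    refine Subset.antisymm (union_subset (union_subset (hQS _ _) (hQS _ _))
      (union_subset (hQS _ _) (hQS _ _))) fun y hy => ?_
    rw [← hKimg, ← hRU, image_iUnion] at hy
    obtain ⟨s, hs⟩ := mem_iUnion.1 hy
    have hys : y ∈ Q (s i) (s j) := mem_iUnion.2 ⟨⟨s, rfl, rfl⟩, hs⟩
    cases h1 : s i <;> cases h2 : s j <;> cases h3 : o i <;> cases h4 : o j <;>
      rw [h1, h2] at hys <;> simp only [Bool.not_true, Bool.not_false, mem_union] <;> tauto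
  have hQmem : ∀ {α β : Bool} {y : Euc n}, y ∈ Q α β → ∃ s : Fin n → Bool,
      s i = α ∧ s j = β ∧ y ∈ e '' R s := by
    intro α β y hy
    obtain ⟨⟨s, h1, h2⟩, hs⟩ := mem_iUnion.1 hy
    exact ⟨s, h1, h2, hs⟩
  obtain ⟨q1, q2, q3, q4⟩ := setIntegral_eq_cellVol_of_quadrants (g := g) hab' hij (hzI i) (hzI j)
    hQU
    (fun y hy => by
      obtain ⟨s, h1, h2, hs⟩ := hQmem hy
      exact ⟨(ho i s).1 h1 hs, (ho j s).1 h2 hs⟩)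
    (fun y hy => by
      obtain ⟨s, h1, h2, hs⟩ := hQmem hy
      exact ⟨(ho i s).1 h1 hs, (ho j s).2 h2 hs⟩)
    (fun y hy => by
      obtain ⟨s, h1, h2, hs⟩ := hQmem hy
      exact ⟨(ho i s).2 h1 hs, (ho j s).2 h2 hs⟩)
    (fun y hy => by
      obtain ⟨s, h1, h2, hs⟩ := hQmem hy
      exact ⟨(ho i s).2 h1 hs, (ho j s).1 h2 hs⟩)
  have p1 := hQ (o i) (o j) (o i) (!o j)
  have p2 := hQ (o i) (o j) (!o i) (!o j)
  have p3 := hQ (o i) (o j) (!o i) (o j)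
  rw [q1, q2] at p1
  rw [q1, q3] at p2
  rw [q1, q4] at p3
  have hu : ∀ k, uIcc (a k) (b k) = Icc (a k) (b k) := fun k => uIcc_of_le (hab' k)
  have hzi : z i ∈ uIcc (a i) (b i) := by rw [hu]; exact hzI i
  have hzj1 : z j ∈ uIcc (a j) (Function.update b i (z i) j) := by
    rw [Function.update_of_ne hij.symm, hu]; exact hzI j
  have hzj2 : z j ∈ uIcc (Function.update a i (z i) j) (b j) := by
    rw [Function.update_of_ne hij.symm, hu]; exact hzI j
  have t1 := cellVol_cut (hg.mono (coordBox_update_right hzi)) hzj1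
  have t2 := cellVol_cut (hg.mono (coordBox_update_left hzi)) hzj2
  have hci : c = z i := eq_of_cellVol_eq hg hg0 hab (Ioo_subset_Icc_self hc) (hzI i) hcc (by linarith)
  subst hci
  have hsub := coordBox_update_right (a := a) (b := b) hzi
  have hdj : d = z j := by
    refine eq_of_cellVol_eq (hg.mono hsub) (fun y hy => hg0 y (hsub hy)) (fun k => ?_) (i := j)
      ?_ ?_ hdd p1
    · by_cases hk : k = i
      · subst hk; rw [Function.update_self]; exact hc.1
      · rw [Function.update_of_ne hk]; exact hab k
    · rw [Function.update_of_ne hij.symm]; exact Ioo_subset_Icc_self hd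
    · rw [Function.update_of_ne hij.symm]; exact hzI j
  subst hdj
  linarith

end

/-! ### Rectangle functions compatible with bisection -/

section

theorem exists_mem_Ioo_two_mul_eq {f : ℝ → ℝ} {s t : ℝ} (hst : s ≤ t)
    (hf : ContinuousOn f (Icc s t)) (h : f s < f t) : ∃ c ∈ Ioo s t, 2 * f c = f s + f t := by
  obtain ⟨c, hc, h'⟩ := intermediate_value_Ioo hst hf
    (show (f s + f t) / 2 ∈ Ioo (f s) (f t) from ⟨by linarith, by linarith⟩)
  exact ⟨c, hc, by rw [h']; ring⟩

/-- A closed subset of a compact interval which contains the end points and has no gaps is the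
whole interval. -/
theorem Icc_subset_of_exists_between {Z : Set ℝ} {a b : ℝ} (hZ : IsClosed (Z ∩ Icc a b))
    (ha : a ∈ Z) (hb : b ∈ Z)
    (h : ∀ s ∈ Z ∩ Icc a b, ∀ t ∈ Z ∩ Icc a b, s < t → ∃ c ∈ Ioo s t, c ∈ Z) : Icc a b ⊆ Z := by
  intro x hx
  by_contra hxZ
  have hab : a ≤ b := hx.1.trans hx.2
  have hcpt : IsCompact (Z ∩ Icc a b) := isCompact_Icc.of_isClosed_subset hZ inter_subset_right
  obtain ⟨s, ⟨hs, hsx⟩, hs'⟩ := (hcpt.inter_right isClosed_Iic).exists_isGreatest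
    (s := Z ∩ Icc a b ∩ Iic x) ⟨a, ⟨ha, le_rfl, hab⟩, hx.1⟩
  obtain ⟨t, ⟨ht, hxt⟩, ht'⟩ := (hcpt.inter_right isClosed_Ici).exists_isLeast
    (s := Z ∩ Icc a b ∩ Ici x) ⟨b, ⟨hb, hab, le_rfl⟩, hx.2⟩
  have hsx' : s < x := lt_of_le_of_ne hsx fun h => hxZ (h ▸ hs.1)
  have hxt' : x < t := lt_of_le_of_ne hxt fun h => hxZ (h ▸ ht.1)
  obtain ⟨c, hc, hcZ⟩ := h s hs t ht (hsx'.trans hxt')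
  have hcI : c ∈ Icc a b := ⟨hs.2.1.trans hc.1.le, hc.2.le.trans ht.2.2⟩
  rcases le_total c x with hcx | hcx
  · exact (hs' ⟨⟨hcZ, hcI⟩, hcx⟩).not_gt hc.1
  · exact (ht' ⟨⟨hcZ, hcI⟩, hcx⟩).not_gt hc.2

/-- The increment of a function of two variables over the rectangle `[x₁, x₂] × [y₁, y₂]`. -/
def rectIncr (H : ℝ → ℝ → ℝ) (x₁ x₂ y₁ y₂ : ℝ) : ℝ := H x₂ y₂ - H x₁ y₂ - H x₂ y₁ + H x₁ y₁

/-- A separately continuous function on `[α, β] × [γ, η]` with positive increments over rectangles,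
such that `y = d` halves the increment over the right half of a rectangle whenever it halves that
over the left half. It is the two-dimensional form of `BisectionCompatible`. -/
structure IsBisectionRect (H : ℝ → ℝ → ℝ) (α β γ η : ℝ) : Prop where
  continuous_fst : ∀ y ∈ Icc γ η, ContinuousOn (fun x => H x y) (Icc α β)
  continuous_snd : ∀ x ∈ Icc α β, ContinuousOn (H x) (Icc γ η)
  pos : ∀ x₁ ∈ Icc α β, ∀ x₂ ∈ Icc α β, x₁ < x₂ → ∀ y₁ ∈ Icc γ η, ∀ y₂ ∈ Icc γ η, y₁ < y₂ →
    0 < rectIncr H x₁ x₂ y₁ y₂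
  bisection : ∀ x₁ ∈ Icc α β, ∀ x₂ ∈ Icc α β, ∀ y₁ ∈ Icc γ η, ∀ y₂ ∈ Icc γ η,
    ∀ c ∈ Ioo x₁ x₂, ∀ d ∈ Ioo y₁ y₂, rectIncr H x₁ c y₁ y₂ = rectIncr H c x₂ y₁ y₂ →
    rectIncr H x₁ c y₁ d = rectIncr H x₁ c d y₂ → rectIncr H c x₂ y₁ d = rectIncr H c x₂ d y₂

namespace IsBisectionRect

variable {H : ℝ → ℝ → ℝ} {α β γ η : ℝ}

/-- If `y = d` halves a rectangle, it halves all the rectangles of the same height contained in it.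
The set of `x` such that `y = d` halves the part to the left of `x` has no gaps, as between two
of its points lies the point which bisects the strip between them. -/
theorem bisection_sub (h : IsBisectionRect H α β γ η) {s t y₁ y₂ d x : ℝ} (hs : s ∈ Icc α β)
    (ht : t ∈ Icc α β) (hy₁ : y₁ ∈ Icc γ η) (hy₂ : y₂ ∈ Icc γ η) (hd : d ∈ Ioo y₁ y₂)
    (hst : rectIncr H s t y₁ d = rectIncr H s t d y₂) (hx : x ∈ Icc s t) :
    rectIncr H s x y₁ d = rectIncr H s x d y₂ := by
  have hsub : Icc s t ⊆ Icc α β := Icc_subset_Icc hs.1 ht.2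
  have hdI : d ∈ Icc γ η := ⟨hy₁.1.trans hd.1.le, hd.2.le.trans hy₂.2⟩
  have hsubY : Icc y₁ y₂ ⊆ Icc γ η := Icc_subset_Icc hy₁.1 hy₂.2
  have hy12 : y₁ < y₂ := hd.1.trans hd.2
  refine Icc_subset_of_exists_between (a := s) (b := t)
    (Z := {x | rectIncr H s x y₁ d = rectIncr H s x d y₂}) ?_ ?_ hst ?_ hx
  · have hc : ∀ y ∈ Icc γ η, ContinuousOn (fun x => H x y) (Icc s t) := fun y hy =>
      (h.continuous_fst y hy).mono hsub
    have hcont : ContinuousOn (fun x => rectIncr H s x y₁ d - rectIncr H s x d y₂) (Icc s t) := by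
      unfold rectIncr
      have c1 := hc _ hy₁
      have c2 := hc _ hy₂
      have c3 := hc _ hdI
      fun_prop
    have := hcont.preimage_isClosed_of_isClosed isClosed_Icc (isClosed_singleton (x := (0 : ℝ)))
    convert! this using 1
    ext x
    simp only [mem_inter_iff, mem_preimage, mem_singleton_iff, sub_eq_zero]
    exact and_comm
  · change rectIncr H s s y₁ d = rectIncr H s s d y₂
    unfold rectIncr; ring
  · rintro p ⟨hpZ, hp⟩ q ⟨hqZ, hq⟩ hpq
    have hpZ : rectIncr H s p y₁ d = rectIncr H s p d y₂ := hpZ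
    have hqZ : rectIncr H s q y₁ d = rectIncr H s q d y₂ := hqZ
    have hpI := hsub hp
    have hqI := hsub hq
    obtain ⟨c, hc, hc2⟩ := exists_mem_Ioo_two_mul_eq (f := fun x => H x y₂ - H x y₁) hpq.le
      (((h.continuous_fst _ hy₂).sub (h.continuous_fst _ hy₁)).mono (Icc_subset_Icc hpI.1 hqI.2))
      (by have := h.pos p hpI q hqI hpq _ hy₁ _ hy₂ hy12; unfold rectIncr at this; linarith)
    have hcI : c ∈ Icc α β := ⟨hpI.1.trans hc.1.le, hc.2.le.trans hqI.2⟩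
    obtain ⟨d', hd', hd2⟩ := exists_mem_Ioo_two_mul_eq (f := fun y => H c y - H p y) hy12.le
      (((h.continuous_snd _ hcI).sub (h.continuous_snd _ hpI)).mono hsubY)
      (by have := h.pos p hpI c hcI hc.1 _ hy₁ _ hy₂ hy12; unfold rectIncr at this; linarith)
    have hd'I : d' ∈ Icc γ η := ⟨hy₁.1.trans hd'.1.le, hd'.2.le.trans hy₂.2⟩
    have key := h.bisection p hpI q hqI _ hy₁ _ hy₂ c hc d' hd' (by unfold rectIncr; linarith)
      (by unfold rectIncr; linarith)
    refine ⟨c, hc, ?_⟩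
    -- `d` and `d'` both halve the strip between `p` and `q`
    have hdd : d = d' := by
      rcases lt_trichotomy d d' with hlt | heq | hlt
      · have := h.pos p hpI q hqI hpq _ hdI _ hd'I hlt
        unfold rectIncr at *
        linarith
      · exact heq
      · have := h.pos p hpI q hqI hpq _ hd'I _ hdI hlt
        unfold rectIncr at *
        linarith
    subst hdd
    change rectIncr H s c y₁ d = rectIncr H s c d y₂
    unfold rectIncr at *
    linarith

/-- The increments over lower left rectangles are proportional to the products of those over the full
strips. The set of heights `y` where this holds has no gaps, since the height which bisects a
horizontal strip bisects its left part as well. -/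
theorem left_mul (h : IsBisectionRect H α β γ η) {x y : ℝ} (hx : x ∈ Icc α β) (hy : y ∈ Icc γ η) :
    rectIncr H α x γ y * rectIncr H α β γ η = rectIncr H α x γ η * rectIncr H α β γ y := by
  have hα : α ∈ Icc α β := ⟨le_rfl, hx.1.trans hx.2⟩
  have hβ : β ∈ Icc α β := ⟨hx.1.trans hx.2, le_rfl⟩
  have hγ : γ ∈ Icc γ η := ⟨le_rfl, hy.1.trans hy.2⟩
  have hη : η ∈ Icc γ η := ⟨hy.1.trans hy.2, le_rfl⟩
  refine Icc_subset_of_exists_between (a := γ) (b := η) (Z := {y |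
    rectIncr H α x γ y * rectIncr H α β γ η = rectIncr H α x γ η * rectIncr H α β γ y}) ?_ ?_ ?_
    ?_ hy
  · have hcont : ContinuousOn (fun y => rectIncr H α x γ y * rectIncr H α β γ η -
        rectIncr H α x γ η * rectIncr H α β γ y) (Icc γ η) := by
      unfold rectIncr
      have c1 := h.continuous_snd _ hx
      have c2 := h.continuous_snd _ hα
      have c3 := h.continuous_snd _ hβ
      fun_prop
    have := hcont.preimage_isClosed_of_isClosed isClosed_Icc (isClosed_singleton (x := (0 : ℝ)))
    convert! this using 1
    ext x
    simp only [mem_inter_iff, mem_preimage, mem_singleton_iff, sub_eq_zero]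
    exact and_comm
  · change rectIncr H α x γ γ * rectIncr H α β γ η = rectIncr H α x γ η * rectIncr H α β γ γ
    unfold rectIncr; ring
  · rfl
  · rintro s ⟨hsZ, hs⟩ t ⟨htZ, ht⟩ hst
    rcases hα.2.eq_or_lt with heq | hαβ
    · refine ⟨(s + t) / 2, ⟨by linarith, by linarith⟩, ?_⟩
      have : x = α := le_antisymm (heq ▸ hx.2) hx.1
      change rectIncr H α x γ _ * rectIncr H α β γ η = rectIncr H α x γ η * rectIncr H α β γ _
      subst this heq
      unfold rectIncr; ring
    obtain ⟨d, hd, hd2⟩ := exists_mem_Ioo_two_mul_eq (f := fun y => H β y - H α y) hst.le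
      (((h.continuous_snd _ hβ).sub (h.continuous_snd _ hα)).mono (Icc_subset_Icc hs.1 ht.2))
      (by have := h.pos _ hα _ hβ hαβ _ hs _ ht hst; unfold rectIncr at this; linarith)
    have key := h.bisection_sub hα hβ hs ht hd (by unfold rectIncr; linarith) hx
    refine ⟨d, hd, ?_⟩
    have hsZ : rectIncr H α x γ s * rectIncr H α β γ η =
      rectIncr H α x γ η * rectIncr H α β γ s := hsZ
    have htZ : rectIncr H α x γ t * rectIncr H α β γ η =
      rectIncr H α x γ η * rectIncr H α β γ t := htZ
    change rectIncr H α x γ d * rectIncr H α β γ η = rectIncr H α x γ η * rectIncr H α β γ d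
    have e1 : rectIncr H α x γ d = (rectIncr H α x γ s + rectIncr H α x γ t) / 2 := by
      unfold rectIncr at *; linarith
    have e2 : rectIncr H α β γ d = (rectIncr H α β γ s + rectIncr H α β γ t) / 2 := by
      unfold rectIncr at *; linarith
    rw [e1, e2]
    linear_combination (hsZ + htZ) / 2

/-- The increments over the products of two intervals with two others satisfy `ac = bd`. -/
theorem mul_eq_mul (h : IsBisectionRect H α β γ η) {x₁ x₂ x₃ x₄ y₁ y₂ y₃ y₄ : ℝ} (hαβ : α < β)
    (hγη : γ < η) (hx₁ : x₁ ∈ Icc α β) (hx₂ : x₂ ∈ Icc α β) (hx₃ : x₃ ∈ Icc α β)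
    (hx₄ : x₄ ∈ Icc α β) (hy₁ : y₁ ∈ Icc γ η) (hy₂ : y₂ ∈ Icc γ η) (hy₃ : y₃ ∈ Icc γ η)
    (hy₄ : y₄ ∈ Icc γ η) :
    rectIncr H x₁ x₂ y₁ y₂ * rectIncr H x₃ x₄ y₃ y₄ =
      rectIncr H x₁ x₂ y₃ y₄ * rectIncr H x₃ x₄ y₁ y₂ := by
  have hpos := h.pos α ⟨le_rfl, hαβ.le⟩ β ⟨hαβ.le, le_rfl⟩ hαβ γ ⟨le_rfl, hγη.le⟩ η
    ⟨hγη.le, le_rfl⟩ hγη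
  have key : ∀ {x₁ x₂ y₁ y₂ : ℝ}, x₁ ∈ Icc α β → x₂ ∈ Icc α β → y₁ ∈ Icc γ η → y₂ ∈ Icc γ η →
      rectIncr H x₁ x₂ y₁ y₂ =
        rectIncr H x₁ x₂ γ η * rectIncr H α β y₁ y₂ / rectIncr H α β γ η := by
    intro x₁ x₂ y₁ y₂ h1 h2 h3 h4
    rw [eq_div_iff hpos.ne']
    have k1 := h.left_mul h1 h3
    have k2 := h.left_mul h2 h3
    have k3 := h.left_mul h1 h4
    have k4 := h.left_mul h2 h4
    have e1 : rectIncr H x₁ x₂ y₁ y₂ = rectIncr H α x₂ γ y₂ - rectIncr H α x₁ γ y₂ -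
        rectIncr H α x₂ γ y₁ + rectIncr H α x₁ γ y₁ := by unfold rectIncr; ring
    have e2 : rectIncr H x₁ x₂ γ η = rectIncr H α x₂ γ η - rectIncr H α x₁ γ η := by
      unfold rectIncr; ring
    have e3 : rectIncr H α β y₁ y₂ = rectIncr H α β γ y₂ - rectIncr H α β γ y₁ := by
      unfold rectIncr; ring
    rw [e1, e2, e3]
    linear_combination k1 - k2 - k3 + k4
  rw [key hx₁ hx₂ hy₁ hy₂, key hx₃ hx₄ hy₃ hy₄, key hx₁ hx₂ hy₃ hy₄, key hx₃ hx₄ hy₁ hy₂]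
  ring

end IsBisectionRect

end

/-! ### Densities compatible with bisection -/

section

open MeasureTheory

variable {n : ℕ}

/-- The hypothesis is Lipschitz continuity, for ordered pairs of points. -/
theorem continuousOn_of_increment_le {f : ℝ → ℝ} {a b C : ℝ}
    (h : ∀ x ∈ Icc a b, ∀ x' ∈ Icc a b, x ≤ x' → |f x' - f x| ≤ C * (x' - x)) :
    ContinuousOn f (Icc a b) := by
  have : LipschitzOnWith C.toNNReal f (Icc a b) := by
    refine LipschitzOnWith.of_dist_le_mul fun x hx y hy => ?_
    rw [Real.dist_eq, Real.dist_eq]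
    rcases le_total x y with hxy | hxy
    · rw [abs_sub_comm, abs_sub_comm x y, abs_of_nonneg (sub_nonneg.2 hxy)]
      exact (h x hx y hy hxy).trans
        (mul_le_mul_of_nonneg_right (Real.le_coe_toNNReal C) (sub_nonneg.2 hxy))
    · rw [abs_of_nonneg (sub_nonneg.2 hxy)]
      exact (h y hy x hx hxy).trans
        (mul_le_mul_of_nonneg_right (Real.le_coe_toNNReal C) (sub_nonneg.2 hxy))
  exact this.continuousOn

theorem continuousOn_cellVol_update {g : Euc n → ℝ} {a b : Fin n → ℝ}
    (hg : ContinuousOn g (coordBox a b)) (hg0 : ∀ y ∈ coordBox a b, 0 < g y) (i : Fin n)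
    (hab : a i ≤ b i) :
    ContinuousOn (fun x => cellVol g a (Function.update b i x)) (Icc (a i) (b i)) := by
  obtain ⟨z, hz, hmax⟩ := (isCompact_coordBox a b).exists_isMaxOn ⟨_, left_mem_coordBox a b⟩ hg
  refine continuousOn_of_increment_le (C := g z * ∏ k ∈ Finset.univ.erase i, |b k - a k|) ?_
  intro x hx x' hx' hxx'
  have hu : x' ∈ uIcc (a i) (b i) := by rw [uIcc_of_le hab]; exact hx'
  have hs := coordBox_update_right hu
  have hx2 : x ∈ uIcc (a i) (Function.update b i x' i) := by
    rw [Function.update_self, uIcc_of_le hx'.1]; exact ⟨hx.1, hxx'⟩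
  have hcut := cellVol_cut (hg.mono hs) hx2
  rw [Function.update_idem] at hcut
  have hs2 := (coordBox_update_left hx2).trans hs
  have h1 := cellVol_le (hg.mono hs2) (m := g z) fun y hy => hmax (hs2 hy)
  have h2 := cellVol_nonneg (g := g) fun y hy => (hg0 y (hs2 hy)).le
  rw [← Finset.mul_prod_erase _ _ (Finset.mem_univ i), Function.update_self, Function.update_self,
    abs_of_nonneg (sub_nonneg.2 hxx')] at h1
  have h3 : ∏ k ∈ Finset.univ.erase i, |Function.update b i x' k - Function.update a i x k| =
      ∏ k ∈ Finset.univ.erase i, |b k - a k| := by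
    refine Finset.prod_congr rfl fun k hk => ?_
    have := Finset.ne_of_mem_erase hk
    rw [Function.update_of_ne this, Function.update_of_ne this]
  rw [h3] at h1
  rw [hcut, add_sub_cancel_left, abs_of_nonneg h2]
  linarith

theorem tendsto_of_forall_abs_sub_le {ξ : ℕ → Euc n} {P : Euc n} {δ : ℝ}
    (h : ∀ m k, |ξ m k - P k| ≤ δ / (m + 1)) : Tendsto ξ atTop (𝓝 P) := by
  refine tendsto_def.2 fun O hO => ?_
  obtain ⟨ε, hε, hε'⟩ := exists_cube_subset hO
  have h1 : Tendsto (fun m : ℕ => δ / ((m : ℝ) + 1)) atTop (𝓝 0) :=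
    tendsto_const_div_atTop_nhds_zero_nat δ |>.comp (tendsto_add_atTop_nat 1) |>.congr
      fun m => by simp
  filter_upwards [h1.eventually (gt_mem_nhds hε)] with m hm
  exact hε' _ fun k => (h m k).trans_lt hm

theorem exists_cellVol_cube_eq {g : Euc n → ℝ} {P : Euc n} {δ : ℝ} (hδ : 0 ≤ δ)
    (hg : ContinuousOn g (coordBox (fun k => P k - δ) (fun k => P k + δ))) :
    ∃ ξ : Euc n, (∀ k, |ξ k - P k| ≤ δ) ∧
      cellVol g (fun k => P k - δ) (fun k => P k + δ) = g ξ * (2 * δ) ^ n := by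
  obtain ⟨ξ, hξ, h⟩ := exists_cellVol_eq hg
  refine ⟨ξ, fun k => ?_, ?_⟩
  · have := hξ k
    rw [uIcc_of_le (by linarith)] at this
    rw [abs_le]
    constructor <;> linarith [this.1, this.2]
  · rw [h]
    congr 1
    rw [Finset.prod_congr rfl fun k _ => show |P k + δ - (P k - δ)| = 2 * δ by
      rw [show P k + δ - (P k - δ) = 2 * δ by ring, abs_of_nonneg (by linarith)]]
    simp

variable {g : Euc n → ℝ} {l u : Fin n → ℝ}

/-- For a fixed box, the volumes of its parts cut out in the directions `i` and `j` are the increments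
of a function of two variables as in `IsBisectionRect`. -/
theorem BisectionCompatible.isBisectionRect (h : BisectionCompatible g l u)
    (hg : ContinuousOn g {y | ∀ k, y k ∈ Ioo (l k) (u k)})
    (hg0 : ∀ y : Euc n, (∀ k, y k ∈ Ioo (l k) (u k)) → 0 < g y) {i j : Fin n} (hij : i ≠ j)
    {p q : Fin n → ℝ} (hp : ∀ k, p k ∈ Ioo (l k) (u k)) (hq : ∀ k, q k ∈ Ioo (l k) (u k))
    (hpq : ∀ k, p k < q k) :
    (∀ x₁ ∈ Icc (p i) (q i), ∀ x₂ ∈ Icc (p i) (q i), x₁ ≤ x₂ →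
      ∀ y₁ ∈ Icc (p j) (q j), ∀ y₂ ∈ Icc (p j) (q j), y₁ ≤ y₂ →
      rectIncr (fun x y => cellVol g p (Function.update (Function.update q i x) j y)) x₁ x₂ y₁ y₂ =
        cellVol g (Function.update (Function.update p i x₁) j y₁)
          (Function.update (Function.update q i x₂) j y₂)) ∧
    IsBisectionRect (fun x y => cellVol g p (Function.update (Function.update q i x) j y))
      (p i) (q i) (p j) (q j) := by
  have hIi : Icc (p i) (q i) ⊆ Ioo (l i) (u i) := ordConnected_Ioo.out (hp i) (hq i)
  have hIj : Icc (p j) (q j) ⊆ Ioo (l j) (u j) := ordConnected_Ioo.out (hp j) (hq j)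
  have hbox : ∀ {a b : Fin n → ℝ}, (∀ k, a k ∈ Ioo (l k) (u k)) → (∀ k, b k ∈ Ioo (l k) (u k)) →
      ContinuousOn g (coordBox a b) := fun ha hb => hg.mono (coordBox_subset_openBox ha hb)
  have hpos : ∀ {a b : Fin n → ℝ}, (∀ k, a k ∈ Ioo (l k) (u k)) → (∀ k, b k ∈ Ioo (l k) (u k)) →
      ∀ y ∈ coordBox a b, 0 < g y := fun ha hb y hy => hg0 y (coordBox_subset_openBox ha hb hy)
  have hA : ∀ {f : Fin n → ℝ}, (∀ k, f k ∈ Ioo (l k) (u k)) → ∀ {x y : ℝ}, x ∈ Icc (p i) (q i) →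
      y ∈ Icc (p j) (q j) → ∀ k, Function.update (Function.update f i x) j y k ∈ Ioo (l k) (u k) :=
    fun hf x y hx hy => update_mem_box (update_mem_box hf (hIi hx)) (hIj hy)
  have ui : ∀ (f : Fin n → ℝ) (x y : ℝ), Function.update (Function.update f i x) j y i = x :=
    fun f x y => by simp [hij]
  have uj : ∀ (f : Fin n → ℝ) (x y : ℝ), Function.update (Function.update f i x) j y j = y :=
    fun f x y => by simp
  have wi : ∀ (f : Fin n → ℝ) (x y c : ℝ),
      Function.update (Function.update (Function.update f i x) j y) i c =
        Function.update (Function.update f i c) j y := fun f x y c => by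
    rw [Function.update_comm hij.symm, Function.update_idem]
  have wj : ∀ (f : Fin n → ℝ) (x y d : ℝ),
      Function.update (Function.update (Function.update f i x) j y) j d =
        Function.update (Function.update f i x) j d := fun f x y d => Function.update_idem ..
  have pp : Function.update (Function.update p i (p i)) j (p j) = p := by simp
  have hrect : ∀ x₁ ∈ Icc (p i) (q i), ∀ x₂ ∈ Icc (p i) (q i), x₁ ≤ x₂ →
      ∀ y₁ ∈ Icc (p j) (q j), ∀ y₂ ∈ Icc (p j) (q j), y₁ ≤ y₂ →
      rectIncr (fun x y => cellVol g p (Function.update (Function.update q i x) j y)) x₁ x₂ y₁ y₂ =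
        cellVol g (Function.update (Function.update p i x₁) j y₁)
          (Function.update (Function.update q i x₂) j y₂) := by
    intro x₁ hx₁ x₂ hx₂ hx y₁ hy₁ y₂ hy₂ hy
    have hpi : p i ∈ Icc (p i) (q i) := ⟨le_rfl, (hpq i).le⟩
    have hpj : p j ∈ Icc (p j) (q j) := ⟨le_rfl, (hpq j).le⟩
    have e1 : ∀ y ∈ Icc (p j) (q j),
        cellVol g p (Function.update (Function.update q i x₂) j y) =
        cellVol g p (Function.update (Function.update q i x₁) j y) +
        cellVol g (Function.update (Function.update p i x₁) j (p j))
          (Function.update (Function.update q i x₂) j y) := by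
      intro y hy
      have := cellVol_cut (a := p) (b := Function.update (Function.update q i x₂) j y) (i := i)
        (c := x₁) (hbox hp (hA hq hx₂ hy))
        (by rw [ui, uIcc_of_le hx₂.1]; exact ⟨hx₁.1, hx⟩)
      rw [wi] at this
      rw [this]
      congr 2
      rw [← wi p (p i) (p j) x₁, pp]
    have e2 := cellVol_cut (a := Function.update (Function.update p i x₁) j (p j))
      (b := Function.update (Function.update q i x₂) j y₂) (i := j) (c := y₁)
      (hbox (hA hp hx₁ hpj) (hA hq hx₂ hy₂))
      (by rw [uj, uj, uIcc_of_le hy₂.1]; exact ⟨hy₁.1, hy⟩)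
    rw [wj, wj] at e2
    unfold rectIncr
    have e3 := e1 y₁ hy₁
    have e4 := e1 y₂ hy₂
    linarith
  refine ⟨hrect, ⟨fun y hy => ?_, fun x hx => ?_, fun x₁ hx₁ x₂ hx₂ hx y₁ hy₁ y₂ hy₂ hy => ?_,
    fun x₁ hx₁ x₂ hx₂ y₁ hy₁ y₂ hy₂ c hc d hd hcc hdd => ?_⟩⟩
  · have hqi : q i ∈ Icc (p i) (q i) := ⟨(hpq i).le, le_rfl⟩
    have hb := hA hq hqi hy
    have := continuousOn_cellVol_update (hbox hp hb) (hpos hp hb) i (by rw [ui]; exact (hpq i).le)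
    simp only [wi, ui] at this
    exact this
  · have hqj : q j ∈ Icc (p j) (q j) := ⟨(hpq j).le, le_rfl⟩
    have hb := hA hq hx hqj
    have := continuousOn_cellVol_update (hbox hp hb) (hpos hp hb) j (by rw [uj]; exact (hpq j).le)
    simp only [wj, uj] at this
    exact this
  · rw [hrect x₁ hx₁ x₂ hx₂ hx.le y₁ hy₁ y₂ hy₂ hy.le]
    refine cellVol_pos (hbox (hA hp hx₁ hy₁) (hA hq hx₂ hy₂)) (hpos (hA hp hx₁ hy₁) (hA hq hx₂ hy₂))
      fun k => ?_
    by_cases hkj : k = j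
    · subst hkj; rw [uj, uj]; exact hy.ne
    · by_cases hki : k = i
      · subst hki; rw [ui, ui]; exact hx.ne
      · simpa [hkj, hki] using (hpq k).ne
  · have hcI : c ∈ Icc (p i) (q i) := ⟨hx₁.1.trans hc.1.le, hc.2.le.trans hx₂.2⟩
    have hdI : d ∈ Icc (p j) (q j) := ⟨hy₁.1.trans hd.1.le, hd.2.le.trans hy₂.2⟩
    have hy12 := hd.1.trans hd.2
    rw [hrect _ hx₁ _ hcI hc.1.le _ hy₁ _ hy₂ hy12.le,
      hrect _ hcI _ hx₂ hc.2.le _ hy₁ _ hy₂ hy12.le] at hcc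
    rw [hrect _ hx₁ _ hcI hc.1.le _ hy₁ _ hdI hd.1.le,
      hrect _ hx₁ _ hcI hc.1.le _ hdI _ hy₂ hd.2.le] at hdd
    rw [hrect _ hcI _ hx₂ hc.2.le _ hy₁ _ hdI hd.1.le,
      hrect _ hcI _ hx₂ hc.2.le _ hdI _ hy₂ hd.2.le]
    have key := h (Function.update (Function.update p i x₁) j y₁)
      (Function.update (Function.update q i x₂) j y₂) (hA hp hx₁ hy₁) (hA hq hx₂ hy₂) (fun k => ?_)
      i j hij c (by rw [ui, ui]; exact hc) d (by rw [uj, uj]; exact hd)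
    · simp only [wi, wj] at key
      exact key hcc hdd
    · by_cases hkj : k = j
      · subst hkj; rw [uj, uj]; exact hy12
      · by_cases hki : k = i
        · subst hki; rw [ui, ui]; exact hc.1.trans hc.2
        · simpa [hkj, hki] using (hpq k)

/-- The values at the vertices of a coordinate rectangle are the limits of the mean values over
shrinking cubes around them, and the volumes of such cubes satisfy `ac = bd`. -/
theorem BisectionCompatible.mul_eq_mul (h : BisectionCompatible g l u)
    (hg : ContinuousOn g {y | ∀ k, y k ∈ Ioo (l k) (u k)})
    (hg0 : ∀ y : Euc n, (∀ k, y k ∈ Ioo (l k) (u k)) → 0 < g y) {i j : Fin n} (hij : i ≠ j)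
    {y : Euc n} (hy : ∀ k, y k ∈ Ioo (l k) (u k)) {s t : ℝ} (hs : s ∈ Ioo (l i) (u i))
    (ht : t ∈ Ioo (l j) (u j)) :
    g y * g (setCoord (setCoord y i s) j t) = g (setCoord y i s) * g (setCoord y j t) := by
  set O : Set (Euc n) := {y | ∀ k, y k ∈ Ioo (l k) (u k)} with hO
  have hOo : IsOpen O := isOpen_openBox l u
  let c : ℝ → ℝ → Euc n := fun x z => setCoord (setCoord y i x) j z
  have hc : ∀ x ∈ Ioo (l i) (u i), ∀ z ∈ Ioo (l j) (u j), c x z ∈ O := fun x hx z hz =>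
    update_mem_box (update_mem_box hy hx) hz
  -- a common margin around the four vertices
  have hmargin : ∃ δ > 0, ∀ x ∈ ({y i, s} : Set ℝ), ∀ z ∈ ({y j, t} : Set ℝ), ∀ k,
      c x z k - δ ∈ Ioo (l k) (u k) ∧ c x z k + δ ∈ Ioo (l k) (u k) := by
    have h1 : ∀ w : Euc n, w ∈ O → ∃ δ₀ > 0, ∀ δ ≤ δ₀, 0 < δ → ∀ k,
        w k - δ ∈ Ioo (l k) (u k) ∧ w k + δ ∈ Ioo (l k) (u k) := by
      intro w hw
      obtain ⟨ε, hε, hε'⟩ := exists_cube_subset (hOo.mem_nhds hw)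
      refine ⟨ε / 2, half_pos hε, fun δ hδ hδ0 k => ?_⟩
      have h2 : ∀ r : ℝ, |r| < ε → w k + r ∈ Ioo (l k) (u k) := by
        intro r hr
        have := hε' (setCoord w k (w k + r)) (fun m => by
          by_cases hm : m = k
          · subst hm; simpa using hr
          · rw [setCoord_of_ne w hm]; simpa using hε) k
        simpa using this
      have hδε : |δ| < ε := by rw [abs_of_pos hδ0]; linarith
      exact ⟨by rw [sub_eq_add_neg]; exact h2 _ (by rwa [abs_neg]), h2 _ hδε⟩
    obtain ⟨δ1, p1, h1'⟩ := h1 (c (y i) (y j)) (hc _ (hy i) _ (hy j))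
    obtain ⟨δ2, p2, h2'⟩ := h1 (c (y i) t) (hc _ (hy i) _ ht)
    obtain ⟨δ3, p3, h3'⟩ := h1 (c s (y j)) (hc _ hs _ (hy j))
    obtain ⟨δ4, p4, h4'⟩ := h1 (c s t) (hc _ hs _ ht)
    have hp : 0 < min (min δ1 δ2) (min δ3 δ4) := lt_min (lt_min p1 p2) (lt_min p3 p4)
    refine ⟨min (min δ1 δ2) (min δ3 δ4), hp, ?_⟩
    rintro x (rfl | rfl) z (rfl | rfl)
    · exact h1' _ ((min_le_left _ _).trans (min_le_left _ _)) hp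
    · exact h2' _ ((min_le_left _ _).trans (min_le_right _ _)) hp
    · exact h3' _ ((min_le_right _ _).trans (min_le_left _ _)) hp
    · exact h4' _ ((min_le_right _ _).trans (min_le_right _ _)) hp
  obtain ⟨δ₀, hδ₀, hm⟩ := hmargin
  have ci : ∀ x z, c x z i = x := fun x z => by
    change setCoord (setCoord y i x) j z i = x
    rw [setCoord_of_ne _ hij, setCoord_self]
  have cj : ∀ x z, c x z j = z := fun x z => setCoord_self _ _ _
  have ck : ∀ x z k, k ≠ i → k ≠ j → c x z k = y k := fun x z k h1 h2 => by
    change setCoord (setCoord y i x) j z k = y k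
    rw [setCoord_of_ne _ h2, setCoord_of_ne _ h1]
  have mi : ∀ x ∈ ({y i, s} : Set ℝ), x - δ₀ ∈ Ioo (l i) (u i) ∧ x + δ₀ ∈ Ioo (l i) (u i) := by
    intro x hx
    have := hm x hx (y j) (Or.inl rfl) i
    rwa [ci] at this
  have mj : ∀ z ∈ ({y j, t} : Set ℝ), z - δ₀ ∈ Ioo (l j) (u j) ∧ z + δ₀ ∈ Ioo (l j) (u j) := by
    intro z hz
    have := hm (y i) (Or.inl rfl) z hz j
    rwa [cj] at this
  have key : ∀ δ, 0 < δ → δ ≤ δ₀ → ∃ p₁ p₂ p₃ p₄ : Euc n, (∀ k, |p₁ k - c (y i) (y j) k| ≤ δ) ∧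
      (∀ k, |p₂ k - c s t k| ≤ δ) ∧ (∀ k, |p₃ k - c (y i) t k| ≤ δ) ∧
      (∀ k, |p₄ k - c s (y j) k| ≤ δ) ∧ g p₁ * g p₂ = g p₃ * g p₄ := by
    intro δ hδ hδδ₀
    have hcube : ∀ x ∈ ({y i, s} : Set ℝ), ∀ z ∈ ({y j, t} : Set ℝ),
        ∃ ξ : Euc n, (∀ k, |ξ k - c x z k| ≤ δ) ∧
        cellVol g (fun k => c x z k - δ) (fun k => c x z k + δ) = g ξ * (2 * δ) ^ n := by
      intro x hx z hz
      refine exists_cellVol_cube_eq hδ.le (hg.mono ?_)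
      refine coordBox_subset_openBox (fun k => ?_) fun k => ?_
      · exact ⟨by linarith [(hm x hx z hz k).1.1], by linarith [(hm x hx z hz k).2.2]⟩
      · exact ⟨by linarith [(hm x hx z hz k).1.1], by linarith [(hm x hx z hz k).2.2]⟩
    have yi : y i ∈ ({y i, s} : Set ℝ) := Or.inl rfl
    have si : s ∈ ({y i, s} : Set ℝ) := Or.inr rfl
    have yj : y j ∈ ({y j, t} : Set ℝ) := Or.inl rfl
    have tj : t ∈ ({y j, t} : Set ℝ) := Or.inr rfl
    obtain ⟨p₁, h1, v1⟩ := hcube _ yi _ yj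
    obtain ⟨p₂, h2, v2⟩ := hcube _ si _ tj
    obtain ⟨p₃, h3, v3⟩ := hcube _ yi _ tj
    obtain ⟨p₄, h4, v4⟩ := hcube _ si _ yj
    refine ⟨p₁, p₂, p₃, p₄, h1, h2, h3, h4, ?_⟩
    -- a box containing the four cubes
    let p : Fin n → ℝ := Function.update (Function.update (fun k => y k - δ) i (min (y i) s - δ)) j
      (min (y j) t - δ)
    let q : Fin n → ℝ := Function.update (Function.update (fun k => y k + δ) i (max (y i) s + δ)) j
      (max (y j) t + δ)
    have pi : p i = min (y i) s - δ := by simp [p, hij]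
    have qi : q i = max (y i) s + δ := by simp [q, hij]
    have pj : p j = min (y j) t - δ := by simp [p]
    have qj : q j = max (y j) t + δ := by simp [q]
    have hp : ∀ k, p k ∈ Ioo (l k) (u k) := by
      refine update_mem_box (update_mem_box (fun k => ?_) ?_) ?_
      · have := hy k
        by_cases hki : k = i
        · subst hki
          exact ⟨by linarith [(mi _ yi).1.1], by linarith [this.2]⟩
        · by_cases hkj : k = j
          · subst hkj
            exact ⟨by linarith [(mj _ yj).1.1], by linarith [this.2]⟩
          · have := (hm _ yi _ yj k)
            rw [ck _ _ _ hki hkj] at this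
            exact ⟨by linarith [this.1.1], by linarith [this.2.2]⟩
      · rcases min_choice (y i) s with h | h <;> rw [h]
        · exact ⟨by linarith [(mi _ yi).1.1], by linarith [(mi _ yi).2.2]⟩
        · exact ⟨by linarith [(mi _ si).1.1], by linarith [(mi _ si).2.2]⟩
      · rcases min_choice (y j) t with h | h <;> rw [h]
        · exact ⟨by linarith [(mj _ yj).1.1], by linarith [(mj _ yj).2.2]⟩
        · exact ⟨by linarith [(mj _ tj).1.1], by linarith [(mj _ tj).2.2]⟩
    have hq : ∀ k, q k ∈ Ioo (l k) (u k) := by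
      refine update_mem_box (update_mem_box (fun k => ?_) ?_) ?_
      · have := hy k
        by_cases hki : k = i
        · subst hki
          exact ⟨by linarith [this.1], by linarith [(mi _ yi).2.2]⟩
        · by_cases hkj : k = j
          · subst hkj
            exact ⟨by linarith [this.1], by linarith [(mj _ yj).2.2]⟩
          · have := (hm _ yi _ yj k)
            rw [ck _ _ _ hki hkj] at this
            exact ⟨by linarith [this.1.1], by linarith [this.2.2]⟩
      · rcases max_choice (y i) s with h | h <;> rw [h]
        · exact ⟨by linarith [(mi _ yi).1.1], by linarith [(mi _ yi).2.2]⟩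
        · exact ⟨by linarith [(mi _ si).1.1], by linarith [(mi _ si).2.2]⟩
      · rcases max_choice (y j) t with h | h <;> rw [h]
        · exact ⟨by linarith [(mj _ yj).1.1], by linarith [(mj _ yj).2.2]⟩
        · exact ⟨by linarith [(mj _ tj).1.1], by linarith [(mj _ tj).2.2]⟩
    have hpq : ∀ k, p k < q k := by
      intro k
      by_cases hkj : k = j
      · subst hkj
        rw [pj, qj]
        linarith [min_le_left (y k) t, le_max_left (y k) t]
      · by_cases hki : k = i
        · subst hki
          rw [pi, qi]
          linarith [min_le_left (y k) s, le_max_left (y k) s]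
        · simp only [p, q, Function.update_of_ne hkj, Function.update_of_ne hki]
          linarith
    obtain ⟨hrect, hbis⟩ := h.isBisectionRect hg hg0 hij hp hq hpq
    have hcell : ∀ x z : ℝ, cellVol g (fun k => c x z k - δ) (fun k => c x z k + δ) =
        cellVol g (Function.update (Function.update p i (x - δ)) j (z - δ))
          (Function.update (Function.update q i (x + δ)) j (z + δ)) := by
      intro x z
      congr 1 <;> ext k
      · by_cases hkj : k = j
        · subst hkj; rw [cj, Function.update_self]
        · by_cases hki : k = i
          · subst hki; rw [ci, Function.update_of_ne hkj, Function.update_self]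
          · rw [ck _ _ _ hki hkj]; simp [p, hki, hkj]
      · by_cases hkj : k = j
        · subst hkj; rw [cj, Function.update_self]
        · by_cases hki : k = i
          · subst hki; rw [ci, Function.update_of_ne hkj, Function.update_self]
          · rw [ck _ _ _ hki hkj]; simp [q, hki, hkj]
    have xi : ∀ x ∈ ({y i, s} : Set ℝ), x - δ ∈ Icc (p i) (q i) ∧ x + δ ∈ Icc (p i) (q i) := by
      rw [pi, qi]
      rintro x (rfl | rfl)
      · have := min_le_left (y i) s
        have := le_max_left (y i) s
        exact ⟨⟨by linarith, by linarith⟩, ⟨by linarith, by linarith⟩⟩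
      · have := min_le_right (y i) x
        have := le_max_right (y i) x
        exact ⟨⟨by linarith, by linarith⟩, ⟨by linarith, by linarith⟩⟩
    have zj : ∀ z ∈ ({y j, t} : Set ℝ), z - δ ∈ Icc (p j) (q j) ∧ z + δ ∈ Icc (p j) (q j) := by
      rw [pj, qj]
      rintro z (rfl | rfl)
      · have := min_le_left (y j) t
        have := le_max_left (y j) t
        exact ⟨⟨by linarith, by linarith⟩, ⟨by linarith, by linarith⟩⟩
      · have := min_le_right (y j) z
        have := le_max_right (y j) z
        exact ⟨⟨by linarith, by linarith⟩, ⟨by linarith, by linarith⟩⟩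
    have hR : ∀ x ∈ ({y i, s} : Set ℝ), ∀ z ∈ ({y j, t} : Set ℝ), ∀ ξ : Euc n,
        cellVol g (fun k => c x z k - δ) (fun k => c x z k + δ) = g ξ * (2 * δ) ^ n →
        rectIncr (fun x z => cellVol g p (Function.update (Function.update q i x) j z))
          (x - δ) (x + δ) (z - δ) (z + δ) = g ξ * (2 * δ) ^ n := by
      intro x hx z hz ξ hξ
      rw [hrect _ (xi x hx).1 _ (xi x hx).2 (by linarith) _ (zj z hz).1 _ (zj z hz).2
        (by linarith), ← hcell, hξ]
    have hfin := hbis.mul_eq_mul (hpq i) (hpq j) (xi _ yi).1 (xi _ yi).2 (xi _ si).1 (xi _ si).2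
      (zj _ yj).1 (zj _ yj).2 (zj _ tj).1 (zj _ tj).2
    rw [hR _ yi _ yj _ v1, hR _ si _ tj _ v2, hR _ yi _ tj _ v3, hR _ si _ yj _ v4] at hfin
    have hne : (2 * δ) ^ n * (2 * δ) ^ n ≠ 0 := by positivity
    refine mul_right_cancel₀ hne ?_
    linear_combination hfin
  have hδm : ∀ m : ℕ, 0 < δ₀ / ((m : ℝ) + 1) ∧ δ₀ / ((m : ℝ) + 1) ≤ δ₀ := fun m =>
    ⟨by positivity, div_le_self hδ₀.le (by linarith [(Nat.cast_nonneg m : (0 : ℝ) ≤ m)])⟩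
  choose p₁ p₂ p₃ p₄ h1 h2 h3 h4 hmul using fun m => key _ (hδm m).1 (hδm m).2
  have lim : ∀ {ξ : ℕ → Euc n} {x z : ℝ}, x ∈ Ioo (l i) (u i) → z ∈ Ioo (l j) (u j) →
      (∀ m k, |ξ m k - c x z k| ≤ δ₀ / ((m : ℝ) + 1)) →
      Tendsto (fun m => g (ξ m)) atTop (𝓝 (g (c x z))) := fun hx hz hξ =>
    (hg.continuousAt (hOo.mem_nhds (hc _ hx _ hz))).tendsto.comp
      (tendsto_of_forall_abs_sub_le hξ)
  have l1 := (lim (hy i) (hy j) h1).mul (lim hs ht h2)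
  have l2 := (lim (hy i) ht h3).mul (lim hs (hy j) h4)
  have := tendsto_nhds_unique l1 (l2.congr fun m => (hmul m).symm)
  have c1 : c (y i) (y j) = y := by simp [c]
  have c2 : c (y i) t = setCoord y j t := by simp [c]
  have c3 : c s (y j) = setCoord y i s := by
    have : y j = setCoord y i s j := (setCoord_of_ne y hij.symm s).symm
    change setCoord (setCoord y i s) j (y j) = _
    rw [this, setCoord_eq_self]
  rw [c1, c2, c3] at this
  rw [this, mul_comm]

end

/-! ### Mixed partial derivatives and double differences -/

section

variable {n : ℕ}

/-- Rolle's theorem between two different points in either order. -/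
theorem exists_hasDerivAt_eq_zero_of_ne {f f' : ℝ → ℝ} {s t : ℝ} (hst : s ≠ t)
    (hf : ∀ x ∈ uIcc s t, HasDerivAt f (f' x) x) (h : f s = f t) : ∃ c ∈ uIcc s t, f' c = 0 := by
  wlog hlt : s < t generalizing s t
  · rw [uIcc_comm] at hf ⊢
    exact this hst.symm hf h.symm (lt_of_le_of_ne (not_lt.1 hlt) hst.symm)
  rw [uIcc_of_le hlt.le] at hf ⊢
  obtain ⟨c, hc, hc'⟩ := exists_hasDerivAt_eq_zero hlt
    (fun x hx => (hf x hx).continuousAt.continuousWithinAt) h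
    fun x hx => hf x (Ioo_subset_Icc_self hx)
  exact ⟨c, Ioo_subset_Icc_self hc, hc'⟩

theorem abs_sub_lt_of_mem_uIcc {a ε s t x : ℝ} (hs : |s - a| < ε) (ht : |t - a| < ε)
    (hx : x ∈ uIcc s t) : |x - a| < ε := by
  rw [abs_lt] at *
  rcases mem_uIcc.1 hx with h | h <;> constructor <;> linarith

/-- A mixed second derivative vanishes at a point which is a limit of nondegenerate coordinate
rectangles over which the double difference of the function vanishes. -/
theorem fderiv_fderiv_eq_zero_of_double_difference {L : Euc n → ℝ} {O : Set (Euc n)}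
    (hO : IsOpen O) (hL : ContDiffOn ℝ ∞ L O) {y₀ : Euc n} (hy₀ : y₀ ∈ O) {i j : Fin n}
    (hij : i ≠ j) (h : ∀ ε > 0, ∃ y : Euc n, ∃ s t : ℝ, (∀ k, |y k - y₀ k| < ε) ∧
      |s - y₀ i| < ε ∧ |t - y₀ j| < ε ∧ y i ≠ s ∧ y j ≠ t ∧
      L (setCoord (setCoord y i s) j t) - L (setCoord y i s) = L (setCoord y j t) - L y) :
    fderiv ℝ (fun z => fderiv ℝ L z (stdVec i)) y₀ (stdVec j) = 0 := by
  set D : Euc n → ℝ := fun w => fderiv ℝ (fun z => fderiv ℝ L z (stdVec i)) w (stdVec j) with hD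
  have hL1 : ContDiffOn ℝ ∞ (fun z => fderiv ℝ L z (stdVec i)) O := hL.fderiv_apply_const hO _
  have hDc : ContinuousAt D y₀ :=
    (hL1.fderiv_apply_const hO (stdVec j)).continuousOn.continuousAt (hO.mem_nhds hy₀)
  by_contra hne
  obtain ⟨ε, hε, hcube⟩ := exists_cube_subset
    (inter_mem (hO.mem_nhds hy₀) (hDc.eventually_ne hne))
  obtain ⟨y, s, t, hy, hs, ht, hsy, hty, heq⟩ := h ε hε
  have hd : ∀ {f : Euc n → ℝ} (_ : ContDiffOn ℝ ∞ f O) (y : Euc n) (k : Fin n) (r : ℝ),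
      setCoord y k r ∈ O → HasDerivAt (fun r => f (setCoord y k r))
        (fderiv ℝ f (setCoord y k r) (stdVec k)) r := fun hf y k r hr =>
    (hf.differentiableAt_of_isOpen hO hr).hasFDerivAt.comp_hasDerivAt r (hasDerivAt_setCoord y k r)
  have hmem : ∀ y : Euc n, (∀ k, |y k - y₀ k| < ε) → ∀ (k : Fin n) (r : ℝ), |r - y₀ k| < ε →
      ∀ m, |setCoord y k r m - y₀ m| < ε := by
    intro y hy k r hr m
    by_cases hm : m = k
    · subst hm; rwa [setCoord_self]
    · rw [setCoord_of_ne y hm]; exact hy m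
  have hswap : ∀ r, setCoord (setCoord y i r) j t = setCoord (setCoord y j t) i r := fun r => by
    change (WithLp.toLp 2 (Function.update (Function.update y.ofLp i r) j t) : Euc n) =
      WithLp.toLp 2 (Function.update (Function.update y.ofLp j t) i r)
    rw [Function.update_comm hij]
  obtain ⟨r, hr, hr0⟩ := exists_hasDerivAt_eq_zero_of_ne hsy
    (f := fun r => L (setCoord (setCoord y j t) i r) - L (setCoord y i r))
    (f' := fun r => fderiv ℝ L (setCoord (setCoord y j t) i r) (stdVec i) -
      fderiv ℝ L (setCoord y i r) (stdVec i))
    (fun r hr => by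
      have hr' := abs_sub_lt_of_mem_uIcc (hy i) hs hr
      exact (hd hL _ _ _ (hcube _ (hmem _ (hmem y hy j t ht) i r hr')).1).sub
        (hd hL _ _ _ (hcube _ (hmem y hy i r hr')).1))
    (by
      simp only [← hswap, setCoord_eq_self]
      linarith)
  have hr' := abs_sub_lt_of_mem_uIcc (hy i) hs hr
  have hy' := hmem y hy i r hr'
  obtain ⟨q, hq, hq0⟩ := exists_hasDerivAt_eq_zero_of_ne hty
    (f := fun q => fderiv ℝ L (setCoord (setCoord y i r) j q) (stdVec i))
    (f' := fun q => D (setCoord (setCoord y i r) j q))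
    (fun q hq => hd hL1 _ _ _
      (hcube _ (hmem _ hy' j q (abs_sub_lt_of_mem_uIcc (hy j) ht hq))).1)
    (by
      rw [← hswap] at hr0
      have : setCoord (setCoord y i r) j (y j) = setCoord y i r := by
        rw [show y j = setCoord y i r j from (setCoord_of_ne y hij.symm r).symm, setCoord_eq_self]
      rw [this]
      linarith)
  exact (hcube _ (hmem _ hy' j q (abs_sub_lt_of_mem_uIcc (hy j) ht hq))).2 hq0

theorem exists_abs_sub_lt_of_ne {l u x ε : ℝ} (hx : x ∈ Ioo l u) (hε : 0 < ε) :
    ∃ s ∈ Ioo l u, |s - x| < ε ∧ x ≠ s := by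
  obtain ⟨s, h1, h2⟩ := exists_between (lt_min hx.2 (show x < x + ε by linarith))
  refine ⟨s, ⟨hx.1.trans h1, h2.trans_le (min_le_left _ _)⟩, ?_, h1.ne⟩
  rw [abs_of_pos (sub_pos.2 h1)]
  linarith [h2.trans_le (min_le_right _ _)]

variable {M : Type*} [TopologicalSpace M] [ChartedSpace (Euc n) M] {W : DivergenceFreeWeb n M}

theorem DivergenceFreeWeb.mixedPartialsVanish_of_bisectionCompatible
    (h : ∀ e, W.IsAdaptedChart e → ∀ l u : Fin n → ℝ,
      e.target = {y | ∀ k, y k ∈ Ioo (l k) (u k)} →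
      BisectionCompatible (fun y => |W.density e y|) l u) : W.MixedPartialsVanish := by
  intro e he i j hij y hy
  obtain ⟨l, u, hlu⟩ := he.2.1
  refine fderiv_fderiv_eq_zero_of_double_difference e.open_target
    (W.contDiffOn_log_density he.1) hy hij.symm fun ε hε => ?_
  have hy' : ∀ k, y k ∈ Ioo (l k) (u k) := by rw [hlu] at hy; exact hy
  obtain ⟨s, hs, hsε, hsne⟩ := exists_abs_sub_lt_of_ne (hy' j) hε
  obtain ⟨t, ht, htε, htne⟩ := exists_abs_sub_lt_of_ne (hy' i) hε
  refine ⟨y, s, t, fun k => by simpa using hε, hsε, htε, hsne, htne, ?_⟩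
  have hmul := (h e he l u hlu).mul_eq_mul (hlu ▸ W.continuousOn_abs_density he)
    (fun y hy => W.abs_density_pos he (hlu ▸ hy)) hij.symm hy' hs ht
  have h0 : ∀ z : Euc n, (∀ k, z k ∈ Ioo (l k) (u k)) → W.density e z ≠ 0 := fun z hz =>
    W.density_ne_zero he.1 (hlu ▸ hz)
  have hys : ∀ k, setCoord y j s k ∈ Ioo (l k) (u k) := update_mem_box hy' hs
  have hyt : ∀ k, setCoord y i t k ∈ Ioo (l k) (u k) := update_mem_box hy' ht
  have hyst : ∀ k, setCoord (setCoord y j s) i t k ∈ Ioo (l k) (u k) := update_mem_box hys ht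
  have hlog := congrArg Real.log hmul
  simp only [← abs_mul, Real.log_abs] at hlog
  rw [Real.log_mul (h0 _ hy') (h0 _ hyst), Real.log_mul (h0 _ hys) (h0 _ hyt)] at hlog
  linarith

end

theorem DivergenceFreeWeb.vol_nonneg {n : ℕ} {M : Type*} [TopologicalSpace M]
    [ChartedSpace (Euc n) M] (W : DivergenceFreeWeb n M) (C : Set M) : 0 ≤ W.vol C := by
  unfold DivergenceFreeWeb.vol
  split_ifs
  exacts [abs_nonneg _, le_rfl]

/-! ### Local triviality -/

section

variable {n : ℕ} {M : Type*} [TopologicalSpace M] [ChartedSpace (Euc n) M]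
variable {W : DivergenceFreeWeb n M}

/-- In the coordinates of a local equivalence with the standard web, up to a permutation, the
density is constant. -/
theorem DivergenceFreeWeb.IsLocallyTrivial.mixedPartialsVanish [IsManifold (𝓡 n) ∞ M]
    (h : W.IsLocallyTrivial) :
    W.MixedPartialsVanish := by
  refine mixedPartialsVanish_of_exists fun p => ?_
  obtain ⟨e, hp, hsm, -, ⟨σ, hσ⟩, hΩ⟩ := h p
  let L : Euc n ≃L[ℝ] Euc n :=
    (LinearIsometryEquiv.piLpCongrLeft 2 ℝ ℝ σ.symm).toContinuousLinearEquiv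
  have hL : ∀ (v : Euc n) (i : Fin n), L v i = v (σ i) := fun v i => by
    simp [L, LinearIsometryEquiv.piLpCongrLeft_apply, Equiv.piCongrLeft'_apply]
  have hLsm : ContMDiffOn (𝓡 n) (𝓡 n) ∞ (L ∘ e) e.source :=
    L.contDiff.contMDiff.comp_contMDiffOn hsm
  have hed : ∀ x ∈ e.source, MDifferentiableAt (𝓡 n) (𝓡 n) e x := fun x hx =>
    (hsm.contMDiffAt (e.open_source.mem_nhds hx)).mdifferentiableAt (by simp)
  obtain ⟨e', he', hpe', hse', heq⟩ := W.exists_adaptedChart_of_map e.open_source hLsm (by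
    intro x hx i v
    have h1 : mfderiv (𝓡 n) (𝓡 n) (L ∘ e) x v = L (mfderiv (𝓡 n) (𝓡 n) e x v) := by
      have := (L.hasMFDerivAt (x := e x)).comp x (hed x hx).hasMFDerivAt
      rw [this.mfderiv]
      rfl
    rw [hσ x hx i v, h1]
    exact iff_of_eq (congrArg (· = (0 : ℝ)) (hL (mfderiv (𝓡 n) (𝓡 n) e x v) i)).symm) hp
  refine ⟨e', he', hpe', fun i j _ => ?_⟩
  have hconst : ∀ y ∈ e'.target, W.density e' y =
      (EuclideanSpace.basisFun (Fin n) ℝ).toBasis.det fun i => L.symm (stdVec i) := by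
    intro y hy
    have hx' := e'.map_target hy
    have hx := hse' hx'
    have h1 := hΩ _ hx fun i => mfderiv (𝓡 n) (𝓡 n) e'.symm y (stdVec i)
    unfold density
    rw [← h1]
    change (EuclideanSpace.basisFun (Fin n) ℝ).toBasis.det _ = _
    congr 1
    ext1 i
    have h2 : e ∘ e'.symm =ᶠ[𝓝 y] L.symm := by
      filter_upwards [e'.open_target.mem_nhds hy] with z hz
      have := heq (e'.map_target hz)
      rw [e'.right_inv hz] at this
      exact (L.symm_apply_apply (e (e'.symm z))).symm.trans (congrArg L.symm this.symm)
    have h3 : MDifferentiableAt (𝓡 n) (𝓡 n) e'.symm y :=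
      (mdifferentiable_of_mem_maximalAtlas he'.1).mdifferentiableAt_symm hy
    have h4 := ((hed _ hx).hasMFDerivAt.comp y h3.hasMFDerivAt).congr_of_eventuallyEq h2.symm
    have h5 := hasMFDerivAt_unique h4 (L.symm.hasMFDerivAt (x := y))
    exact DFunLike.congr_fun h5 (stdVec i)
  have hnhds := e'.open_target.mem_nhds (e'.map_source hpe')
  unfold logDensityPartial
  have h1 : (fun z => fderiv ℝ (fun z' => Real.log (W.density e' z')) z (stdVec j)) =ᶠ[𝓝 (e' p)]
      fun _ => 0 := by
    filter_upwards [hnhds] with z hz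
    have h2 : (fun z' => Real.log (W.density e' z')) =ᶠ[𝓝 z] fun _ => Real.log
        ((EuclideanSpace.basisFun (Fin n) ℝ).toBasis.det fun i => L.symm (stdVec i)) := by
      filter_upwards [e'.open_target.mem_nhds hz] with w hw
      rw [hconst w hw]
    rw [h2.fderiv_eq]
    simp
  rw [h1.fderiv_eq]
  simp

theorem hasDerivAt_primitive {γ : ℝ → ℝ} {l u : ℝ} (hγ : ContinuousOn γ (Ioo l u)) {c t : ℝ}
    (hc : c ∈ Ioo l u) (ht : t ∈ Ioo l u) :
    HasDerivAt (fun t => ∫ x in c..t, γ x) (γ t) t := by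
  have hsub : uIcc c t ⊆ Ioo l u := ordConnected_Ioo.uIcc_subset hc ht
  exact intervalIntegral.integral_hasDerivAt_right (hγ.mono hsub).intervalIntegrable
    (hγ.stronglyMeasurableAtFilter isOpen_Ioo t ht) (hγ.continuousAt (isOpen_Ioo.mem_nhds ht))

theorem contDiffOn_primitive {γ : ℝ → ℝ} {l u : ℝ} (hγ : ContDiffOn ℝ ∞ γ (Ioo l u)) {c : ℝ}
    (hc : c ∈ Ioo l u) : ContDiffOn ℝ ∞ (fun t => ∫ x in c..t, γ x) (Ioo l u) := by
  refine (contDiffOn_infty_iff_deriv_of_isOpen isOpen_Ioo).2 ⟨fun t ht =>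
    (hasDerivAt_primitive hγ.continuousOn hc ht).differentiableAt.differentiableWithinAt, ?_⟩
  exact hγ.congr fun t ht => (hasDerivAt_primitive hγ.continuousOn hc ht).deriv

/-- An adapted chart with density `1` is a local equivalence with the standard web. -/
theorem DivergenceFreeWeb.isLocalEquivalence_of_density_eq_one
    {e : OpenPartialHomeomorph M (Euc n)} (he : W.IsAdaptedChart e)
    (h : ∀ y ∈ e.target, W.density e y = 1) : W.IsLocalEquivalence (standardWeb n) e := by
  refine ⟨contMDiffOn_of_mem_maximalAtlas he.1, contMDiffOn_symm_of_mem_maximalAtlas he.1,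
    ⟨Equiv.refl _, fun x hx i v => he.mem_tangent_iff hx i v⟩, fun x hx v => ?_⟩
  let b := (EuclideanSpace.basisFun (Fin n) ℝ).toBasis
  let A : (Euc n) [⋀^Fin n]→ₗ[ℝ] ℝ :=
    (W.Ω.form x).compLinearMap (mfderiv (𝓡 n) (𝓡 n) e.symm (e x)).toLinearMap
  have h1 := A.eq_smul_basis_det b
  have hb : (⇑b : Fin n → Euc n) = stdVec := by
    ext i j
    simp [b, stdVec]
  have h2 : A b = 1 := by
    have h3 := h (e x) (e.map_source hx)
    unfold density at h3
    rw [e.left_inv hx] at h3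
    rw [hb]
    exact h3
  rw [h2, one_smul] at h1
  change b.det (fun i => mfderiv (𝓡 n) (𝓡 n) e x (v i)) = W.Ω.form x v
  rw [← h1]
  change W.Ω.form x (fun i => mfderiv (𝓡 n) (𝓡 n) e.symm (e x) (mfderiv (𝓡 n) (𝓡 n) e x (v i))) = _
  congr 1
  ext1 i
  exact DFunLike.congr_fun ((mdifferentiable_of_mem_maximalAtlas he.1).symm_comp_deriv hx) (v i)

/-- A product density becomes constant after replacing each coordinate by a primitive of
the corresponding factor. -/
theorem DivergenceFreeWeb.MixedPartialsVanish.isLocallyTrivial [IsManifold (𝓡 n) ∞ M]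
    (hn : 1 ≤ n) (hP : W.MixedPartialsVanish) : W.IsLocallyTrivial := by
  intro p
  obtain ⟨e, he, hp, -⟩ := W.exists_adaptedChart p
  obtain ⟨l, u, hlu⟩ := he.2.1
  set y₀ := e p with hy₀def
  have hy₀ : y₀ ∈ e.target := e.map_source hp
  have hmem : ∀ x ∈ e.source, ∀ k, e x k ∈ Ioo (l k) (u k) := fun x hx => by
    have := e.map_source hx
    rwa [hlu] at this
  let ρ : Fin n → ℝ → ℝ := fun k t => W.density e (setCoord y₀ k t) / W.density e y₀
  have hset : ∀ k, ∀ t ∈ Ioo (l k) (u k), setCoord y₀ k t ∈ e.target := fun k t ht => by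
    rw [hlu]; exact update_mem_box (hmem p hp) ht
  have hρ0 : ∀ k, ∀ t ∈ Ioo (l k) (u k), ρ k t ≠ 0 := fun k t ht =>
    (density_div_pos he (hset k t ht) hy₀).ne'
  have hsetsm : ∀ k, ContDiff ℝ ∞ (setCoord y₀ k) := fun k => by
    rw [show setCoord y₀ k = fun t => y₀ + (t - y₀ k) • stdVec k from funext (setCoord_eq_add y₀ k)]
    fun_prop
  have hρ : ∀ k, ContDiffOn ℝ ∞ (ρ k) (Ioo (l k) (u k)) := fun k =>
    ((W.contDiffOn_density he.1).comp (hsetsm k).contDiffOn (hset k)).div_const _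
  -- the constant factor is put into one of the coordinates
  let m : Fin n → ℝ := fun k => if k = ⟨0, hn⟩ then W.density e y₀ else 1
  have hm0 : ∀ k, m k ≠ 0 := fun k => by
    simp only [m]
    split_ifs
    exacts [W.density_ne_zero he.1 hy₀, one_ne_zero]
  have hm : ∏ k, m k = W.density e y₀ := by simp [m]
  let ψ : Fin n → ℝ → ℝ := fun k t => m k * ∫ x in (y₀ k)..t, ρ k x
  have hψ : ∀ k, ContDiffOn ℝ ∞ (ψ k) (Ioo (l k) (u k)) := fun k =>
    contDiffOn_const.mul (contDiffOn_primitive (hρ k) (hmem p hp k))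
  have hψd : ∀ k, ∀ t ∈ Ioo (l k) (u k), HasDerivAt (ψ k) (m k * ρ k t) t := fun k t ht =>
    (hasDerivAt_primitive (hρ k).continuousOn (hmem p hp k) ht).const_mul _
  have hesm : ContMDiffOn (𝓡 n) (𝓡 n) ∞ e e.source := contMDiffOn_of_mem_maximalAtlas he.1
  have hcoord : ∀ k, ContMDiffOn (𝓡 n) 𝓘(ℝ, ℝ) ∞ (fun x => e x k) e.source := fun k =>
    (stdCoord k).contDiff.contMDiff.comp_contMDiffOn hesm
  have hfsm := contMDiffOn_toEuc (f := fun k x => ψ k (e x k)) (U := e.source) fun k =>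
    (hψ k).contMDiffOn.comp (hcoord k) fun x hx => hmem x hx k
  obtain ⟨e', he', hpe', hse', heq⟩ := W.exists_adaptedChart_of_map e.open_source hfsm (by
    intro x hx i v
    have hed := (hesm.contMDiffAt (e.open_source.mem_nhds hx)).mdifferentiableAt (by simp)
    rw [he.mem_tangent_iff hx, stdCoord_mfderiv hed, stdCoord_mfderiv
      ((hfsm.contMDiffAt (e.open_source.mem_nhds hx)).mdifferentiableAt (by simp))]
    have h1 : MDifferentiableAt (𝓡 n) 𝓘(ℝ, ℝ) (fun x => e x i) x :=
      ((hcoord i).contMDiffAt (e.open_source.mem_nhds hx)).mdifferentiableAt (by simp)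
    have h2 := ((hψd i _ (hmem x hx i)).hasFDerivAt.hasMFDerivAt).comp x h1.hasMFDerivAt
    obtain ⟨r, hr⟩ : ∃ r : ℝ, r = mfderiv (𝓡 n) 𝓘(ℝ, ℝ) (fun x => e x i) x v := ⟨_, rfl⟩
    have h3 : mfderiv (𝓡 n) 𝓘(ℝ, ℝ) (fun z => ψ i (e z i)) x v = r * (m i * ρ i (e x i)) := by
      rw [hr]
      exact DFunLike.congr_fun h2.mfderiv v
    have h4 : r = 0 ↔ r * (m i * ρ i (e x i)) = 0 :=
      (mul_eq_zero_iff_right (mul_ne_zero (hm0 i) (hρ0 i _ (hmem x hx i)))).symm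
    rw [← h3, hr] at h4
    exact h4) hp
  refine ⟨e', hpe', isLocalEquivalence_of_density_eq_one he' fun z hz => ?_⟩
  have hx' := e'.map_target hz
  set x := e'.symm z with hxdef
  have hx := hse' hx'
  have hy := e.map_source hx
  have hxy : e.symm (e x) = x := e.left_inv hx
  have h1 := W.density_transition he.1 he'.1 hy (by rw [hxy]; exact hx')
  rw [he.det_fderiv_transition he' hy (by rw [hxy]; exact hx'), hxy, hxdef, e'.right_inv hz,
    ← hxdef] at h1
  have h2 : ∀ k, (fderiv ℝ (e' ∘ e.symm) (e x) (stdVec k)) k = m k * ρ k (e x k) := by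
    intro k
    have h3 : e' ∘ e.symm =ᶠ[𝓝 (e x)] fun y => (WithLp.toLp 2 fun k => ψ k (y k) : Euc n) := by
      have : e.symm ⁻¹' e'.source ∈ 𝓝 (e x) :=
        (e.continuousAt_symm hy).preimage_mem_nhds (by
          rw [hxy]; exact e'.open_source.mem_nhds hx')
      filter_upwards [this, e.open_target.mem_nhds hy] with w hw hw'
      have := heq hw
      simp only [e.right_inv hw'] at this
      exact this
    have h4 : DifferentiableAt ℝ (e' ∘ e.symm) (e x) :=
      (contDiffOn_transition he.1 he'.1).contDiffAt ((e.isOpen_inter_preimage_symm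
        e'.open_source).mem_nhds ⟨hy, by rw [mem_preimage, hxy]; exact hx'⟩)
        |>.differentiableAt (by simp)
    have h5 := ((stdCoord k).hasFDerivAt.comp (e x) h4.hasFDerivAt).congr_of_eventuallyEq
      (f₁ := fun y : Euc n => ψ k (y k)) (h3.symm.fun_comp (stdCoord k))
    have h6 := (hψd k _ (hmem x hx k)).hasFDerivAt.comp (e x) (stdCoord k).hasFDerivAt
    have h7 := DFunLike.congr_fun (h5.unique h6) (stdVec k)
    simpa using h7
  rw [Finset.prod_congr rfl fun k _ => h2 k, Finset.prod_mul_distrib, hm,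
    ← hP.density_eq he hy hy₀] at h1
  exact (mul_eq_left₀ (W.density_ne_zero he.1 hy)).1 h1.symm

end

/-! ### Reflections in a web with product density -/

section

open MeasureTheory

variable {n : ℕ}

/-- Two boxes with the vertex `0` which form together a box and meet only in the hyperplane
`xᵢ = 0` are spanned by points which differ only in the sign and the size of their `i`-th
coordinate. -/
theorem coordBox_reflection {y y' : Euc n} {i : Fin n} {a b : Fin n → ℝ} (hy : ∀ k, y k ≠ 0)
    (hy' : ∀ k, y' k ≠ 0)
    (hU : coordBox (0 : Euc n) y ∪ coordBox (0 : Euc n) y' = coordBox a b)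
    (hI : coordBox (0 : Euc n) y ∩ coordBox (0 : Euc n) y' ⊆ {z | z i = 0}) :
    y i * y' i < 0 ∧ ∀ j, j ≠ i → y' j = y j := by
  have hneg : y i * y' i < 0 := by
    refine lt_of_le_of_ne (le_of_not_gt fun hpos => ?_) (mul_ne_zero (hy i) (hy' i))
    have key : ∃ r : ℝ, r ≠ 0 ∧ r ∈ uIcc 0 (y i) ∧ r ∈ uIcc 0 (y' i) := by
      rcases pos_and_pos_or_neg_and_neg_of_mul_pos hpos with ⟨h1, h2⟩ | ⟨h1, h2⟩
      · refine ⟨min (y i) (y' i), (lt_min h1 h2).ne', ?_, ?_⟩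
        · rw [uIcc_of_le h1.le]; exact ⟨(lt_min h1 h2).le, min_le_left _ _⟩
        · rw [uIcc_of_le h2.le]; exact ⟨(lt_min h1 h2).le, min_le_right _ _⟩
      · refine ⟨max (y i) (y' i), (max_lt h1 h2).ne, ?_, ?_⟩
        · rw [uIcc_of_ge h1.le]; exact ⟨le_max_left _ _, (max_lt h1 h2).le⟩
        · rw [uIcc_of_ge h2.le]; exact ⟨le_max_right _ _, (max_lt h1 h2).le⟩
    obtain ⟨r, hr0, hr, hr'⟩ := key
    have hmem : ∀ w : Euc n, r ∈ uIcc 0 (w i) → setCoord 0 i r ∈ coordBox (0 : Euc n) w := by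
      intro w hw k
      by_cases hk : k = i
      · subst hk; rw [setCoord_self]; exact hw
      · rw [setCoord_of_ne _ hk]; exact left_mem_uIcc
    have : setCoord (0 : Euc n) i r i = 0 := hI ⟨hmem y hr, hmem y' hr'⟩
    rw [setCoord_self] at this
    exact hr0 this
  -- a vertex of one box cannot be moved into the other one
  have hvert : ∀ w w' : Euc n, w i * w' i < 0 →
      coordBox (0 : Euc n) w ∪ coordBox (0 : Euc n) w' = coordBox a b →
      ∀ j, j ≠ i → w' j ∈ uIcc 0 (w j) := by
    intro w w' hww hU j hj
    have h1 : w ∈ coordBox a b := hU ▸ Or.inl (right_mem_coordBox (0 : Euc n) w)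
    have h2 : w' ∈ coordBox a b := hU ▸ Or.inr (right_mem_coordBox (0 : Euc n) w')
    have h3 : setCoord w j (w' j) ∈ coordBox a b := by
      intro k
      by_cases hk : k = j
      · subst hk; rw [setCoord_self]; exact h2 k
      · rw [setCoord_of_ne _ hk]; exact h1 k
    rw [← hU] at h3
    rcases h3 with h3 | h3
    · have := h3 j
      rwa [setCoord_self] at this
    · have := h3 i
      rw [setCoord_of_ne _ hj.symm, mem_uIcc] at this
      have h0 : (0 : Euc n).ofLp i = 0 := rfl
      rw [h0] at this
      exfalso
      rcases this with h | h
      · exact hww.not_ge (mul_nonneg h.1 (h.1.trans h.2))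
      · exact hww.not_ge (mul_nonneg_of_nonpos_of_nonpos h.2 (h.1.trans h.2))
  refine ⟨hneg, fun j hj => ?_⟩
  have h1 := hvert y y' hneg hU j hj
  have h2 := hvert y' y (by rwa [mul_comm]) (by rwa [union_comm]) j hj
  rw [mem_uIcc] at h1 h2
  rcases h1 with h1 | h1 <;> rcases h2 with h2 | h2 <;> linarith

theorem dense_off_axes (n : ℕ) : Dense {y : Euc n | ∀ k, y k ≠ 0} := by
  refine Measure.dense_of_ae (μ := volume) ?_
  rw [ae_all_iff]
  exact fun k => measure_mono_null (fun y hy => not_not.1 hy) (volume_hyperplane k 0)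

end

section

open MeasureTheory

variable {n : ℕ} {M : Type*} [TopologicalSpace M] {e : OpenPartialHomeomorph M (Euc n)}

theorem eventually_chartBox_subset {p : M} (hp : p ∈ e.source) {U : Set M} (hU : U ∈ 𝓝 p) :
    ∀ᶠ q in 𝓝 p, chartBox e p q ⊆ U := by
  have hV : e.target ∩ e.symm ⁻¹' U ∈ 𝓝 (e p) :=
    inter_mem (e.open_target.mem_nhds (e.map_source hp))
      ((e.continuousAt_symm (e.map_source hp)).preimage_mem_nhds (by rwa [e.left_inv hp]))
  obtain ⟨ε, hε, hcube⟩ := exists_cube_subset hV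
  have h1 : ∀ᶠ q in 𝓝 p, ∀ k, |e q k - e p k| < ε := by
    refine eventually_all.2 fun k => ?_
    have : ContinuousAt (fun q => |e q k - e p k|) p := by
      have := (stdCoord k).continuous.continuousAt.comp (e.continuousAt hp)
      exact (this.sub continuousAt_const).abs
    exact this.eventually_lt continuousAt_const (by simpa using hε)
  filter_upwards [h1] with q hq x hx
  have h2 := (hcube (e x) fun k => abs_sub_lt_of_mem_uIcc (by simpa using hε) (hq k) (hx.2 k)).2
  rwa [mem_preimage, e.left_inv hx.1] at h2

theorem frequently_off_axes {x : M} (hx : x ∈ e.source) : ∃ᶠ q in 𝓝 x, ∀ k, e q k ≠ 0 := by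
  rw [frequently_iff]
  intro U hU
  have hV : e.target ∩ e.symm ⁻¹' U ∈ 𝓝 (e x) :=
    inter_mem (e.open_target.mem_nhds (e.map_source hx))
      ((e.continuousAt_symm (e.map_source hx)).preimage_mem_nhds (by rwa [e.left_inv hx]))
  obtain ⟨y, hy, hy0⟩ := (dense_off_axes n).inter_nhds_nonempty hV
  exact ⟨e.symm y, hy0.2, by rwa [e.right_inv hy0.1]⟩

variable [ChartedSpace (Euc n) M] {W : DivergenceFreeWeb n M}

/-- A volume-preserving reflection, in the coordinates of a centred adapted chart: it changes only
the sign and the size of the `i`-th coordinate, and preserves the integral of the `i`-th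
factor of the density. -/
theorem DivergenceFreeWeb.IsReflection.eventually_coords [IsManifold (𝓡 n) ∞ M]
    [SecondCountableTopology M] {p : M} {i : Fin n} {r : M → M} (hr : W.IsReflection i p r)
    (he : W.IsAdaptedChart e) (hp : p ∈ e.source) (hp0 : e p = 0) {l u : Fin n → ℝ}
    (hlu : e.target = {y | ∀ k, y k ∈ Ioo (l k) (u k)}) {κ : ℝ} {γ : Fin n → ℝ → ℝ}
    (hprod : IsProductDensity (fun y => |W.density e y|) l u κ γ) :
    ∀ᶠ q in 𝓝 p, (∀ k, e q k ≠ 0) → r q ∈ e.source ∧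
      ∀ m, 0 < (if m = i then -1 else 1) * (e q m * e (r q) m) ∧
        ∫ t in uIcc 0 (e q m), γ m t = ∫ t in uIcc 0 (e (r q) m), γ m t := by
  obtain ⟨hsm, e', he', hp', hp0', hev⟩ := hr
  have hnhds := e.open_source.mem_nhds hp
  have haxes : ∀ᶠ q in 𝓝 p, ∀ k, e' q k = e' p k → e q k = e p k :=
    eventually_all.2 fun k => he'.eventually_eq_of_isDistinguished (he.isDistinguished k) hp' hp
  have hbox := eventually_chartBox_subset (e := e') hp' hnhds
  filter_upwards [hev, hnhds, e'.open_source.mem_nhds hp', haxes, hbox, hsm.tendsto hnhds,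
    hsm.tendsto.eventually hbox] with q hq hqe hqe' hqax hqbox hrq hrqbox hq0
  obtain ⟨hre', -, ⟨hA, hB, hAB, p₀, hp₀⟩, hvol⟩ := hq fun k hk => by
    refine hq0 k ?_
    rw [hqax k (by rw [hk, hp0']; rfl), hp0]
    rfl
  have hAe := Web.chartBox_eq_chartBox he' he hp' hqe' hqbox
  have hBe := Web.chartBox_eq_chartBox he' he hp' hre' hrqbox
  have hre : r q ∈ e.source := hrq
  have hAsub : chartBox e p q ⊆ e.source := fun x hx => hx.1
  have hBsub : chartBox e p (r q) ⊆ e.source := fun x hx => hx.1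
  rw [hAe, hBe] at hAB hp₀ hvol
  rw [hAe] at hA
  rw [hBe] at hB
  rw [W.vol_chartBox he hp hqe, W.vol_chartBox he hp hre, hp0] at hvol
  obtain ⟨a, -, b, -, hab⟩ := hAB.exists_image_eq he (union_subset hAsub hBsub)
  obtain ⟨c, hc⟩ := W.exists_level_of_inter_subset_leaf hA hB he hAsub hBsub hp₀
  rw [image_union] at hab
  rw [he.image_chartBox hp hqe, he.image_chartBox hp hre, hp0] at hab hc
  have hc0 : (0 : ℝ) = c := hc (show (0 : Euc n) ∈ _ from
    ⟨left_mem_coordBox (0 : Euc n) (e q), left_mem_coordBox (0 : Euc n) (e (r q))⟩)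
  rw [← hc0] at hc
  have h0I : ∀ k, (0 : ℝ) ∈ Ioo (l k) (u k) := by
    have := e.map_source hp
    rw [hp0, hlu] at this
    exact this
  have hqI : ∀ k, e q k ∈ Ioo (l k) (u k) := by
    have := e.map_source hqe
    rwa [hlu] at this
  have hrI : ∀ k, e (r q) k ∈ Ioo (l k) (u k) := by
    have := e.map_source hre
    rwa [hlu] at this
  have hcont : ∀ b : Euc n, b ∈ e.target →
      ContinuousOn (fun y => |W.density e y|) (coordBox (0 : Euc n) b) := fun b hb =>
    (W.continuousOn_abs_density he).mono
      (he.coordBox_subset_target (hp0 ▸ e.map_source hp) hb)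
  have hpos : 0 < cellVol (fun y => |W.density e y|) (0 : Euc n) (e q) :=
    cellVol_pos (hcont _ (e.map_source hqe)) (fun y hy => W.abs_density_pos he
      (he.coordBox_subset_target (hp0 ▸ e.map_source hp) (e.map_source hqe) hy))
      fun k => (hq0 k).symm
  have hr0 : ∀ k, e (r q) k ≠ 0 := by
    intro k hk
    rw [hvol, cellVol_eq_zero (k := k) (by rw [hk]; rfl)] at hpos
    exact hpos.ne rfl
  obtain ⟨hneg, heq⟩ := coordBox_reflection hq0 hr0 hab hc
  refine ⟨hre, fun m => ?_⟩
  by_cases hm : m = i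
  · subst hm
    refine ⟨by rw [if_pos rfl]; linarith, ?_⟩
    have e1 : cellVol (fun y => |W.density e y|) (0 : Euc n) (e q) =
        κ * ∏ k, ∫ t in uIcc 0 (e q k), γ k t := hprod.cellVol_eq h0I hqI
    have e2 : cellVol (fun y => |W.density e y|) (0 : Euc n) (e (r q)) =
        κ * ∏ k, ∫ t in uIcc 0 (e (r q) k), γ k t := hprod.cellVol_eq h0I hrI
    rw [e1, e2, ← Finset.mul_prod_erase _ _ (Finset.mem_univ m),
      ← Finset.mul_prod_erase Finset.univ (fun k => ∫ t in uIcc 0 (e (r q) k), γ k t)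
      (Finset.mem_univ m)] at hvol
    have e3 : ∏ k ∈ Finset.univ.erase m, ∫ t in uIcc 0 (e (r q) k), γ k t =
        ∏ k ∈ Finset.univ.erase m, ∫ t in uIcc 0 (e q k), γ k t :=
      Finset.prod_congr rfl fun k hk => by rw [heq k (Finset.ne_of_mem_erase hk)]
    rw [e3] at hvol
    rw [e1, ← Finset.mul_prod_erase _ _ (Finset.mem_univ m)] at hpos
    have hne : ∏ k ∈ Finset.univ.erase m, ∫ t in uIcc 0 (e q k), γ k t ≠ 0 := by
      intro h
      rw [h, mul_zero, mul_zero] at hpos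
      exact hpos.ne rfl
    exact mul_right_cancel₀ hne (mul_left_cancel₀ hprod.pos.ne' hvol)
  · rw [if_neg hm, heq m hm]
    exact ⟨by rw [one_mul]; exact mul_self_pos.2 (hq0 m), rfl⟩

/-- Off the leaves through `p`, both compositions of two reflections have the same signs of
coordinates and the same integrals of the factors of the density, hence the same coordinates. The
remaining points near `p` are limits of such points. -/
theorem DivergenceFreeWeb.MixedPartialsVanish.reflections_commute [IsManifold (𝓡 n) ∞ M]
    [SecondCountableTopology M] [T2Space M] (hP : W.MixedPartialsVanish) {p : M} {i k : Fin n}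
    {r s : M → M} (hr : W.IsReflection i p r) (hs : W.IsReflection k p s) :
    r ∘ s =ᶠ[𝓝 p] s ∘ r := by
  obtain ⟨e, he, hp, hp0⟩ := W.exists_adaptedChart p
  obtain ⟨l, u, hlu⟩ := he.2.1
  obtain ⟨κ, γ, hprod⟩ := hP.exists_isProductDensity he hlu (e.map_source hp)
  have hcr := hr.eventually_coords he hp hp0 hlu hprod
  have hcs := hs.eventually_coords he hp hp0 hlu hprod
  have h0I : ∀ k, (0 : ℝ) ∈ Ioo (l k) (u k) := by
    have := e.map_source hp
    rw [hp0, hlu] at this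
    exact this
  have hI : ∀ x ∈ e.source, ∀ k, e x k ∈ Ioo (l k) (u k) := fun x hx => by
    have := e.map_source hx
    rwa [hlu] at this
  have hoff : ∀ᶠ q in 𝓝 p, (∀ k, e q k ≠ 0) → r (s q) = s (r q) := by
    filter_upwards [hcr, hcs, hr.1.tendsto.eventually hcs, hs.1.tendsto.eventually hcr]
      with q h1 h2 h3 h4 hq
    obtain ⟨-, hr1⟩ := h1 hq
    obtain ⟨-, hs1⟩ := h2 hq
    obtain ⟨m3, hr2⟩ := h3 fun m hm => by
      have := (hr1 m).1
      rw [hm, mul_zero, mul_zero] at this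
      exact this.ne rfl
    obtain ⟨m4, hs2⟩ := h4 fun m hm => by
      have := (hs1 m).1
      rw [hm, mul_zero, mul_zero] at this
      exact this.ne rfl
    refine e.injOn m4 m3 (PiLp.ext fun m => ?_)
    refine eq_of_setIntegral_uIcc_eq (hprod.continuousOn m) (hprod.factor_pos m) (h0I m)
      (hI _ m4 m) (hI _ m3 m) ?_ ?_
    -- in each coordinate both compositions change the sign in the same way
    · have p1 := mul_pos (mul_pos (hr1 m).1 (hr2 m).1) (mul_pos (hs1 m).1 (hs2 m).1)
      have hsq : 0 ≤ ((if m = i then -1 else 1) * (if m = k then -1 else 1) * e q m *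
        e (r q) m * e (s q) m) ^ 2 := sq_nonneg _
      by_contra hneg
      have := mul_nonpos_of_nonneg_of_nonpos hsq (not_lt.1 hneg)
      refine absurd p1 (not_lt.2 (le_trans (le_of_eq ?_) this))
      ring
    · rw [← (hs2 m).2, ← (hs1 m).2, ← (hr2 m).2, ← (hr1 m).2]
  have hcont : ∀ᶠ q in 𝓝 p, ContinuousAt (r ∘ s) q ∧ ContinuousAt (s ∘ r) q := by
    filter_upwards [(hr.1.comp hs.1).2, (hs.1.comp hr.1).2] with q h1 h2
    exact ⟨h1.continuousAt, h2.continuousAt⟩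
  filter_upwards [hoff.eventually_nhds, hcont, e.open_source.mem_nhds hp] with x h1 h2 hx
  exact tendsto_nhds_unique_of_frequently_eq h2.1.tendsto h2.2.tendsto
    (((frequently_off_axes hx).and_eventually h1).mono fun q hq => hq.2 hq.1)

theorem DivergenceFreeWeb.MixedPartialsVanish.reflectionHolonomy_eq_bot [IsManifold (𝓡 n) ∞ M]
    [SecondCountableTopology M] [T2Space M] (hP : W.MixedPartialsVanish) (p : M) :
    W.reflectionHolonomy p = ⊥ := by
  unfold reflectionHolonomy reflectionGroup
  rw [Subgroup.commutator_eq_bot_iff_le_centralizer, Subgroup.closure_le]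
  rintro v ⟨i, r, hr, hv⟩
  rw [SetLike.mem_coe, Subgroup.mem_centralizer_iff]
  intro w hw
  induction hw using Subgroup.closure_induction with
  | mem w hw =>
    obtain ⟨k, s, hs, hw⟩ := hw
    refine Units.ext ?_
    rw [Units.val_mul, Units.val_mul, hv, hw]
    exact Quotient.sound (hP.reflections_commute hs hr)
  | one => rw [one_mul, mul_one]
  | mul a b _ _ ha hb => rw [mul_assoc, hb, ← mul_assoc, ha, mul_assoc]
  | inv a _ ha => exact (Commute.inv_left (show Commute a v from ha)).eq

end

/-! ### Mean values over the boxes with one vertex at the origin -/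

section

open MeasureTheory

variable {n : ℕ}

/-- The linear map which multiplies the `k`-th coordinate by `t k`, for all `k`. -/
noncomputable def coordScale (t : Euc n) : Euc n →L[ℝ] Euc n :=
  ∑ k, t k • (stdCoord k).smulRight (stdVec k)

theorem coordScale_apply (t y : Euc n) (k : Fin n) : coordScale t y k = t k * y k := by
  simp [coordScale, Finset.sum_apply, Pi.single_apply]

theorem coordScale_comm (t y : Euc n) : coordScale t y = coordScale y t :=
  PiLp.ext fun k => by rw [coordScale_apply, coordScale_apply, mul_comm]

theorem continuous_coordScale : Continuous (coordScale : Euc n → _) := by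
  unfold coordScale
  fun_prop

theorem det_coordScale (t : Euc n) : (coordScale t).det = ∏ k, t k := by
  have h1 : (coordScale t).det = LinearMap.det (coordScale t).toLinearMap := rfl
  rw [h1, ← LinearMap.det_toMatrix (EuclideanSpace.basisFun (Fin n) ℝ).toBasis]
  have h2 : LinearMap.toMatrix (EuclideanSpace.basisFun (Fin n) ℝ).toBasis
      (EuclideanSpace.basisFun (Fin n) ℝ).toBasis (coordScale t).toLinearMap =
      Matrix.diagonal t.ofLp := by
    ext i j
    rw [LinearMap.toMatrix_apply]
    simp [coordScale_apply, Matrix.diagonal_apply]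
  rw [h2, Matrix.det_diagonal]

/-- The unit cube. -/
def unitCube (n : ℕ) : Set (Euc n) := coordBox (fun _ => 0) (fun _ => 1)

theorem mem_unitCube {t : Euc n} : t ∈ unitCube n ↔ ∀ k, t k ∈ Icc (0 : ℝ) 1 := by
  simp [unitCube, coordBox]

/-- The integral over the unit cube of `g (t₁y₁, …, tₙyₙ)` with the weight `w t`. For `w = 1` it is the
mean value of `g` over the box spanned by `0` and `y`. -/
noncomputable def boxMean (w g : Euc n → ℝ) (y : Euc n) : ℝ :=
  ∫ t in unitCube n, w t * g (coordScale t y)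

variable {O : Set (Euc n)} {w g : Euc n → ℝ}

theorem continuousOn_boxMean_integrand (hOs : ∀ t ∈ unitCube n, ∀ y ∈ O, coordScale t y ∈ O)
    (hw : Continuous w) (hg : ContinuousOn g O) :
    ContinuousOn (fun z : Euc n × Euc n => w z.2 * g (coordScale z.2 z.1)) (O ×ˢ unitCube n) := by
  refine (hw.comp continuous_snd).continuousOn.mul (hg.comp ?_ fun z hz => hOs _ hz.2 _ hz.1)
  exact ((continuous_coordScale.comp continuous_snd).clm_apply continuous_fst).continuousOn

theorem hasFDerivAt_boxMean_integrand (hO : IsOpen O) (hg : ContDiffOn ℝ ∞ g O) (w : Euc n → ℝ)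
    {t y : Euc n} (hty : coordScale t y ∈ O) :
    HasFDerivAt (fun y => w t * g (coordScale t y))
      (∑ k, (w t * t k * fderiv ℝ g (coordScale t y) (stdVec k)) • stdCoord k) y := by
  have hd := (hg.differentiableAt_of_isOpen hO hty).hasFDerivAt
  refine ((hd.comp y (coordScale t).hasFDerivAt).const_mul (w t)).congr_fderiv ?_
  ext v
  have h1 : (∑ k, (w t * t k * fderiv ℝ g (coordScale t y) (stdVec k)) • stdCoord k) v =
      ∑ k, w t * t k * fderiv ℝ g (coordScale t y) (stdVec k) * v k := by
    rw [_root_.sum_apply]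
    rfl
  have h2 : (w t • (fderiv ℝ g (coordScale t y)).comp (coordScale t)) v =
      w t * fderiv ℝ g (coordScale t y) (coordScale t v) := rfl
  rw [h1, h2, fderiv_apply_eq_sum, Finset.mul_sum]
  refine Finset.sum_congr rfl fun k _ => ?_
  rw [coordScale_apply, smul_eq_mul]
  ring

theorem integrableOn_boxMean_integrand (hOs : ∀ t ∈ unitCube n, ∀ y ∈ O, coordScale t y ∈ O)
    (hw : Continuous w) (hg : ContinuousOn g O) {y : Euc n} (hy : y ∈ O) :
    IntegrableOn (fun t => w t * g (coordScale t y)) (unitCube n) := by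
  have h1 := (continuousOn_boxMean_integrand hOs hw hg).comp
    (f := fun t => (y, t)) (Continuous.prodMk_right y).continuousOn fun t ht => ⟨hy, ht⟩
  exact ContinuousOn.integrableOn_coordBox h1

theorem continuousOn_sum_smul {X : Type*} [TopologicalSpace X] {S : Set X} {φ : Fin n → X → ℝ}
    (h : ∀ k, ContinuousOn (φ k) S) :
    ContinuousOn (fun z => ∑ k, φ k z • (stdCoord k : Euc n →L[ℝ] ℝ)) S :=
  continuousOn_finsetSum _ fun k _ => (h k).smul continuousOn_const

theorem hasFDerivAt_boxMean (hO : IsOpen O)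
    (hOs : ∀ t ∈ unitCube n, ∀ y ∈ O, coordScale t y ∈ O) (hw : Continuous w)
    (hg : ContDiffOn ℝ ∞ g O) {y : Euc n} (hy : y ∈ O) :
    HasFDerivAt (boxMean w g)
      (∑ k, boxMean (fun t => w t * t k) (fun z => fderiv ℝ g z (stdVec k)) y • stdCoord k) y := by
  have hwk : ∀ k, Continuous fun t : Euc n => w t * t k := fun k =>
    hw.mul (stdCoord k).continuous
  have hgk : ∀ k, ContinuousOn (fun z => fderiv ℝ g z (stdVec k)) O := fun k =>
    (hg.fderiv_apply_const hO (stdVec k)).continuousOn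
  have hF'c : ContinuousOn (fun z : Euc n × Euc n => ∑ k,
      (w z.2 * z.2 k * fderiv ℝ g (coordScale z.2 z.1) (stdVec k)) •
        (stdCoord k : Euc n →L[ℝ] ℝ)) (O ×ˢ unitCube n) :=
    continuousOn_sum_smul fun k => continuousOn_boxMean_integrand hOs (hwk k) (hgk k)
  obtain ⟨δ, hδ, hball⟩ := Metric.nhds_basis_closedBall.mem_iff.1 (hO.mem_nhds hy)
  have hcpt : IsCompact (Metric.closedBall y δ ×ˢ unitCube n) :=
    (isCompact_closedBall y δ).prod (isCompact_coordBox _ _)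
  obtain ⟨C, hC⟩ := hcpt.exists_bound_of_continuousOn (hF'c.mono (prod_mono hball Subset.rfl))
  have hcube : MeasurableSet (unitCube n) := measurableSet_coordBox _ _
  have hfin : volume (unitCube n) ≠ ⊤ := (isCompact_coordBox _ _).measure_lt_top.ne
  have hF'y : ContinuousOn (fun t : Euc n => ∑ k,
      (w t * t k * fderiv ℝ g (coordScale t y) (stdVec k)) •
        (stdCoord k : Euc n →L[ℝ] ℝ)) (unitCube n) :=
    hF'c.comp (f := fun t => (y, t)) (Continuous.prodMk_right y).continuousOn fun t ht => ⟨hy, ht⟩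
  have key := hasFDerivAt_integral_of_dominated_of_fderiv_le (μ := volume.restrict (unitCube n))
    (F := fun y t => w t * g (coordScale t y)) (F' := fun y t => ∑ k,
      (w t * t k * fderiv ℝ g (coordScale t y) (stdVec k)) • (stdCoord k : Euc n →L[ℝ] ℝ))
    (x₀ := y) (bound := fun _ => C) (Metric.closedBall_mem_nhds y hδ)
    (by
      filter_upwards [hO.mem_nhds hy] with z hz
      exact (integrableOn_boxMean_integrand hOs hw hg.continuousOn hz).aestronglyMeasurable)
    (integrableOn_boxMean_integrand hOs hw hg.continuousOn hy)
    (hF'y.aestronglyMeasurable hcube)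
    (ae_restrict_of_forall_mem hcube fun t ht z hz => hC (z, t) ⟨hz, ht⟩)
    (integrableOn_const hfin)
    (ae_restrict_of_forall_mem hcube fun t ht z hz =>
      hasFDerivAt_boxMean_integrand hO hg w (hOs t ht z (hball hz)))
  refine key.congr_fderiv ?_
  have hint : ∀ k, Integrable (fun t => w t * t k * fderiv ℝ g (coordScale t y) (stdVec k))
      (volume.restrict (unitCube n)) := fun k =>
    integrableOn_boxMean_integrand hOs (hwk k) (hgk k) hy
  rw [integral_finsetSum _ fun k _ => (hint k).smul_const _]
  exact Finset.sum_congr rfl fun k _ => integral_smul_const _ _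

theorem fderiv_boxMean (hO : IsOpen O)
    (hOs : ∀ t ∈ unitCube n, ∀ y ∈ O, coordScale t y ∈ O) (hw : Continuous w)
    (hg : ContDiffOn ℝ ∞ g O) {y : Euc n} (hy : y ∈ O) (k : Fin n) :
    fderiv ℝ (boxMean w g) y (stdVec k) =
      boxMean (fun t => w t * t k) (fun z => fderiv ℝ g z (stdVec k)) y := by
  rw [(hasFDerivAt_boxMean hO hOs hw hg hy).fderiv]
  simp

theorem contDiffOn_boxMean (hO : IsOpen O)
    (hOs : ∀ t ∈ unitCube n, ∀ y ∈ O, coordScale t y ∈ O) (hw : Continuous w)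
    (hg : ContDiffOn ℝ ∞ g O) : ContDiffOn ℝ ∞ (boxMean w g) O := by
  refine contDiffOn_infty.2 fun m => ?_
  induction m generalizing w g with
  | zero =>
    exact contDiffOn_zero.2 fun y hy =>
      (hasFDerivAt_boxMean hO hOs hw hg hy).continuousAt.continuousWithinAt
  | succ m ih =>
    rw [Nat.cast_succ]
    refine (contDiffOn_succ_iff_fderiv_of_isOpen hO).2 ⟨fun y hy =>
      (hasFDerivAt_boxMean hO hOs hw hg hy).differentiableAt.differentiableWithinAt, by simp, ?_⟩
    refine ContDiffOn.congr (f := fun y => ∑ k, boxMean (fun t => w t * t k)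
      (fun z => fderiv ℝ g z (stdVec k)) y • stdCoord k) ?_
      fun y hy => (hasFDerivAt_boxMean hO hOs hw hg hy).fderiv
    exact ContDiffOn.sum fun k _ => (ih (hw.mul (stdCoord k).continuous)
      (hg.fderiv_apply_const hO (stdVec k))).smul contDiffOn_const

theorem boxMean_zero (w g : Euc n → ℝ) : boxMean w g 0 = (∫ t in unitCube n, w t) * g 0 := by
  unfold boxMean
  simp only [map_zero]
  exact integral_mul_const _ _

theorem setIntegral_unitCube_prod (φ : Fin n → ℝ → ℝ) :
    ∫ t in unitCube n, ∏ k, φ k (t k) = ∏ k, ∫ s in Icc (0 : ℝ) 1, φ k s := by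
  have := cellVol_prod (g := fun t : Euc n => ∏ k, φ k (t k)) (a := fun _ => 0) (b := fun _ => 1)
    (κ := 1) (γ := φ) fun y _ => (one_mul _).symm
  rw [one_mul] at this
  simpa [cellVol, unitCube] using this

theorem setIntegral_Icc_id : ∫ s in Icc (0 : ℝ) 1, s = 1 / 2 := by
  rw [integral_Icc_eq_integral_Ioc, ← intervalIntegral.integral_of_le zero_le_one, integral_id]
  norm_num

theorem setIntegral_unitCube_one : ∫ _ in unitCube n, (1 : ℝ) = 1 := by
  have := setIntegral_unitCube_prod (n := n) fun _ _ => 1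
  simpa using this

theorem setIntegral_unitCube_coord (i : Fin n) : ∫ t in unitCube n, t i = 1 / 2 := by
  have := setIntegral_unitCube_prod (n := n) fun k s => if k = i then s else 1
  simp only [Finset.prod_ite_eq', Finset.mem_univ, if_true] at this
  rw [this, Finset.prod_eq_single i]
  · simpa using setIntegral_Icc_id
  · intro k _ hk
    simp [hk]
  · simp

theorem setIntegral_unitCube_coord_mul {i j : Fin n} (hij : i ≠ j) :
    ∫ t in unitCube n, t i * t j = 1 / 4 := by
  have := setIntegral_unitCube_prod (n := n) fun k s =>
    (if k = i then s else 1) * (if k = j then s else 1)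
  simp only [Finset.prod_mul_distrib, Finset.prod_ite_eq', Finset.mem_univ, if_true] at this
  rw [this, ← Finset.mul_prod_erase _ _ (Finset.mem_univ i), ← Finset.mul_prod_erase _ _
    (Finset.mem_erase.2 ⟨hij.symm, Finset.mem_univ j⟩)]
  rw [Finset.prod_eq_one]
  · simp only [if_true, hij, hij.symm, if_false, mul_one, one_mul]
    rw [setIntegral_Icc_id]
    norm_num
  · intro k hk
    simp only [Finset.mem_erase] at hk
    simp [hk.1, hk.2.1]

/-- The change of variables from a box with a vertex at the origin to the unit cube. -/
theorem cellVol_zero_left (g : Euc n → ℝ) {y : Euc n} (hy : ∀ k, y k ≠ 0) :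
    cellVol g (0 : Euc n) y = |∏ k, y k| * boxMean (fun _ => 1) g y := by
  have himg : coordScale y '' unitCube n = coordBox (0 : Euc n) y := by
    ext z
    constructor
    · rintro ⟨t, ht, rfl⟩ k
      have := mem_unitCube.1 ht k
      rw [coordScale_apply, mul_comm]
      change t k * y k ∈ uIcc 0 (y k)
      rw [mem_uIcc]
      rcases le_total 0 (y k) with h | h
      · exact Or.inl ⟨mul_nonneg this.1 h, mul_le_of_le_one_left h this.2⟩
      · exact Or.inr ⟨by nlinarith [this.2], mul_nonpos_of_nonneg_of_nonpos this.1 h⟩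
    · intro hz
      refine ⟨WithLp.toLp 2 fun k => z k / y k, mem_unitCube.2 fun k => ?_, PiLp.ext fun k => ?_⟩
      · have hzk := hz k
        change z k ∈ uIcc 0 (y k) at hzk
        change z k / y k ∈ _
        rw [mem_uIcc] at hzk
        rcases hzk with h | h
        · exact ⟨div_nonneg h.1 (h.1.trans h.2), div_le_one_of_le₀ h.2 (h.1.trans h.2)⟩
        · exact ⟨div_nonneg_of_nonpos h.2 (h.1.trans h.2),
            div_le_one_of_ge h.1 (h.1.trans h.2)⟩
      · rw [coordScale_apply]
        exact mul_div_cancel₀ _ (hy k)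
  have hinj : InjOn (coordScale y) (unitCube n) := fun s _ t _ hst => PiLp.ext fun k => by
    have := congrArg (fun v : Euc n => v k) hst
    simp only [coordScale_apply] at this
    exact mul_left_cancel₀ (hy k) this
  unfold cellVol boxMean
  have hcube : MeasurableSet (unitCube n) := measurableSet_coordBox _ _
  rw [← himg, integral_image_eq_integral_abs_det_fderiv_smul volume hcube
    (fun t _ => (coordScale y).hasFDerivAt.hasFDerivWithinAt) hinj, det_coordScale,
    integral_smul, smul_eq_mul]
  congr 1
  refine integral_congr_ae (Eventually.of_forall fun t => ?_)
  simp only [one_mul]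
  rw [coordScale_comm]

/-- The second derivatives of a logarithm. -/
theorem fderiv_fderiv_log {f : Euc n → ℝ} (hO : IsOpen O) (hf : ContDiffOn ℝ ∞ f O)
    (h0 : ∀ y ∈ O, f y ≠ 0) {y : Euc n} (hy : y ∈ O) (v v' : Euc n) :
    fderiv ℝ (fun z => fderiv ℝ (fun z' => Real.log (f z')) z v) y v' =
      (f y * fderiv ℝ (fun z => fderiv ℝ f z v) y v' - fderiv ℝ f y v * fderiv ℝ f y v') /
        f y ^ 2 := by
  have h1 : (fun z => fderiv ℝ (fun z' => Real.log (f z')) z v) =ᶠ[𝓝 y]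
      fun z => fderiv ℝ f z v / f z := by
    filter_upwards [hO.mem_nhds hy] with z hz
    have := ((hf.differentiableAt_of_isOpen hO hz).hasFDerivAt.log (h0 z hz)).fderiv
    rw [this, _root_.smul_apply, smul_eq_mul, div_eq_inv_mul]
  have h2 := (hf.differentiableAt_of_isOpen hO hy).hasFDerivAt
  have h3 := ((hf.fderiv_apply_const hO v).differentiableAt_of_isOpen hO hy).hasFDerivAt
  have h4 := h3.mul ((hasDerivAt_inv (h0 y hy)).comp_hasFDerivAt y h2)
  rw [h1.fderiv_eq]
  refine (DFunLike.congr_fun (h4.congr_of_eventuallyEq (Eventually.of_forall fun z =>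
    div_eq_mul_inv _ _)).fderiv v').trans ?_
  have := h0 y hy
  simp only [_root_.add_apply, _root_.smul_apply, smul_eq_mul, Function.comp_apply]
  field_simp
  ring

/-- The mixed logarithmic derivative at the origin of the mean values of a function over boxes with
a vertex there is a quarter of that of the function. -/
theorem fderiv_fderiv_log_boxMean (hO : IsOpen O)
    (hOs : ∀ t ∈ unitCube n, ∀ y ∈ O, coordScale t y ∈ O) (hg : ContDiffOn ℝ ∞ g O)
    (h0 : ∀ y ∈ O, g y ≠ 0) (h0' : ∀ y ∈ O, boxMean (fun _ => 1) g y ≠ 0)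
    (hz : (0 : Euc n) ∈ O) {i j : Fin n} (hij : i ≠ j) :
    fderiv ℝ (fun z => fderiv ℝ (fun z' => Real.log (boxMean (fun _ => 1) g z')) z (stdVec i)) 0
        (stdVec j) =
      1 / 4 * fderiv ℝ (fun z => fderiv ℝ (fun z' => Real.log (g z')) z (stdVec i)) 0
        (stdVec j) := by
  have hc : Continuous fun _ : Euc n => (1 : ℝ) := continuous_const
  have hk : ∀ k : Fin n, Continuous fun t : Euc n => (1 : ℝ) * t k := fun k =>
    continuous_const.mul (stdCoord k).continuous
  have e0 : boxMean (fun _ => 1) g 0 = g 0 := by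
    rw [boxMean_zero, setIntegral_unitCube_one, one_mul]
  have e1 : ∀ k, fderiv ℝ (boxMean (fun _ => 1) g) 0 (stdVec k) =
      1 / 2 * fderiv ℝ g 0 (stdVec k) := by
    intro k
    rw [fderiv_boxMean hO hOs hc hg hz, boxMean_zero]
    simp only [one_mul]
    rw [setIntegral_unitCube_coord]
  have e2 : fderiv ℝ (fun z => fderiv ℝ (boxMean (fun _ => 1) g) z (stdVec i)) 0 (stdVec j) =
      1 / 4 * fderiv ℝ (fun z => fderiv ℝ g z (stdVec i)) 0 (stdVec j) := by
    have : (fun z => fderiv ℝ (boxMean (fun _ => 1) g) z (stdVec i)) =ᶠ[𝓝 0]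
        boxMean (fun t => 1 * t i) (fun z => fderiv ℝ g z (stdVec i)) := by
      filter_upwards [hO.mem_nhds hz] with z hz using fderiv_boxMean hO hOs hc hg hz i
    rw [this.fderiv_eq, fderiv_boxMean hO hOs (hk i) (hg.fderiv_apply_const hO _) hz, boxMean_zero]
    simp only [one_mul]
    rw [setIntegral_unitCube_coord_mul hij]
  rw [fderiv_fderiv_log hO (contDiffOn_boxMean hO hOs hc hg) h0' hz,
    fderiv_fderiv_log hO hg h0 hz, e0, e1, e1, e2]
  ring

end

/-! ### Construction of the reflections -/

section

variable {n : ℕ}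

theorem setCoord_setCoord (y : Euc n) (i : Fin n) (s t : ℝ) :
    setCoord (setCoord y i s) i t = setCoord y i t := by
  refine PiLp.ext fun k => ?_
  by_cases hk : k = i
  · subst hk; rw [setCoord_self, setCoord_self]
  · rw [setCoord_of_ne _ hk, setCoord_of_ne _ hk, setCoord_of_ne _ hk]

theorem eq_setCoord {y z : Euc n} {i : Fin n} (h : ∀ k, k ≠ i → z k = y k) :
    z = setCoord y i (z i) := by
  refine PiLp.ext fun k => ?_
  by_cases hk : k = i
  · subst hk; rw [setCoord_self]
  · rw [setCoord_of_ne _ hk, h k hk]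

/-- For a positive smooth function `f`, the equation `sᵢ f(s) = -yᵢ f(y)` is solved near the origin by
a smooth involution `y ↦ s` which changes only the `i`-th coordinate: it is the reflection
`yᵢ ↦ -yᵢ` in the coordinate system where `yᵢ` is replaced by `yᵢ f(y)`. -/
theorem exists_involution {O : Set (Euc n)} (hO : IsOpen O) (h0 : (0 : Euc n) ∈ O)
    {f : Euc n → ℝ} (hf : ContDiffOn ℝ ∞ f O) (hf0 : f 0 ≠ 0) (i : Fin n) :
    ∃ R : Euc n → Euc n, R 0 = 0 ∧ ∀ᶠ y in 𝓝 0, ContDiffAt ℝ ∞ R y ∧ R y ∈ O ∧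
      (∀ k, k ≠ i → R y k = y k) ∧ R y i * f (R y) = -(y i * f y) ∧ R (R y) = y := by
  have hf1 := hf.fderiv_apply_const hO (stdVec i)
  have hcoord : ContDiff ℝ ∞ fun y : Euc n => y i := (stdCoord i).contDiff
  let V : Set (Euc n) := O ∩ (fun y => f y + y i * fderiv ℝ f y (stdVec i)) ⁻¹' {0}ᶜ
  have hV : IsOpen V :=
    (hf.continuousOn.add (hcoord.continuous.continuousOn.mul hf1.continuousOn)).isOpen_inter_preimage
      hO isOpen_compl_singleton
  have h0V : (0 : Euc n) ∈ V := ⟨h0, by simpa using hf0⟩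
  let Ψ : Euc n → Euc n := fun y => setCoord y i (y i * f y)
  have hΨeq : Ψ = fun y => y + (y i * f y - y i) • stdVec i := funext fun y => setCoord_eq_add y i _
  have hΨ : ContDiffOn ℝ ∞ Ψ V := by
    rw [hΨeq]
    exact contDiffOn_id.add (((hcoord.contDiffOn.mul (hf.mono inter_subset_left)).sub
      hcoord.contDiffOn).smul contDiffOn_const)
  have hinj : ∀ y ∈ V, Function.Injective (fderiv ℝ Ψ y) := by
    intro y hy
    have h1 : HasFDerivAt (fun y : Euc n => y i) (stdCoord i : Euc n →L[ℝ] ℝ) y :=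
      (stdCoord i).hasFDerivAt
    have h2 := (hf.differentiableAt_of_isOpen hO hy.1).hasFDerivAt
    have h3 := (hasFDerivAt_id y).add (((h1.mul h2).sub h1).smul_const (stdVec i))
    change HasFDerivAt (fun y => y + (y i * f y - y i) • stdVec i) _ y at h3
    rw [← hΨeq] at h3
    rw [injective_iff_map_eq_zero]
    intro v hv
    rw [h3.fderiv] at hv
    -- the differential is triangular, with the diagonal entries `1` and `∂(yᵢ f(y)) / ∂yᵢ ≠ 0`
    have hvk : ∀ k, k ≠ i → v k = 0 := fun k hk => by
      have := congrArg (fun w : Euc n => w k) hv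
      simpa [hk] using this
    have hvi := congrArg (fun w : Euc n => w i) hv
    simp only [_root_.add_apply, _root_.sub_apply, _root_.smul_apply, smul_eq_mul,
      ContinuousLinearMap.smulRight_apply, ContinuousLinearMap.id_apply, PiLp.add_apply,
      PiLp.smul_apply, PiLp.zero_apply, PiLp.single_apply, if_true, mul_one] at hvi
    rw [show stdCoord i v = v i from rfl] at hvi
    have hvs : v = v i • stdVec i := by
      refine PiLp.ext fun k => ?_
      by_cases hk : k = i
      · subst hk; simp
      · simp [hvk k hk, hk]
    have h4 : fderiv ℝ f y v = v i * fderiv ℝ f y (stdVec i) := by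
      conv_lhs => rw [hvs]
      rw [map_smul, smul_eq_mul]
    rw [h4] at hvi
    have h5 : v i * (f y + y i * fderiv ℝ f y (stdVec i)) = 0 := by linear_combination hvi
    have h6 : v i = 0 := (mul_eq_zero.1 h5).resolve_right hy.2
    rw [hvs, h6, zero_smul]
  obtain ⟨ψ, hψ0, hψV, hψ, hψs⟩ := exists_localDiffeo hV hΨ hinj h0V
  -- the involution is the linear reflection `φ` conjugated by `ψ`
  let φ : Euc n → Euc n := fun z => setCoord z i (-(z i))
  have hφeq : φ = fun z => z + (-(z i) - z i) • stdVec i := funext fun z => setCoord_eq_add z i _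
  have hφ : ContDiff ℝ ∞ φ := by
    rw [hφeq]
    exact contDiff_id.add ((hcoord.neg.sub hcoord).smul contDiff_const)
  have hφφ : ∀ z, φ (φ z) = z := fun z => by
    change setCoord (setCoord z i (-(z i))) i (-(setCoord z i (-(z i)) i)) = z
    rw [setCoord_self, neg_neg, setCoord_setCoord, setCoord_eq_self]
  have hψz : ψ 0 = 0 := by
    rw [hψ]
    change setCoord 0 i ((0 : Euc n) i * f 0) = 0
    rw [show (0 : Euc n) i * f 0 = (0 : Euc n) i by simp, setCoord_eq_self]
  have hφz : φ 0 = 0 := by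
    change setCoord 0 i (-((0 : Euc n) i)) = 0
    rw [show -((0 : Euc n) i) = (0 : Euc n) i by simp, setCoord_eq_self]
  refine ⟨fun y => ψ.symm (φ (ψ y)), ?_, ?_⟩
  · simp only
    rw [hψz, hφz]
    exact (congrArg ψ.symm hψz.symm).trans (ψ.left_inv hψ0)
  have hcont : ContinuousAt (fun y => φ (ψ y)) 0 :=
    hφ.continuous.continuousAt.comp (ψ.continuousAt hψ0)
  have htarget : ∀ᶠ y in 𝓝 0, φ (ψ y) ∈ ψ.target := by
    refine hcont.preimage_mem_nhds (ψ.open_target.mem_nhds ?_)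
    rw [hψz, hφz, ← hψz]
    exact ψ.map_source hψ0
  filter_upwards [htarget, ψ.open_source.mem_nhds hψ0] with y hy hys
  have hRs := ψ.map_target hy
  have hψR : ψ (ψ.symm (φ (ψ y))) = φ (ψ y) := ψ.right_inv hy
  have hcoordR : ∀ k, Ψ (ψ.symm (φ (ψ y))) k = φ (Ψ y) k := fun k => by
    have := hψR
    rw [hψ] at this ⊢
    rw [this]
  refine ⟨?_, (hψV hRs).1, fun k hk => ?_, ?_, ?_⟩
  · have hψy : ContDiffAt ℝ ∞ ψ y := by
      rw [hψ]; exact hΨ.contDiffAt (hV.mem_nhds (hψV hys))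
    exact (hψs.contDiffAt (ψ.open_target.mem_nhds hy)).comp y (hφ.contDiffAt.comp y hψy)
  · have h1 := hcoordR k
    change setCoord _ i _ k = setCoord (setCoord y i _) i _ k at h1
    rwa [setCoord_of_ne _ hk, setCoord_of_ne _ hk, setCoord_of_ne _ hk] at h1
  · have h1 := hcoordR i
    change setCoord _ i _ i = setCoord (setCoord y i _) i (-(setCoord y i _ i)) i at h1
    rwa [setCoord_self, setCoord_self, setCoord_self] at h1
  · rw [hψR, hφφ, ψ.left_inv hys]

theorem boxMean_pos {O : Set (Euc n)} {g : Euc n → ℝ}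
    (hOs : ∀ t ∈ unitCube n, ∀ y ∈ O, coordScale t y ∈ O) (hg : ContinuousOn g O)
    (h0 : ∀ y ∈ O, 0 < g y) {y : Euc n} (hy : y ∈ O) : 0 < boxMean (fun _ => 1) g y := by
  have h1 := (continuousOn_boxMean_integrand hOs (w := fun _ => 1) continuous_const hg).comp
    (f := fun t => (y, t)) (Continuous.prodMk_right y).continuousOn fun t ht => ⟨hy, ht⟩
  exact cellVol_pos (a := fun _ => 0) (b := fun _ => 1) h1
    (fun t ht => by
      change 0 < 1 * g (coordScale t y)
      rw [one_mul]
      exact h0 _ (hOs t ht y hy)) fun _ => zero_ne_one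

end

section

variable {n : ℕ} {M : Type*} [TopologicalSpace M] [ChartedSpace (Euc n) M]
variable {e : OpenPartialHomeomorph M (Euc n)} {W : DivergenceFreeWeb n M}

theorem Web.IsAdaptedChart.coordScale_mem_target {W : Web n M} (he : W.IsAdaptedChart e)
    (h0 : (0 : Euc n) ∈ e.target) {t : Euc n} (ht : t ∈ unitCube n) {y : Euc n}
    (hy : y ∈ e.target) : coordScale t y ∈ e.target := by
  refine he.coordBox_subset_target h0 hy fun k => ?_
  have := mem_unitCube.1 ht k
  rw [coordScale_apply]
  change t k * y k ∈ uIcc 0 (y k)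
  rw [mem_uIcc]
  rcases le_total 0 (y k) with h | h
  · exact Or.inl ⟨mul_nonneg this.1 h, mul_le_of_le_one_left h this.2⟩
  · exact Or.inr ⟨by nlinarith [this.2], mul_nonpos_of_nonneg_of_nonpos this.1 h⟩

/-- The boxes spanned by the origin and by two points which differ only in the sign and the size of
one coordinate form a box. -/
theorem exists_coordBox_union_eq {y : Euc n} {i : Fin n} {s : ℝ} (hs : s * y i < 0) :
    ∃ a : Euc n, (∀ k, a k = 0 ∨ a k = setCoord y i s k) ∧
      coordBox (0 : Euc n) y ∪ coordBox (0 : Euc n) (setCoord y i s) = coordBox a y ∧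
      coordBox (0 : Euc n) y ∩ coordBox (0 : Euc n) (setCoord y i s) ⊆ {z | z i = 0} := by
  let a : Fin n → ℝ := Function.update 0 i s
  have hc : (0 : ℝ) ∈ uIcc (a i) (y i) := by
    simp only [a, Function.update_self]
    rw [mem_uIcc]
    rcases mul_neg_iff.1 hs with h | h
    · exact Or.inr ⟨h.2.le, h.1.le⟩
    · exact Or.inl ⟨h.1.le, h.2.le⟩
  have e1 : coordBox a (Function.update y.ofLp i 0) = coordBox (0 : Euc n) (setCoord y i s) := by
    ext z
    refine forall_congr' fun k => ?_
    by_cases hk : k = i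
    · subst hk
      rw [setCoord_self, Function.update_self]
      simp only [a, Function.update_self]
      rw [uIcc_comm]
      rfl
    · rw [setCoord_of_ne _ hk, Function.update_of_ne hk]
      simp only [a, Function.update_of_ne hk]
      rfl
  have e2 : Function.update a i 0 = (0 : Euc n).ofLp := by
    simp only [a, Function.update_idem]
    exact Function.update_eq_self i _
  refine ⟨WithLp.toLp 2 a, fun k => ?_, ?_, ?_⟩
  · by_cases hk : k = i
    · subst hk
      exact Or.inr ((Function.update_self ..).trans (setCoord_self ..).symm)
    · exact Or.inl (Function.update_of_ne hk ..)
  · have := coordBox_union hc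
    rw [e1, e2, union_comm] at this
    exact this
  · have := coordBox_inter hc
    rw [e1, e2, inter_comm] at this
    exact this

/-- An involution which changes only the `i`-th coordinate, as in `exists_involution` for the mean
values of the density over the boxes with a vertex at the origin, is a volume-preserving
reflection. -/
theorem DivergenceFreeWeb.isReflection_of_involution [IsManifold (𝓡 n) ∞ M]
    (he : W.IsAdaptedChart e) {p : M} (hp : p ∈ e.source) (hp0 : e p = 0) {i : Fin n}
    {R : Euc n → Euc n} (hR0 : R 0 = 0)
    (hR : ∀ᶠ y in 𝓝 0, ContDiffAt ℝ ∞ R y ∧ R y ∈ e.target ∧ (∀ k, k ≠ i → R y k = y k) ∧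
      R y i * boxMean (fun _ => 1) (fun y => |W.density e y|) (R y) =
        -(y i * boxMean (fun _ => 1) (fun y => |W.density e y|) y) ∧ R (R y) = y) :
    W.IsReflection i p (fun x => e.symm (R (e x))) ∧
      ∀ᶠ x in 𝓝 p, e.symm (R (e (e.symm (R (e x))))) = x := by
  have h0t : (0 : Euc n) ∈ e.target := hp0 ▸ e.map_source hp
  have hlim : Tendsto e (𝓝 p) (𝓝 0) := by
    have := (e.continuousAt hp).tendsto
    rwa [hp0] at this
  have hesm := contMDiffOn_of_mem_maximalAtlas he.1
  have hesm' := contMDiffOn_symm_of_mem_maximalAtlas he.1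
  have hpos : ∀ y ∈ e.target, 0 < boxMean (fun _ => 1) (fun y => |W.density e y|) y :=
    fun y hy => boxMean_pos (fun t ht y hy => he.coordScale_mem_target h0t ht hy)
      (W.continuousOn_abs_density he) (fun y hy => W.abs_density_pos he hy) hy
  refine ⟨⟨⟨?_, ?_⟩, e, he, hp, hp0, ?_⟩, ?_⟩
  · simp only
    rw [hp0, hR0]
    exact (congrArg e.symm hp0.symm).trans (e.left_inv hp)
  · filter_upwards [hlim.eventually hR, e.open_source.mem_nhds hp] with x hx hxs
    have h1 := hesm.contMDiffAt (e.open_source.mem_nhds hxs)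
    have h2 := hesm'.contMDiffAt (e.open_target.mem_nhds hx.2.1)
    exact h2.comp x (hx.1.contMDiffAt.comp x h1)
  · filter_upwards [hlim.eventually hR, e.open_source.mem_nhds hp] with q hq hqs hq0
    obtain ⟨-, hRt, hRk, hRi, -⟩ := hq
    set y := e q with hy
    have hyt : y ∈ e.target := e.map_source hqs
    have hrs : e.symm (R y) ∈ e.source := e.map_target hRt
    have her : e (e.symm (R y)) = R y := e.right_inv hRt
    have hneg : R y i * y i < 0 := by
      have h1 := hpos y hyt
      have h2 := hpos _ hRt
      have h3 : 0 < y i * y i := mul_self_pos.2 (hq0 i)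
      have h4 : (R y i * y i) * boxMean (fun _ => 1) (fun y => |W.density e y|) (R y) < 0 := by
        have : (R y i * y i) * boxMean (fun _ => 1) (fun y => |W.density e y|) (R y) =
            -(y i * y i * boxMean (fun _ => 1) (fun y => |W.density e y|) y) := by
          linear_combination y i * hRi
        rw [this]
        exact neg_neg_of_pos (mul_pos h3 h1)
      exact neg_of_mul_neg_left h4 h2.le
    have hRy : R y = setCoord y i (R y i) := eq_setCoord hRk
    have hR0' : ∀ k, R y k ≠ 0 := by
      intro k
      by_cases hk : k = i
      · subst hk
        exact left_ne_zero_of_mul hneg.ne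
      · rw [hRk k hk]; exact hq0 k
    obtain ⟨a, ha, hU, hI⟩ := exists_coordBox_union_eq hneg
    rw [← hRy] at ha hU hI
    have hat : a ∈ e.target := he.coordBox_subset_target h0t hRt fun k => by
      rcases ha k with h | h
      · rw [h]; exact left_mem_uIcc
      · rw [h]; exact right_mem_uIcc
    have hbox : ∀ q', chartBox e p q' = e.source ∩ e ⁻¹' coordBox (0 : Euc n) (e q') := by
      intro q'
      rw [← hp0]
      rfl
    refine ⟨hrs, fun h => ?_, ⟨⟨e, he, p, hp, q, hqs, rfl⟩, ⟨e, he, p, hp, _, hrs, rfl⟩,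
      ⟨e, he, e.symm a, e.map_target hat, q, hqs, ?_⟩, p, ?_⟩, ?_⟩
    · have h1 : R y = y := by rw [← her, h]
      rw [h1] at hneg
      exact hneg.not_ge (mul_self_nonneg _)
    · rw [hbox, hbox, her, ← inter_union_distrib_left, ← preimage_union, hU]
      have : chartBox e (e.symm a) q = e.source ∩ e ⁻¹' coordBox (e (e.symm a)) (e q) := rfl
      rw [this, e.right_inv hat]
    · refine Subset.trans ?_ (he.plaque_subset_leaf (i := i) (c := 0) ⟨hp, by rw [hp0]; rfl⟩)
      rw [hbox, hbox, her]
      exact fun x hx => ⟨hx.1.1, hI ⟨hx.1.2, hx.2.2⟩⟩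
    · rw [W.vol_chartBox he hp hqs, W.vol_chartBox he hp hrs, her, hp0, cellVol_zero_left _ hq0,
        cellVol_zero_left _ hR0', Finset.abs_prod, Finset.abs_prod,
        ← Finset.mul_prod_erase _ _ (Finset.mem_univ i),
        ← Finset.mul_prod_erase Finset.univ (fun k => |R y k|) (Finset.mem_univ i)]
      have h1 : ∏ k ∈ Finset.univ.erase i, |R y k| = ∏ k ∈ Finset.univ.erase i, |y k| :=
        Finset.prod_congr rfl fun k hk => by rw [hRk k (Finset.ne_of_mem_erase hk)]
      have h2 := congrArg abs hRi
      rw [abs_neg, abs_mul, abs_mul, abs_of_pos (hpos _ hRt), abs_of_pos (hpos _ hyt)] at h2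
      rw [h1]
      linear_combination -(∏ k ∈ Finset.univ.erase i, |y k|) * h2
  · filter_upwards [hlim.eventually hR, e.open_source.mem_nhds hp] with x hx hxs
    rw [e.right_inv hx.2.1, hx.2.2.2.2, e.left_inv hxs]

/-- The germ of an involution in the reflection group. -/
theorem DivergenceFreeWeb.IsReflection.exists_mem_reflectionGroup {p : M} {i : Fin n} {r : M → M}
    (hr : W.IsReflection i p r) (hrr : ∀ᶠ x in 𝓝 p, r (r x) = x) :
    ∃ v ∈ W.reflectionGroup p, (v : SmoothGerm n p) = SmoothGerm.mk r hr.1 := by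
  have h1 : SmoothGerm.mk r hr.1 * SmoothGerm.mk r hr.1 = 1 := Quotient.sound hrr
  exact ⟨⟨_, _, h1, h1⟩, Subgroup.subset_closure ⟨i, r, hr, rfl⟩, rfl⟩

theorem DivergenceFreeWeb.eventually_comm_of_reflectionHolonomy_eq_bot {p : M}
    (h : W.reflectionHolonomy p = ⊥) {i j : Fin n} {r s : M → M} (hr : W.IsReflection i p r)
    (hrr : ∀ᶠ x in 𝓝 p, r (r x) = x) (hs : W.IsReflection j p s)
    (hss : ∀ᶠ x in 𝓝 p, s (s x) = x) : r ∘ s =ᶠ[𝓝 p] s ∘ r := by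
  obtain ⟨v, hv, hvr⟩ := hr.exists_mem_reflectionGroup hrr
  obtain ⟨w, hw, hws⟩ := hs.exists_mem_reflectionGroup hss
  have h1 := Subgroup.commutator_eq_bot_iff_le_centralizer.1 h
  have h2 := congrArg Units.val (Subgroup.mem_centralizer_iff.1 (h1 hw) v hv)
  rw [Units.val_mul, Units.val_mul, hvr, hws] at h2
  exact Quotient.exact h2

end

/-! ### Trivial reflection holonomy -/

section

variable {n : ℕ}

/-- If the reflections determined by a positive function `f` in the directions `i` and `j` commute,
then `log f` has no mixed second differences over the quadrilaterals formed by a point, its two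
reflections and their common reflection. -/
theorem fderiv_fderiv_log_eq_zero_of_commute {O : Set (Euc n)} (hO : IsOpen O)
    (h0 : (0 : Euc n) ∈ O) {f : Euc n → ℝ} (hf : ContDiffOn ℝ ∞ f O) (hf0 : ∀ y ∈ O, 0 < f y)
    {i j : Fin n} (hij : i ≠ j) {R S : Euc n → Euc n} (hR0 : R 0 = 0) (hS0 : S 0 = 0)
    (hR : ∀ᶠ y in 𝓝 0, ContDiffAt ℝ ∞ R y ∧ R y ∈ O ∧ (∀ k, k ≠ i → R y k = y k) ∧
      R y i * f (R y) = -(y i * f y) ∧ R (R y) = y)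
    (hS : ∀ᶠ y in 𝓝 0, ContDiffAt ℝ ∞ S y ∧ S y ∈ O ∧ (∀ k, k ≠ j → S y k = y k) ∧
      S y j * f (S y) = -(y j * f y) ∧ S (S y) = y)
    (hRS : ∀ᶠ y in 𝓝 0, R (S y) = S (R y)) :
    fderiv ℝ (fun z => fderiv ℝ (fun z' => Real.log (f z')) z (stdVec i)) 0 (stdVec j) = 0 := by
  have hRt : Tendsto R (𝓝 0) (𝓝 0) := by
    have := hR.self_of_nhds.1.continuousAt.tendsto
    rwa [hR0] at this
  have hSt : Tendsto S (𝓝 0) (𝓝 0) := by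
    have := hS.self_of_nhds.1.continuousAt.tendsto
    rwa [hS0] at this
  refine fderiv_fderiv_eq_zero_of_double_difference hO
    (hf.log fun y hy => (hf0 y hy).ne') h0 hij fun ε hε => ?_
  have hsmall : ∀ᶠ y : Euc n in 𝓝 0, ∀ k, |y k| < ε := by
    rw [eventually_all]
    intro k
    have hc : Continuous fun y : Euc n => |y k| := (stdCoord k).continuous.abs
    exact hc.continuousAt.eventually_lt continuousAt_const (by simpa using hε)
  obtain ⟨y, hyne, hyO, hyε, hRε, hSε, ⟨-, haO, ha, hai, -⟩, ⟨-, hbO, hb, hbj, -⟩,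
      ⟨-, hcO, hc, hci, -⟩, ⟨-, -, hc', -, -⟩, hcomm⟩ :=
    (dense_off_axes n).inter_nhds_nonempty ((hO.eventually_mem h0).and <| hsmall.and <|
      (hRt.eventually hsmall).and <| (hSt.eventually hsmall).and <| hR.and <| hS.and <|
      (hSt.eventually hR).and <| (hRt.eventually hS).and hRS)
  -- a reflection changes the sign of the coordinate it moves
  have key : ∀ (k : Fin n) (u : Euc n), u ∈ O → u k * f u = -(y k * f y) → y k ≠ u k := by
    intro k u hu h hk
    rw [← hk] at h
    have h1 : y k * (f u + f y) = 0 := by linear_combination h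
    exact (mul_ne_zero (hyne k) (add_pos (hf0 u hu) (hf0 y hyO)).ne') h1
  have ea : R y = setCoord y i (R y i) := eq_setCoord ha
  have eb : S y = setCoord y j (S y j) := eq_setCoord hb
  have ec : R (S y) = setCoord (setCoord y i (R y i)) j (S y j) := by
    rw [← ea]
    refine (eq_setCoord (i := j) fun k hk => ?_).trans (by rw [hc j hij.symm])
    rw [hcomm, hc' k hk]
  refine ⟨y, R y i, S y j, fun k => by simpa using hyε k, by simpa using hRε i,
    by simpa using hSε j, key i _ haO hai, key j _ hbO hbj, ?_⟩
  rw [← ec, ← ea, ← eb]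
  have hy0 := hf0 y hyO
  have ha0 := hf0 _ haO
  have hb0 := hf0 _ hbO
  have hc0 := hf0 _ hcO
  have hcomm' : R (S y) i = R y i := by rw [hcomm, hc' i hij]
  rw [hcomm', hb i hij] at hci
  have hmul : f (R (S y)) * f y = f (S y) * f (R y) := by
    have h1 : y i * (f (R (S y)) * f y) = y i * (f (S y) * f (R y)) := by
      linear_combination f (R (S y)) * hai - f (R y) * hci
    exact mul_left_cancel₀ (hyne i) h1
  have hlog := congrArg Real.log hmul
  rw [Real.log_mul hc0.ne' hy0.ne', Real.log_mul hb0.ne' ha0.ne'] at hlog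
  linear_combination hlog

end

section

variable {n : ℕ} {M : Type*} [TopologicalSpace M] [ChartedSpace (Euc n) M]
variable {W : DivergenceFreeWeb n M}

/-- The reflections at `p` are determined by the mean value `f(y)` of `|h|` over the box spanned by `0`
and `y`, and the mixed second derivatives of `log f` at `0` are a quarter of those of `log |h|`. -/
theorem DivergenceFreeWeb.mixedPartialsVanish_of_reflectionHolonomy_eq_bot
    [IsManifold (𝓡 n) ∞ M] (h : ∀ p, W.reflectionHolonomy p = ⊥) : W.MixedPartialsVanish := by
  refine W.mixedPartialsVanish_of_exists fun p => ?_
  obtain ⟨e, he, hp, hp0⟩ := W.exists_adaptedChart p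
  refine ⟨e, he, hp, fun i j hij => ?_⟩
  have h0t : (0 : Euc n) ∈ e.target := hp0 ▸ e.map_source hp
  have hg0 : ∀ y ∈ e.target, 0 < |W.density e y| := fun y hy => W.abs_density_pos he hy
  have hg : ContDiffOn ℝ ∞ (fun y => |W.density e y|) e.target :=
    fun y hy => (W.contDiffOn_density he.1 y hy).abs (W.density_ne_zero he.1 hy)
  have hOs : ∀ t ∈ unitCube n, ∀ y ∈ e.target, coordScale t y ∈ e.target :=
    fun t ht y hy => he.coordScale_mem_target h0t ht hy
  have hf0 : ∀ y ∈ e.target, 0 < boxMean (fun _ => 1) (fun y => |W.density e y|) y :=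
    fun y hy => boxMean_pos hOs hg.continuousOn hg0 hy
  have hf := contDiffOn_boxMean e.open_target hOs (w := fun _ => 1) continuous_const hg
  obtain ⟨R, hR0, hR⟩ := exists_involution e.open_target h0t hf (hf0 0 h0t).ne' j
  obtain ⟨S, hS0, hS⟩ := exists_involution e.open_target h0t hf (hf0 0 h0t).ne' i
  obtain ⟨hr, hrr⟩ := W.isReflection_of_involution he hp hp0 hR0 hR
  obtain ⟨hs, hss⟩ := W.isReflection_of_involution he hp hp0 hS0 hS
  have hcomm := eventually_comm_of_reflectionHolonomy_eq_bot (h p) hr hrr hs hss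
  have hsymm : Tendsto e.symm (𝓝 0) (𝓝 p) := by
    have := e.tendsto_symm hp
    rwa [hp0] at this
  have hRt : Tendsto R (𝓝 0) (𝓝 0) := by
    have := hR.self_of_nhds.1.continuousAt.tendsto
    rwa [hR0] at this
  have hSt : Tendsto S (𝓝 0) (𝓝 0) := by
    have := hS.self_of_nhds.1.continuousAt.tendsto
    rwa [hS0] at this
  have hRS : ∀ᶠ y in 𝓝 0, R (S y) = S (R y) := by
    filter_upwards [hsymm.eventually hcomm, e.open_target.eventually_mem h0t, hR, hS,
      hSt.eventually hR, hRt.eventually hS] with y hy hyt hRy hSy hRSy hSRy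
    simp only [Function.comp_apply] at hy
    rw [e.right_inv hyt, e.right_inv hSy.2.1, e.right_inv hRy.2.1] at hy
    exact e.symm.injOn hRSy.2.1 hSRy.2.1 hy
  have h1 := fderiv_fderiv_log_eq_zero_of_commute e.open_target h0t hf hf0 hij.symm hR0 hS0 hR hS
    hRS
  rw [fderiv_fderiv_log_boxMean e.open_target hOs hg (fun y hy => (hg0 y hy).ne')
    (fun y hy => (hf0 y hy).ne') h0t hij.symm] at h1
  simp only [Real.log_abs] at h1
  unfold logDensityPartial
  rw [hp0]
  linear_combination 4 * h1

end

theorem mainTheorem1 {n : ℕ} (hn : 1 ≤ n) {M : Type*} [TopologicalSpace M] [T2Space M]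
    [SecondCountableTopology M] [ChartedSpace (Euc n) M] [IsManifold (𝓡 n) ∞ M]
    (W : DivergenceFreeWeb n M) :
    List.TFAE [
      W.IsLocallyTrivial,
      ∀ (i j : Fin n) (F G K A B C D : Set M), i ≠ j → W.SubdividesIntoFour i j F G K A B C D →
        W.vol A * W.vol C = W.vol B * W.vol D,
      ∀ (i j : Fin n) (F G K A B C D : Set M), i ≠ j → W.SubdividesIntoFour i j F G K A B C D →
        W.vol A + W.vol B = W.vol C + W.vol D → W.vol A = W.vol B →
        W.vol A = W.vol B ∧ W.vol B = W.vol C ∧ W.vol C = W.vol D,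
      ∀ K : Set M, W.IsRegion K → ∀ (k : ℕ) (hk : k ≤ n), 1 ≤ k →
        ∃ (F : Fin k → Set M) (R : (Fin k → Bool) → Set M),
          W.SubdividesIntoPow hk F K R ∧ ∀ s t, W.vol (R s) = W.vol (R t),
      ∀ p : M, W.reflectionHolonomy p = ⊥,
      ∀ p : M, W.nonuniformity p = 0] := by
  have h6 := W.mixedPartialsVanish_iff_nonuniformity
  tfae_have 6 → 2 := fun h i j F G K A B C D hij hs => (h6.2 h).mul_eq_mul hij hs
  tfae_have 2 → 3 := fun h i j F G K A B C D hij hs hsum hab => by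
    have hmul := h i j F G K A B C D hij hs
    have h0 : 0 ≤ W.vol C := W.vol_nonneg C
    have h0' : 0 ≤ W.vol D := W.vol_nonneg D
    rw [← hab] at hmul
    rcases eq_or_ne (W.vol A) 0 with hA | hA
    · exact ⟨hab, by linarith, by linarith⟩
    · have := mul_left_cancel₀ hA hmul
      exact ⟨hab, by linarith, this⟩
  tfae_have 3 → 6 := fun h => h6.1 <|
    DivergenceFreeWeb.mixedPartialsVanish_of_bisectionCompatible fun _ he _ _ hlu =>
      DivergenceFreeWeb.bisectionCompatible_of_four h he hlu
  tfae_have 6 → 4 := fun h K hK k hk _ => (h6.2 h).exists_subdividesIntoPow hK hk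
  tfae_have 4 → 6 := fun h => h6.1 <|
    DivergenceFreeWeb.mixedPartialsVanish_of_bisectionCompatible fun _ he _ _ hlu =>
      DivergenceFreeWeb.bisectionCompatible_of_pow (fun K hK => h K hK n le_rfl hn) he hlu
  tfae_have 6 → 5 := fun h p => (h6.2 h).reflectionHolonomy_eq_bot p
  tfae_have 5 → 6 := fun h => h6.1 <|
    DivergenceFreeWeb.mixedPartialsVanish_of_reflectionHolonomy_eq_bot h
  tfae_have 6 → 1 := fun h => (h6.2 h).isLocallyTrivial hn
  tfae_have 1 → 6 := fun h => h6.1 h.mixedPartialsVanish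
  tfae_finish
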